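/- For $\theta>-1$ let $m(\theta)=1+\theta$ and $\beta_c(\theta)=2$ if $\theta\le 0$, and $m(\theta)=\sqrt{1+\theta}$ and $\beta_c(\theta)=2\sqrt{1+\theta}$ if $\theta>0$. For $\beta>0$ put $$f_\theta(\beta)=\begin{cases}\frac{\beta^2}{4}\,(1+\min(\theta,0))+\theta, & \beta\le\beta_c(\theta),\\ \beta\, m(\theta)-1, & \beta>\beta_c(\theta).\end{cases}$$ For $T>1$ let $\tau$ be uniformly distributed on $[T,2T]$ under $\mathbb P$. For an integer $K\ge 4$ put $\sigma_0=\frac12+\frac{(\log T)^{3/(2K)}}{\log T}$ and, for $1\le j\le K-3$ and $h\in\mathbb R$, $$P_j(h)=\mathrm{Re}\sum_{p\in J_j}\frac{1}{p^{\sigma_0+i\tau+ih}},\qquad J_j=\Big\{p\text{ prime}:\ \exp\big((\log T)^{j/K}\big)<p\le \exp\big((\log T)^{(j+1)/K}\big)\Big\}.$$ **Proposition 3.10.** Let $\theta>-1$, $\beta>0$ and $\varepsilon>0$. There is $K_0=K_0(\theta,\beta,\varepsilon)$ such that for every integer $K\ge K_0$, as $T\to\infty$, $$\mathbb P\Big(\int_{-\log^\theta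 T}^{\log^\theta T}\exp\Big(\beta\sum_{j=1}^{K-3}P_j(h)\Big)\,dh>(\log T)^{f_\theta(\beta)-\varepsilon}\Big)=1-o(1).$$ -/

import Mathlib

open MeasureTheory ProbabilityTheory Filter Topology

noncomputable section

namespace ZetaFreezing

/-- The law of `τ`: the uniform probability measure on `[T, 2T]` (for `T > 0`). -/
def uniformLaw (T : ℝ) : Measure ℝ := (volume : Measure ℝ)[|Set.Icc T (2 * T)]

/-- `m(θ) = 1 + θ` if `θ ≤ 0` and `m(θ) = √(1 + θ)` if `θ > 0`. -/
def m (θ : ℝ) : ℝ := if θ ≤ 0 then 1 + θ else Real.sqrt (1 + θ)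

/-- The critical value `β_c(θ)`: it is `2` if `θ ≤ 0` and `2 √(1 + θ)` if `θ > 0`. -/
def betaC (θ : ℝ) : ℝ := if θ ≤ 0 then 2 else 2 * Real.sqrt (1 + θ)

/-- The free energy `f_θ(β)`. -/
def freeEnergy (θ β : ℝ) : ℝ :=
  if β ≤ betaC θ then
    (if θ ≤ 0 then β ^ 2 / 4 * (1 + θ) + θ else β ^ 2 / 4 + θ)
  else β * m θ - 1

/-- The abscissa `σ₀ = 1/2 + (log T)^{3/(2K)} / log T`. -/
def sigma0 (K : ℕ) (T : ℝ) : ℝ :=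
  1 / 2 + Real.log T ^ (3 / (2 * (K : ℝ))) / Real.log T

/-- The end points `exp((log T)^{j/K})` of the blocks of primes. -/
def blockEnd (K : ℕ) (T : ℝ) (j : ℕ) : ℝ :=
  Real.exp (Real.log T ^ ((j : ℝ) / (K : ℝ)))

/-- The block `J_j` of the primes `p` with
`exp((log T)^{j/K}) < p ≤ exp((log T)^{(j+1)/K})`; see `mem_primeBlock`. -/
def primeBlock (K : ℕ) (T : ℝ) (j : ℕ) : Finset ℕ :=
  (Finset.Ioc ⌊blockEnd K T j⌋₊ ⌊blockEnd K T (j + 1)⌋₊).filter Nat.Prime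

theorem mem_primeBlock (K : ℕ) (T : ℝ) (j p : ℕ) :
    p ∈ primeBlock K T j ↔
      p.Prime ∧ blockEnd K T j < (p : ℝ) ∧ (p : ℝ) ≤ blockEnd K T (j + 1) := by
  have h0 : ∀ i, 0 ≤ blockEnd K T i := fun i => (Real.exp_pos _).le
  simp only [primeBlock, Finset.mem_filter, Finset.mem_Ioc, Nat.floor_lt (h0 j),
    Nat.le_floor_iff (h0 (j + 1))]
  tauto

/-- `P_j(h) = Re ∑_{p ∈ J_j} p^{-(σ₀ + iτ + ih)}`, as a function of the value `t` of `τ`. -/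
def P (K : ℕ) (T : ℝ) (j : ℕ) (t h : ℝ) : ℝ :=
  (∑ p ∈ primeBlock K T j,
    1 / (p : ℂ) ^ ((sigma0 K T : ℂ) + Complex.I * (t : ℂ) + Complex.I * (h : ℂ))).re

end ZetaFreezing

end

/-!
Write `A = log T`, `n = log A`, `L = A ^ θ`. By `sum_P_eq`, `∑ j, P_j(h)` is the real part at
`τ + h` of a Dirichlet polynomial `S` over the primes with `A ^ (1/K) < log p ≤ A ^ ((K-2)/K)`.
It behaves like a log-correlated Gaussian field: its variance is about `n / 2`, and two points at
distance `A ^ (-s)` share the part of the field that comes from the primes with `log p ≤ A ^ s`.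
The integral is dominated by the points where the field is about `x n (1 + min θ 0)`, where
`x = β / 2` below the critical value and `x` is frozen at its critical value above it
(`exists_tilt`). When `θ < 0` the part of the field that comes from the primes with
`log p ≤ A ^ (-θ)` is almost constant on the interval, and it is not used.

The lower bound is a second moment method for a truncated density. The primes are cut into `r`
blocks `A ^ (s_i) < log p ≤ A ^ (s_{i+1})`, and `φ(u) = exp (2 x Re F(u))` where no block `F_i` of
`F = ∑ F_i` is much larger than `x` times its square norm `v_i` and where `S` is as large as it is
typically under this density; elsewhere `φ = 0` (`ScaleData.phi`). On the support of `φ` the density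
`exp (2 x Re F)` is at most an explicit constant and `exp (β Re S)` is at least another one, so that
a lower bound for `∫ φ` gives one for the integral (`ScaleData.mul_integral_phi_le`). The exponents
match as the mesh of the blocks tends to zero (`freeEnergy_sub_le`).

* One point: the truncation removes little of the mean of `exp (2 x Re F)`, by Chernoff's bound
  (`ScaleData.eventually_le_mean_phi`).
* Two points: the blocks that are decorrelated at the given distance contribute the square of the
  mean, the others are bounded by the truncation (`ScaleData.eventually_mean_phi_mul_phi_le`). The
  excess coming from close pairs is negligible because `x ^ 2 ≤ 1 + max θ 0`
  (`sum_exp_mul_rpow_le`). Hence `∫ φ` concentrates (`second_moment`).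

Two facts about primes carry this. First, since all the primes are at most `exp (A ^ υ)` with
`υ < 1`, the exponential of a Dirichlet polynomial over them, truncated where the polynomial is at
most a multiple of `n ^ 2`, can be replaced by a Taylor polynomial of degree `O(n ^ 2)`, whose
frequencies are so well separated that its mean square over an interval of length `T` is the sum of
its squared coefficients: this gives exponential moments as for independent variables
(`eventually_mean_cutExp_le`, `eventually_le_mean_cutExp`, `eventually_mean_large_le`). Second, the
squared coefficients of `F_i` are the smooth weights `p⁻¹ (p ^ (-δ') - p ^ (-δ))`, so that the
correlations `∑ p, b_p ^ 2 cos (t log p)` are increments of `log |ζ|` just to the right of the line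
`Re s = 1` (`abs_sum_smoothWeight_sub_le`). These are small at the relevant distances: near `s = 1`
by the simple pole, and at heights up to a power of `log T` by the `3-4-1` inequality
(`eventually_log_zeta_sub_le`). No prime number theorem is needed.
-/

noncomputable section

namespace ZetaFreezing

/-! ### Mean squares of exponential sums -/

lemma norm_integral_exp_le (a T w : ℝ) (hw : w ≠ 0) :
    ‖∫ u in a..(a + T), Complex.exp (-(Complex.I * ((u * w : ℝ) : ℂ)))‖ ≤ 2 / |w| := by
  have hc : (-(Complex.I * w) : ℂ) ≠ 0 := by
    simp [hw]
  have h1 : ∀ u : ℝ, Complex.exp (-(Complex.I * ((u * w : ℝ) : ℂ)))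
      = Complex.exp (-(Complex.I * w) * u) := by
    intro u; congr 1; push_cast; ring
  have hn : ∀ u : ℝ, ‖Complex.exp (-(Complex.I * w) * u)‖ = 1 := by
    intro u; rw [Complex.norm_exp]; simp
  simp_rw [h1]
  rw [integral_exp_mul_complex hc, norm_div]
  have h2 : ‖(-(Complex.I * w) : ℂ)‖ = |w| := by simp
  rw [h2]
  gcongr
  refine (norm_sub_le _ _).trans ?_
  rw [hn, hn]; norm_num

lemma normSq_sum_eq {ι : Type*} (I : Finset ι) (f : ι → ℂ) :
    ((‖∑ i ∈ I, f i‖ ^ 2 : ℝ) : ℂ) = ∑ i ∈ I, ∑ j ∈ I, f i * (starRingEnd ℂ) (f j) := by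
  rw [← Finset.sum_mul_sum, ← map_sum, Complex.mul_conj, Complex.normSq_eq_norm_sq]

/-- Mean value theorem for a finite exponential sum with frequencies separated by `γ`. -/
lemma abs_integral_normSq_sub_le {ι : Type*} (I : Finset ι) (c : ι → ℂ) (w : ι → ℝ) (a : ℝ)
    {γ T : ℝ} (hγ : 0 < γ) (hw : ∀ i ∈ I, ∀ j ∈ I, i ≠ j → γ ≤ |w i - w j|) :
    |(∫ u in a..(a + T), ‖∑ i ∈ I, c i * Complex.exp (-(Complex.I * ((u * w i : ℝ) : ℂ)))‖ ^ 2)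
        - T * ∑ i ∈ I, ‖c i‖ ^ 2| ≤ (∑ i ∈ I, ‖c i‖) ^ 2 * (2 / γ) := by
  classical
  have hexp : ∀ (u : ℝ) (i j : ι), (c i * Complex.exp (-(Complex.I * ((u * w i : ℝ) : ℂ))))
      * (starRingEnd ℂ) (c j * Complex.exp (-(Complex.I * ((u * w j : ℝ) : ℂ))))
      = c i * (starRingEnd ℂ) (c j)
        * Complex.exp (-(Complex.I * ((u * (w i - w j) : ℝ) : ℂ))) := by
    intro u i j
    rw [map_mul, ← Complex.exp_conj]
    have : Complex.exp (-(Complex.I * ((u * (w i - w j) : ℝ) : ℂ)))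
      = Complex.exp (-(Complex.I * ((u * w i : ℝ) : ℂ)))
        * Complex.exp ((starRingEnd ℂ) (-(Complex.I * ((u * w j : ℝ) : ℂ)))) := by
      rw [← Complex.exp_add]
      congr 1
      simp only [map_neg, map_mul, Complex.conj_I, Complex.conj_ofReal]
      push_cast; ring
    rw [this]; ring
  -- after expanding the square, the diagonal terms give the main term
  have hkey : (((∫ u in a..(a + T),
        ‖∑ i ∈ I, c i * Complex.exp (-(Complex.I * ((u * w i : ℝ) : ℂ)))‖ ^ 2)
        - T * ∑ i ∈ I, ‖c i‖ ^ 2 : ℝ) : ℂ)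
      = ∑ i ∈ I, ∑ j ∈ I, if i = j then 0 else c i * (starRingEnd ℂ) (c j) *
          ∫ u in a..(a + T), Complex.exp (-(Complex.I * ((u * (w i - w j) : ℝ) : ℂ))) := by
    rw [Complex.ofReal_sub, Complex.ofReal_mul, Complex.ofReal_sum,
      ← intervalIntegral.integral_ofReal]
    have h1 : ∀ u : ℝ, ((‖∑ i ∈ I, c i *
        Complex.exp (-(Complex.I * ((u * w i : ℝ) : ℂ)))‖ ^ 2 : ℝ) : ℂ)
        = ∑ i ∈ I, ∑ j ∈ I, c i * (starRingEnd ℂ) (c j)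
        * Complex.exp (-(Complex.I * ((u * (w i - w j) : ℝ) : ℂ))) := by
      intro u
      rw [normSq_sum_eq]
      exact Finset.sum_congr rfl fun i _ => Finset.sum_congr rfl fun j _ => hexp u i j
    have hcont : ∀ i j : ι, Continuous fun u : ℝ => c i * (starRingEnd ℂ) (c j)
        * Complex.exp (-(Complex.I * ((u * (w i - w j) : ℝ) : ℂ))) := by
      intro i j; fun_prop
    simp_rw [h1]
    rw [intervalIntegral.integral_finsetSum]
    swap
    · intro i _
      exact (continuous_finsetSum _ fun j _ => hcont i j).intervalIntegrable _ _
    rw [Finset.mul_sum, ← Finset.sum_sub_distrib]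
    refine Finset.sum_congr rfl fun i hi => ?_
    rw [intervalIntegral.integral_finsetSum]
    swap
    · intro j _
      exact (hcont i j).intervalIntegrable _ _
    have h2 : (T : ℂ) * ((‖c i‖ ^ 2 : ℝ) : ℂ)
        = ∑ j ∈ I, if i = j then (T : ℂ) * (c i * (starRingEnd ℂ) (c j)) else 0 := by
      rw [Finset.sum_ite_eq, if_pos hi, Complex.mul_conj, Complex.normSq_eq_norm_sq]
    rw [h2, ← Finset.sum_sub_distrib]
    refine Finset.sum_congr rfl fun j _ => ?_
    by_cases hij : i = j
    · subst hij
      simp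
      ring
    · simp only [hij, if_false, sub_zero]
      rw [intervalIntegral.integral_const_mul]
  have hnorm := congrArg norm hkey
  rw [Complex.norm_real, Real.norm_eq_abs] at hnorm
  rw [hnorm, sq, Finset.sum_mul_sum, Finset.sum_mul]
  refine (norm_sum_le _ _).trans (Finset.sum_le_sum fun i hi => ?_)
  rw [Finset.sum_mul]
  refine (norm_sum_le _ _).trans (Finset.sum_le_sum fun j hj => ?_)
  by_cases hij : i = j
  · simp only [hij, if_true, norm_zero]; positivity
  · simp only [hij, if_false, norm_mul, RCLike.norm_conj]
    have h3 := hw i hi j hj hij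
    have h4 : w i - w j ≠ 0 := by
      intro h0; rw [h0, abs_zero] at h3; linarith
    gcongr
    refine (norm_integral_exp_le a T _ h4).trans ?_
    gcongr

/-! ### Polynomials in a Dirichlet polynomial over primes -/

/-- The Dirichlet polynomial `u ↦ ∑_{p ∈ s} z_p p^{-iu}`. -/
def dirPoly (s : Finset ℕ) (z : ℕ → ℂ) (u : ℝ) : ℂ :=
  ∑ p ∈ s, z p * Complex.exp (-(Complex.I * ((u * Real.log p : ℝ) : ℂ)))

@[fun_prop]
lemma continuous_dirPoly (s : Finset ℕ) (z : ℕ → ℂ) : Continuous (dirPoly s z) := by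
  unfold dirPoly; fun_prop

/-- The indices `(k, α)` of the monomials of degree `k ≤ D` in the variables indexed by `s`. -/
def monomials (s : Finset ℕ) (D : ℕ) : Finset (Σ _ : ℕ, ℕ → ℕ) :=
  (Finset.range (D + 1)).sigma fun k => Finset.piAntidiag s k

/-- The coefficient of the monomial `α` of degree `k` in `∑ k, g k * (∑ p, z p X_p) ^ k / k!`. -/
def monCoeff (s : Finset ℕ) (z : ℕ → ℂ) (g : ℕ → ℝ) (i : Σ _ : ℕ, ℕ → ℕ) : ℂ :=
  (g i.1 : ℂ) * ∏ p ∈ s, z p ^ i.2 p / (i.2 p).factorial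

lemma multinomial_div_factorial {s : Finset ℕ} {k : ℕ} {α : ℕ → ℕ}
    (h : α ∈ Finset.piAntidiag s k) {𝕜 : Type*} [Field 𝕜] [CharZero 𝕜] :
    (Nat.multinomial s α : 𝕜) / k.factorial = ∏ p ∈ s, (1 : 𝕜) / (α p).factorial := by
  have h1 := Nat.multinomial_spec s α
  rw [(Finset.mem_piAntidiag.1 h).1] at h1
  have h2 : ((∏ i ∈ s, (α i).factorial : ℕ) : 𝕜) * Nat.multinomial s α = k.factorial := by
    exact_mod_cast h1
  have h3 : (∏ i ∈ s, ((α i).factorial : 𝕜)) ≠ 0 :=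
    Finset.prod_ne_zero_iff.2 fun i _ => by exact_mod_cast (Nat.factorial_ne_zero _)
  have h4 : (k.factorial : 𝕜) ≠ 0 := by exact_mod_cast (Nat.factorial_ne_zero _)
  push_cast at h2
  rw [Finset.prod_div_distrib, Finset.prod_const_one, div_eq_div_iff h4 h3, ← h2]
  ring

lemma sum_pow_div_factorial {𝕜 : Type*} [Field 𝕜] [CharZero 𝕜] (s : Finset ℕ) (x : ℕ → 𝕜)
    (k : ℕ) :
    (∑ p ∈ s, x p) ^ k / k.factorial
      = ∑ α ∈ Finset.piAntidiag s k, ∏ p ∈ s, x p ^ α p / (α p).factorial := by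
  rw [Finset.sum_pow_eq_sum_piAntidiag, Finset.sum_div]
  refine Finset.sum_congr rfl fun α hα => ?_
  rw [mul_div_right_comm, multinomial_div_factorial hα, ← Finset.prod_mul_distrib]
  exact Finset.prod_congr rfl fun p _ => by ring

/-- The frequency of the monomial `α`, the logarithm of `∏ p ^ α p`. -/
def monFreq (s : Finset ℕ) (i : Σ _ : ℕ, ℕ → ℕ) : ℝ := ∑ p ∈ s, (i.2 p : ℝ) * Real.log p

lemma sum_pow_dirPoly (s : Finset ℕ) (z : ℕ → ℂ) (g : ℕ → ℝ) (D : ℕ) (u : ℝ) :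
    ∑ k ∈ Finset.range (D + 1), (g k : ℂ) * (dirPoly s z u ^ k / k.factorial)
      = ∑ i ∈ monomials s D,
          monCoeff s z g i * Complex.exp (-(Complex.I * ((u * monFreq s i : ℝ) : ℂ))) := by
  rw [monomials, Finset.sum_sigma]
  refine Finset.sum_congr rfl fun k _ => ?_
  rw [dirPoly, sum_pow_div_factorial, Finset.mul_sum]
  refine Finset.sum_congr rfl fun α _ => ?_
  have h : Complex.exp (-(Complex.I * ((u * monFreq s ⟨k, α⟩ : ℝ) : ℂ)))
      = ∏ p ∈ s, Complex.exp (-(Complex.I * ((u * Real.log p : ℝ) : ℂ))) ^ α p := by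
    simp_rw [← Complex.exp_nat_mul]
    rw [← Complex.exp_sum]
    congr 1
    simp only [monFreq]
    push_cast
    rw [Finset.mul_sum, Finset.mul_sum, ← Finset.sum_neg_distrib]
    exact Finset.sum_congr rfl fun p _ => by ring
  rw [h, monCoeff, mul_assoc, ← Finset.prod_mul_distrib]
  congr 1
  exact Finset.prod_congr rfl fun p _ => by rw [mul_pow]; ring

lemma monFreq_eq_log {s : Finset ℕ} (hs : ∀ p ∈ s, p.Prime) (i : Σ _ : ℕ, ℕ → ℕ) :
    monFreq s i = Real.log ((∏ p ∈ s, p ^ i.2 p : ℕ) : ℝ) := by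
  push_cast
  rw [Real.log_prod]
  · simp [monFreq]
  · intro p hp
    have := (hs p hp).pos
    positivity

/-- Distinct monomials have distinct frequencies, by unique factorization. -/
lemma prod_pow_injOn {s : Finset ℕ} (hs : ∀ p ∈ s, p.Prime) (D : ℕ) :
    Set.InjOn (fun i : Σ _ : ℕ, ℕ → ℕ => ∏ p ∈ s, p ^ i.2 p) (monomials s D) := by
  rintro ⟨k, α⟩ hi ⟨l, β⟩ hj hij
  simp only [monomials, Finset.coe_sigma, Set.mem_sigma_iff, Finset.mem_coe,
    Finset.mem_piAntidiag] at hi hj hij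
  have hfac : ∀ γ : ℕ → ℕ, ∀ q ∈ s, (∏ p ∈ s, p ^ γ p).factorization q = γ q := by
    intro γ q hq
    rw [Nat.factorization_prod (fun p hp => pow_ne_zero _ (hs p hp).ne_zero)]
    rw [Finsupp.finsetSum_apply]
    rw [Finset.sum_eq_single q]
    · rw [(hs q hq).factorization_pow]; simp
    · intro p hp hpq
      rw [(hs p hp).factorization_pow]; simp [hpq]
    · intro h; exact absurd hq h
  have hab : α = β := by
    funext q
    by_cases hq : q ∈ s
    · rw [← hfac α q hq, hij, hfac β q hq]
    · have h1 : α q = 0 := by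
        by_contra h; exact hq (hi.2.2 q h)
      have h2 : β q = 0 := by
        by_contra h; exact hq (hj.2.2 q h)
      rw [h1, h2]
  subst hab
  have hkl : k = l := by rw [← hi.2.1, ← hj.2.1]
  subst hkl
  rfl

lemma one_div_le_abs_log_sub_log {M N : ℕ} (hM : 0 < M) (hN : 0 < N) (hMN : M ≠ N) {B : ℝ}
    (hMB : (M : ℝ) ≤ B) (hNB : (N : ℝ) ≤ B) :
    1 / B ≤ |Real.log M - Real.log N| := by
  wlog h : M < N generalizing M N
  · rw [abs_sub_comm]
    exact this hN hM hMN.symm hNB hMB (lt_of_le_of_ne (not_lt.1 h) hMN.symm)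
  have hM' : (0 : ℝ) < M := by exact_mod_cast hM
  have hN' : (0 : ℝ) < N := by exact_mod_cast hN
  have hB : 0 < B := hN'.trans_le hNB
  have h1 : (M : ℝ) + 1 ≤ N := by exact_mod_cast h
  have h2 : Real.log (M / N) ≤ M / N - 1 := Real.log_le_sub_one_of_pos (by positivity)
  rw [Real.log_div hM'.ne' hN'.ne'] at h2
  have h3 : (M : ℝ) / N - 1 ≤ -(1 / B) := by
    have : (M : ℝ) / N - 1 = -((N - M) / N) := by field_simp; ring
    rw [this]
    apply neg_le_neg
    rw [div_le_div_iff₀ hB hN']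
    nlinarith
  rw [abs_sub_comm]
  refine le_trans ?_ (le_abs_self _)
  linarith

lemma monFreq_separated {s : Finset ℕ} (hs : ∀ p ∈ s, p.Prime) {Y : ℝ} (hY : 1 ≤ Y)
    (hsY : ∀ p ∈ s, (p : ℝ) ≤ Y) (D : ℕ) :
    ∀ i ∈ monomials s D, ∀ j ∈ monomials s D, i ≠ j →
      1 / Y ^ D ≤ |monFreq s i - monFreq s j| := by
  have hpos : ∀ i : Σ _ : ℕ, ℕ → ℕ, 0 < ∏ p ∈ s, p ^ i.2 p := fun i =>
    Finset.prod_pos fun p hp => pow_pos (hs p hp).pos _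
  have hle : ∀ i ∈ monomials s D, ((∏ p ∈ s, p ^ i.2 p : ℕ) : ℝ) ≤ Y ^ D := by
    rintro ⟨k, α⟩ hi
    simp only [monomials, Finset.mem_sigma, Finset.mem_range, Finset.mem_piAntidiag] at hi
    push_cast
    calc ∏ p ∈ s, (p : ℝ) ^ α p ≤ ∏ p ∈ s, Y ^ α p :=
          Finset.prod_le_prod (fun p _ => by positivity)
            fun p hp => pow_le_pow_left₀ (by positivity) (hsY p hp) _
      _ = Y ^ k := by rw [Finset.prod_pow_eq_pow_sum, hi.2.1]
      _ ≤ Y ^ D := pow_le_pow_right₀ hY (by omega)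
  intro i hi j hj hij
  rw [monFreq_eq_log hs, monFreq_eq_log hs]
  refine one_div_le_abs_log_sub_log (hpos i) (hpos j) ?_ (hle i hi) (hle j hj)
  intro h
  exact hij (prod_pow_injOn hs D hi hj h)

/-- Mean value of a polynomial in a Dirichlet polynomial over the primes of `s`: up to an error
that is harmless when `Y ^ D` is much smaller than `T`, it is the sum of the squared
coefficients. -/
lemma abs_integral_normSq_dirPoly_sub_le {s : Finset ℕ} (hs : ∀ p ∈ s, p.Prime) {Y : ℝ} (hY : 1 ≤ Y)
    (hsY : ∀ p ∈ s, (p : ℝ) ≤ Y) {z : ℕ → ℂ} (g : ℕ → ℝ) (D : ℕ) (a T : ℝ) :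
    |(∫ u in a..(a + T),
        ‖∑ k ∈ Finset.range (D + 1), (g k : ℂ) * (dirPoly s z u ^ k / k.factorial)‖ ^ 2)
        - T * ∑ i ∈ monomials s D, ‖monCoeff s z g i‖ ^ 2|
      ≤ (∑ k ∈ Finset.range (D + 1), |g k| * ((∑ p ∈ s, ‖z p‖) ^ k / k.factorial)) ^ 2
        * (2 * Y ^ D) := by
  have h := abs_integral_normSq_sub_le (monomials s D) (monCoeff s z g) (monFreq s) a (T := T)
    (γ := 1 / Y ^ D) (by positivity) (monFreq_separated hs hY hsY D)
  simp_rw [← sum_pow_dirPoly] at h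
  refine h.trans (le_of_eq ?_)
  have h1 : ∑ i ∈ monomials s D, ‖monCoeff s z g i‖
      = ∑ k ∈ Finset.range (D + 1), |g k| * ((∑ p ∈ s, ‖z p‖) ^ k / k.factorial) := by
    rw [monomials, Finset.sum_sigma]
    refine Finset.sum_congr rfl fun k _ => ?_
    rw [sum_pow_div_factorial, Finset.mul_sum]
    refine Finset.sum_congr rfl fun α _ => ?_
    simp [monCoeff, norm_prod]
  rw [h1]
  field_simp

/-- Upper bound for the sum of the squared coefficients: `α! ^ 2` is replaced by `α!`, after which
the multinomial theorem applies. -/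
lemma sum_norm_monCoeff_sq_le (s : Finset ℕ) (z : ℕ → ℂ) (g : ℕ → ℝ) (D : ℕ) :
    ∑ i ∈ monomials s D, ‖monCoeff s z g i‖ ^ 2
      ≤ ∑ k ∈ Finset.range (D + 1), g k ^ 2 * ((∑ p ∈ s, ‖z p‖ ^ 2) ^ k / k.factorial) := by
  rw [monomials, Finset.sum_sigma]
  refine Finset.sum_le_sum fun k _ => ?_
  rw [sum_pow_div_factorial, Finset.mul_sum]
  refine Finset.sum_le_sum fun α _ => ?_
  simp only [monCoeff, norm_mul, norm_prod, norm_div, norm_pow, Complex.norm_real, mul_pow,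
    Real.norm_eq_abs, sq_abs, ← Finset.prod_pow]
  refine mul_le_mul_of_nonneg_left ?_ (sq_nonneg _)
  refine Finset.prod_le_prod (fun p _ => by positivity) fun p _ => ?_
  have h1 : (1 : ℝ) ≤ (α p).factorial := by exact_mod_cast Nat.succ_le_of_lt (Nat.factorial_pos _)
  rw [Complex.norm_natCast, div_pow, ← pow_mul, ← pow_mul, mul_comm 2 (α p)]
  gcongr
  nlinarith

/-- Lower bound for the sum of the squared coefficients of the truncated exponential, from the
square-free monomials. -/
lemma le_sum_norm_monCoeff_sq (s : Finset ℕ) (z : ℕ → ℂ) (D : ℕ) :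
    Real.exp (∑ p ∈ s, ‖z p‖ ^ 2 - ∑ p ∈ s, ‖z p‖ ^ 4)
        - Real.exp (2 * ∑ p ∈ s, ‖z p‖ ^ 2) / 2 ^ (D + 1)
      ≤ ∑ i ∈ monomials s D, ‖monCoeff s z (fun _ => 1) i‖ ^ 2 := by
  classical
  set y : ℕ → ℝ := fun p => ‖z p‖ ^ 2 with hy
  have hy0 : ∀ p, 0 ≤ y p := fun p => by positivity
  -- square-free monomials correspond to the subsets of `s`
  let ind : Finset ℕ → (Σ _ : ℕ, ℕ → ℕ) := fun A => ⟨A.card, fun p => if p ∈ A then 1 else 0⟩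
  have hind : Set.InjOn ind (s.powerset.filter fun A => A.card ≤ D) := by
    intro A _ B _ hAB
    have h2 : (fun p => if p ∈ A then 1 else 0) = (fun p => if p ∈ B then (1 : ℕ) else 0) := by
      have := congrArg (fun q : (Σ _ : ℕ, ℕ → ℕ) => q.2) hAB
      exact this
    ext p
    have := congrFun h2 p
    by_cases hA : p ∈ A <;> by_cases hB : p ∈ B <;> simp_all
  have hsub : (s.powerset.filter fun A => A.card ≤ D).image ind ⊆ monomials s D := by
    intro i hi
    obtain ⟨A, hA, rfl⟩ := Finset.mem_image.1 hi
    rw [Finset.mem_filter, Finset.mem_powerset] at hA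
    simp only [monomials, Finset.mem_sigma, Finset.mem_range, Finset.mem_piAntidiag, ind]
    refine ⟨by omega, ?_, ?_⟩
    · rw [Finset.sum_ite_mem, Finset.inter_eq_right.2 hA.1]; simp
    · intro p hp
      apply hA.1
      by_contra h
      simp [h] at hp
  have hcoef : ∀ A ∈ s.powerset.filter fun A => A.card ≤ D,
      ‖monCoeff s z (fun _ => 1) (ind A)‖ ^ 2 = ∏ p ∈ A, y p := by
    intro A hA
    rw [Finset.mem_filter, Finset.mem_powerset] at hA
    have h1 : ∏ p ∈ A, y p = ∏ p ∈ s, if p ∈ A then y p else 1 := by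
      rw [Finset.prod_ite_mem, Finset.inter_eq_right.2 hA.1]
    rw [h1, monCoeff]
    simp only [norm_mul, norm_prod, mul_pow, ← Finset.prod_pow, ind]
    simp only [Complex.ofReal_one, norm_one, one_pow, one_mul]
    refine Finset.prod_congr rfl fun p _ => ?_
    by_cases h : p ∈ A <;> simp [h, hy]
  have h1 : ∑ A ∈ s.powerset.filter (fun A => A.card ≤ D), ∏ p ∈ A, y p
      ≤ ∑ i ∈ monomials s D, ‖monCoeff s z (fun _ => 1) i‖ ^ 2 := by
    rw [← Finset.sum_congr rfl hcoef, ← Finset.sum_image (f := fun i =>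
      ‖monCoeff s z (fun _ => 1) i‖ ^ 2) hind]
    exact Finset.sum_le_sum_of_subset_of_nonneg hsub fun _ _ _ => by positivity
  refine le_trans ?_ h1
  have h2 : ∑ A ∈ s.powerset, ∏ p ∈ A, y p = ∏ p ∈ s, (1 + y p) := (Finset.prod_one_add s).symm
  -- Rankin's trick for the subsets with more than `D` elements
  have h3 : ∑ A ∈ s.powerset.filter (fun A => ¬ A.card ≤ D), ∏ p ∈ A, y p
      ≤ Real.exp (2 * ∑ p ∈ s, y p) / 2 ^ (D + 1) := by
    rw [le_div_iff₀ (by positivity), Finset.sum_mul]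
    calc ∑ A ∈ s.powerset.filter (fun A => ¬ A.card ≤ D), (∏ p ∈ A, y p) * 2 ^ (D + 1)
        ≤ ∑ A ∈ s.powerset.filter (fun A => ¬ A.card ≤ D), ∏ p ∈ A, (2 * y p) := by
          refine Finset.sum_le_sum fun A hA => ?_
          rw [Finset.prod_mul_distrib, Finset.prod_const, mul_comm]
          have hc : D + 1 ≤ A.card := by
            have := (Finset.mem_filter.1 hA).2; omega
          refine mul_le_mul_of_nonneg_right (pow_le_pow_right₀ one_le_two hc)
            (Finset.prod_nonneg fun p _ => hy0 p)
      _ ≤ ∑ A ∈ s.powerset, ∏ p ∈ A, (2 * y p) :=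
          Finset.sum_le_sum_of_subset_of_nonneg (Finset.filter_subset _ _) fun A _ _ =>
            Finset.prod_nonneg fun p _ => mul_nonneg zero_le_two (hy0 p)
      _ = ∏ p ∈ s, (1 + 2 * y p) := (Finset.prod_one_add s).symm
      _ ≤ ∏ p ∈ s, Real.exp (2 * y p) := Finset.prod_le_prod
          (fun p _ => by have := hy0 p; linarith) fun p _ => by
            have := Real.add_one_le_exp (2 * y p); linarith
      _ = Real.exp (2 * ∑ p ∈ s, y p) := by rw [← Real.exp_sum, Finset.mul_sum]
  have h4 : Real.exp (∑ p ∈ s, ‖z p‖ ^ 2 - ∑ p ∈ s, ‖z p‖ ^ 4) ≤ ∏ p ∈ s, (1 + y p) := by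
    rw [← Finset.sum_sub_distrib, Real.exp_sum]
    refine Finset.prod_le_prod (fun p _ => (Real.exp_pos _).le) fun p _ => ?_
    have hz4 : ‖z p‖ ^ 4 = y p ^ 2 := by rw [hy]; ring
    rw [hz4]
    change Real.exp (y p - y p ^ 2) ≤ _
    have hyp := hy0 p
    rw [← Real.le_log_iff_exp_le (by linarith)]
    have h5 := Real.one_sub_inv_le_log_of_pos (x := 1 + y p) (by linarith)
    refine le_trans ?_ h5
    have h6 : 1 - (1 + y p)⁻¹ = y p / (1 + y p) := by field_simp; ring
    rw [h6, le_div_iff₀ (by linarith)]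
    nlinarith [pow_nonneg hyp 3]
  have h5 := Finset.sum_filter_add_sum_filter_not s.powerset (fun A => A.card ≤ D)
    (fun A => ∏ p ∈ A, y p)
  rw [h2] at h5
  linarith

/-! ### Mean values of truncated exponentials -/

/-- The mean value of `f` over the interval `[a, a + T]`. -/
def mean (T a : ℝ) (f : ℝ → ℝ) : ℝ := T⁻¹ * ∫ u in a..(a + T), f u

lemma mean_mono {T a : ℝ} (hT : 0 < T) {f g : ℝ → ℝ}
    (hf : IntervalIntegrable f volume a (a + T)) (hg : IntervalIntegrable g volume a (a + T))
    (h : ∀ u, f u ≤ g u) : mean T a f ≤ mean T a g := by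
  unfold mean
  refine mul_le_mul_of_nonneg_left ?_ (inv_nonneg.2 hT.le)
  exact intervalIntegral.integral_mono (by linarith) hf hg h

lemma mean_add {T a : ℝ} {f g : ℝ → ℝ}
    (hf : IntervalIntegrable f volume a (a + T)) (hg : IntervalIntegrable g volume a (a + T)) :
    mean T a (fun u => f u + g u) = mean T a f + mean T a g := by
  unfold mean
  rw [intervalIntegral.integral_add hf hg, mul_add]

lemma mean_const_mul (T a c : ℝ) (f : ℝ → ℝ) :
    mean T a (fun u => c * f u) = c * mean T a f := by
  unfold mean
  rw [intervalIntegral.integral_const_mul]; ring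

lemma mean_const {T : ℝ} (hT : 0 < T) (a c : ℝ) : mean T a (fun _ => c) = c := by
  unfold mean
  rw [intervalIntegral.integral_const]
  simp [hT.ne']

lemma mean_sum {ι : Type*} {T a : ℝ} (I : Finset ι) {f : ι → ℝ → ℝ}
    (hf : ∀ i ∈ I, IntervalIntegrable (f i) volume a (a + T)) :
    mean T a (fun u => ∑ i ∈ I, f i u) = ∑ i ∈ I, mean T a (f i) := by
  unfold mean
  rw [intervalIntegral.integral_finsetSum hf, Finset.mul_sum]

/-- The exponential series truncated at degree `D`. -/
def expTrunc (D : ℕ) (w : ℂ) : ℂ := ∑ k ∈ Finset.range (D + 1), w ^ k / k.factorial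

@[fun_prop]
lemma continuous_expTrunc (D : ℕ) : Continuous (expTrunc D) := by
  unfold expTrunc; fun_prop

lemma norm_exp_sub_expTrunc_le {D : ℕ} {R : ℝ} (hD : 8 * R ≤ D) {w : ℂ} (hw : ‖w‖ ≤ R) :
    ‖Complex.exp w - expTrunc D w‖ ≤ 2 * Real.exp (-(4 * R)) := by
  have hR : 0 ≤ R := (norm_nonneg w).trans hw
  have h1 : ‖Complex.exp w - expTrunc D w‖ ≤ ‖w‖ ^ (D + 1) / ((D + 1).factorial : ℝ) * 2 := by
    refine Complex.exp_bound' ?_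
    rw [div_le_iff₀ (by positivity)]
    push_cast
    linarith
  refine h1.trans ?_
  rw [mul_comm]
  refine mul_le_mul_of_nonneg_left ?_ zero_le_two
  have h2 : (4 * R) ^ (D + 1) / ((D + 1).factorial : ℝ) ≤ Real.exp (4 * R) :=
    Real.pow_div_factorial_le_exp _ (by positivity) _
  have h3 : Real.exp (8 * R) ≤ 4 ^ (D + 1) := by
    calc Real.exp (8 * R) ≤ Real.exp ((D + 1 : ℕ) * 1) := by
          apply Real.exp_le_exp.2; push_cast; linarith
      _ = Real.exp 1 ^ (D + 1) := Real.exp_nat_mul _ _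
      _ ≤ 4 ^ (D + 1) := by
          apply pow_le_pow_left₀ (Real.exp_pos _).le
          have := Real.exp_one_lt_d9; linarith
  have h4 : ‖w‖ ^ (D + 1) / ((D + 1).factorial : ℝ)
      ≤ (4 * R) ^ (D + 1) / ((D + 1).factorial : ℝ) / 4 ^ (D + 1) := by
    rw [mul_pow, div_right_comm, mul_div_cancel_left₀ _ (by positivity)]
    gcongr
  refine h4.trans ?_
  rw [div_le_iff₀ (by positivity)]
  calc _ ≤ Real.exp (4 * R) := h2
    _ = Real.exp (-(4 * R)) * Real.exp (8 * R) := by rw [← Real.exp_add]; ring_nf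
    _ ≤ _ := by gcongr

/-- Where `‖w‖` is large the truncated series is bounded by a high power of `‖w‖`, whose mean value
is small. -/
lemma norm_expTrunc_sq_le_of_le_norm (D : ℕ) {R : ℝ} (hR : 0 < R) {w : ℂ} (hw : R ≤ ‖w‖) :
    ‖expTrunc D w‖ ^ 2 ≤ Real.exp (2 * R) * (‖w‖ ^ (2 * D) / R ^ (2 * D)) := by
  have h1 : ‖expTrunc D w‖ ≤ Real.exp R * (‖w‖ / R) ^ D := by
    calc ‖expTrunc D w‖ ≤ ∑ k ∈ Finset.range (D + 1), ‖w ^ k / k.factorial‖ := norm_sum_le _ _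
      _ ≤ ∑ k ∈ Finset.range (D + 1), R ^ k / k.factorial * (‖w‖ / R) ^ D := by
          refine Finset.sum_le_sum fun k hk => ?_
          have hk' : k ≤ D := by have := Finset.mem_range.1 hk; omega
          rw [norm_div, norm_pow, Complex.norm_natCast, div_mul_eq_mul_div]
          gcongr
          have h2 : (‖w‖ / R) ^ k ≤ (‖w‖ / R) ^ D :=
            pow_le_pow_right₀ ((one_le_div hR).2 hw) hk'
          calc ‖w‖ ^ k = R ^ k * (‖w‖ / R) ^ k := by
                rw [← mul_pow, mul_div_cancel₀ _ hR.ne']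
            _ ≤ _ := by gcongr
      _ = (∑ k ∈ Finset.range (D + 1), R ^ k / k.factorial) * (‖w‖ / R) ^ D := by
          rw [Finset.sum_mul]
      _ ≤ _ := by
          gcongr
          exact Real.sum_le_exp_of_nonneg hR.le _
  calc ‖expTrunc D w‖ ^ 2 ≤ (Real.exp R * (‖w‖ / R) ^ D) ^ 2 := by gcongr
    _ = _ := by rw [mul_pow, ← Real.exp_nat_mul, ← pow_mul, div_pow, mul_comm D 2]; push_cast; rfl

/-- The error in the mean value theorem for polynomials of degree at most `D` in a Dirichlet
polynomial with coefficients at most `1` over primes at most `Y`. -/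
def meanErr (D : ℕ) (Y T : ℝ) : ℝ := 2 * ((D : ℝ) + 1) ^ 2 * Y ^ (3 * D) / T

section Mean

variable {s : Finset ℕ} {z : ℕ → ℂ} {Y T : ℝ}

lemma card_le_of_prime (hs : ∀ p ∈ s, p.Prime) (hY : 1 ≤ Y) (hsY : ∀ p ∈ s, (p : ℝ) ≤ Y) :
    (s.card : ℝ) ≤ Y := by
  have h : s ⊆ Finset.Icc 1 ⌊Y⌋₊ := fun p hp =>
    Finset.mem_Icc.2 ⟨(hs p hp).one_lt.le, Nat.le_floor (hsY p hp)⟩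
  have h1 := Finset.card_le_card h
  rw [Nat.card_Icc] at h1
  calc (s.card : ℝ) ≤ (⌊Y⌋₊ : ℝ) := by exact_mod_cast (by omega : s.card ≤ ⌊Y⌋₊)
    _ ≤ Y := Nat.floor_le (by linarith)

lemma sum_norm_le (hs : ∀ p ∈ s, p.Prime) (hY : 1 ≤ Y) (hsY : ∀ p ∈ s, (p : ℝ) ≤ Y)
    (hz : ∀ p ∈ s, ‖z p‖ ≤ 1) : ∑ p ∈ s, ‖z p‖ ≤ Y :=
  calc ∑ p ∈ s, ‖z p‖ ≤ ∑ _p ∈ s, (1 : ℝ) := Finset.sum_le_sum hz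
    _ = s.card := by simp
    _ ≤ Y := card_le_of_prime hs hY hsY

/-- The mean value theorem with the error `meanErr`; the weights `k!` allow for the powers of the
Dirichlet polynomial themselves. -/
lemma abs_mean_sub_le_of_weight (hs : ∀ p ∈ s, p.Prime) (hY : 1 ≤ Y)
    (hsY : ∀ p ∈ s, (p : ℝ) ≤ Y) (hz : ∀ p ∈ s, ‖z p‖ ≤ 1) (hT : 0 < T) (g : ℕ → ℝ) (D : ℕ)
    (hg : ∀ k ≤ D, |g k| ≤ k.factorial) (a : ℝ) :
    |mean T a (fun u =>
        ‖∑ k ∈ Finset.range (D + 1), (g k : ℂ) * (dirPoly s z u ^ k / k.factorial)‖ ^ 2)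
        - ∑ i ∈ monomials s D, ‖monCoeff s z g i‖ ^ 2| ≤ meanErr D Y T := by
  have h := abs_integral_normSq_dirPoly_sub_le hs hY hsY (z := z) g D a T
  have h1 : ∑ k ∈ Finset.range (D + 1), |g k| * ((∑ p ∈ s, ‖z p‖) ^ k / k.factorial)
      ≤ (D + 1) * Y ^ D := by
    calc _ ≤ ∑ _k ∈ Finset.range (D + 1), Y ^ D := by
          refine Finset.sum_le_sum fun k hk => ?_
          have hk' : k ≤ D := by have := Finset.mem_range.1 hk; omega
          have hf : (0 : ℝ) < k.factorial := by exact_mod_cast Nat.factorial_pos k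
          calc |g k| * ((∑ p ∈ s, ‖z p‖) ^ k / k.factorial)
              ≤ k.factorial * ((∑ p ∈ s, ‖z p‖) ^ k / k.factorial) := by
                gcongr; exact hg k hk'
            _ = (∑ p ∈ s, ‖z p‖) ^ k := by field_simp
            _ ≤ Y ^ k := by
                gcongr
                exact sum_norm_le hs hY hsY hz
            _ ≤ Y ^ D := pow_le_pow_right₀ hY hk'
      _ = _ := by simp
  have h0 : 0 ≤ ∑ k ∈ Finset.range (D + 1), |g k| * ((∑ p ∈ s, ‖z p‖) ^ k / k.factorial) :=
    Finset.sum_nonneg fun k _ => by positivity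
  unfold mean
  have h2 : T⁻¹ * (∫ u in a..(a + T),
        ‖∑ k ∈ Finset.range (D + 1), (g k : ℂ) * (dirPoly s z u ^ k / k.factorial)‖ ^ 2)
        - ∑ i ∈ monomials s D, ‖monCoeff s z g i‖ ^ 2
      = T⁻¹ * ((∫ u in a..(a + T),
        ‖∑ k ∈ Finset.range (D + 1), (g k : ℂ) * (dirPoly s z u ^ k / k.factorial)‖ ^ 2)
        - T * ∑ i ∈ monomials s D, ‖monCoeff s z g i‖ ^ 2) := by
    field_simp
  rw [h2, abs_mul, abs_of_pos (inv_pos.2 hT), meanErr, inv_mul_eq_div]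
  gcongr
  refine h.trans ?_
  calc _ ≤ ((D + 1) * Y ^ D) ^ 2 * (2 * Y ^ D) := by gcongr
    _ = _ := by ring

lemma mean_expTrunc_le (hs : ∀ p ∈ s, p.Prime) (hY : 1 ≤ Y)
    (hsY : ∀ p ∈ s, (p : ℝ) ≤ Y) (hz : ∀ p ∈ s, ‖z p‖ ≤ 1) (hT : 0 < T) (D : ℕ) (a : ℝ) :
    mean T a (fun u => ‖expTrunc D (dirPoly s z u)‖ ^ 2)
      ≤ Real.exp (∑ p ∈ s, ‖z p‖ ^ 2) + meanErr D Y T := by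
  have h := abs_mean_sub_le_of_weight hs hY hsY hz hT (fun _ => 1) D
    (fun k _ => by simpa using Nat.one_le_iff_ne_zero.2 (Nat.factorial_ne_zero k)) a
  have h1 := (sum_norm_monCoeff_sq_le s z (fun _ => 1) D)
  simp only [Complex.ofReal_one, one_mul, one_pow] at h h1
  have h2 := Real.sum_le_exp_of_nonneg (x := ∑ p ∈ s, ‖z p‖ ^ 2)
    (Finset.sum_nonneg fun p _ => by positivity) (D + 1)
  have h3 := (abs_le.1 h).2
  unfold expTrunc
  linarith

lemma le_mean_expTrunc (hs : ∀ p ∈ s, p.Prime) (hY : 1 ≤ Y)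
    (hsY : ∀ p ∈ s, (p : ℝ) ≤ Y) (hz : ∀ p ∈ s, ‖z p‖ ≤ 1) (hT : 0 < T) (D : ℕ) (a : ℝ) :
    Real.exp (∑ p ∈ s, ‖z p‖ ^ 2 - ∑ p ∈ s, ‖z p‖ ^ 4)
        - Real.exp (2 * ∑ p ∈ s, ‖z p‖ ^ 2) / 2 ^ (D + 1) - meanErr D Y T
      ≤ mean T a (fun u => ‖expTrunc D (dirPoly s z u)‖ ^ 2) := by
  have h := abs_mean_sub_le_of_weight hs hY hsY hz hT (fun _ => 1) D
    (fun k _ => by simpa using Nat.one_le_iff_ne_zero.2 (Nat.factorial_ne_zero k)) a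
  have h1 := le_sum_norm_monCoeff_sq s z D
  simp only [Complex.ofReal_one, one_mul] at h
  have h3 := (abs_le.1 h).1
  unfold expTrunc
  linarith

lemma mean_norm_pow_le (hs : ∀ p ∈ s, p.Prime) (hY : 1 ≤ Y)
    (hsY : ∀ p ∈ s, (p : ℝ) ≤ Y) (hz : ∀ p ∈ s, ‖z p‖ ≤ 1) (hT : 0 < T) (D : ℕ) (a : ℝ) :
    mean T a (fun u => ‖dirPoly s z u‖ ^ (2 * D))
      ≤ D.factorial * (∑ p ∈ s, ‖z p‖ ^ 2) ^ D + meanErr D Y T := by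
  -- with these weights the polynomial is the single power `w ^ D`
  let g : ℕ → ℝ := fun k => if k = D then D.factorial else 0
  have hf : (D.factorial : ℝ) ≠ 0 := by exact_mod_cast Nat.factorial_ne_zero D
  have h := abs_mean_sub_le_of_weight hs hY hsY hz hT g D
    (fun k _ => by
      by_cases hk : k = D
      · simp [g, hk]
      · simp [g, hk]) a
  have h1 := (sum_norm_monCoeff_sq_le s z g D)
  have h2 : ∑ k ∈ Finset.range (D + 1), g k ^ 2 * ((∑ p ∈ s, ‖z p‖ ^ 2) ^ k / k.factorial)
      = D.factorial * (∑ p ∈ s, ‖z p‖ ^ 2) ^ D := by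
    rw [Finset.sum_eq_single D]
    · simp only [g, if_true]; field_simp
    · intro k _ hk; simp [g, hk]
    · simp
  have h3 : ∀ u, ∑ k ∈ Finset.range (D + 1), (g k : ℂ) * (dirPoly s z u ^ k / k.factorial)
      = dirPoly s z u ^ D := by
    intro u
    rw [Finset.sum_eq_single D]
    · simp only [g, if_true]
      rw [Complex.ofReal_natCast, mul_div_cancel₀]
      exact_mod_cast Nat.factorial_ne_zero D
    · intro k _ hk; simp [g, hk]
    · simp
  simp_rw [h3, norm_pow, ← pow_mul, mul_comm D 2] at h
  have h4 := (abs_le.1 h).2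
  linarith

/-- The function equal to `exp (2 Re w)` where `‖w‖ ≤ R`, and to `0` elsewhere. -/
def cutExp (R : ℝ) (w : ℂ) : ℝ := if ‖w‖ ≤ R then Real.exp (2 * w.re) else 0

lemma cutExp_nonneg (R : ℝ) (w : ℂ) : 0 ≤ cutExp R w := by
  unfold cutExp; split_ifs <;> positivity

lemma intervalIntegrable_ite {f : ℝ → ℝ} (hf : Continuous f) {p : ℝ → Prop} [DecidablePred p]
    (hp : MeasurableSet {u | p u}) (a b : ℝ) :
    IntervalIntegrable (fun u => if p u then f u else 0) volume a b := by
  have h : (fun u => if p u then f u else 0) = {u | p u}.indicator f := by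
    funext u; simp [Set.indicator_apply]
  rw [h]
  exact ⟨(hf.intervalIntegrable a b).1.indicator hp, (hf.intervalIntegrable a b).2.indicator hp⟩

lemma intervalIntegrable_cutExp (R : ℝ) {f : ℝ → ℂ} (hf : Continuous f) (a b : ℝ) :
    IntervalIntegrable (fun u => cutExp R (f u)) volume a b := by
  unfold cutExp
  refine intervalIntegrable_ite (f := fun u => Real.exp (2 * (f u).re)) (by fun_prop) ?_ a b
  exact (isClosed_le (by fun_prop) (by fun_prop)).measurableSet

lemma sq_norm_exp (w : ℂ) : ‖Complex.exp w‖ ^ 2 = Real.exp (2 * w.re) := by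
  rw [Complex.norm_exp, ← Real.exp_nat_mul]; push_cast; rfl

lemma sq_le_of_norm_sub_le {x y : ℂ} {ε : ℝ} (h : ‖x - y‖ ≤ ε) :
    ‖x‖ ^ 2 ≤ (1 + ε) * ‖y‖ ^ 2 + (ε + ε ^ 2) := by
  have h0 : 0 ≤ ε := (norm_nonneg _).trans h
  have h1 : ‖x‖ ≤ ‖y‖ + ε := by
    have := norm_le_norm_add_norm_sub y x
    rw [norm_sub_rev] at this; linarith
  nlinarith [sq_nonneg (‖y‖ - 1), norm_nonneg x, norm_nonneg y, mul_nonneg h0 (sq_nonneg (‖y‖ - 1))]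

lemma mean_cutExp_le (hs : ∀ p ∈ s, p.Prime) (hY : 1 ≤ Y)
    (hsY : ∀ p ∈ s, (p : ℝ) ≤ Y) (hz : ∀ p ∈ s, ‖z p‖ ≤ 1) (hT : 0 < T) {D : ℕ} {R : ℝ}
    (hD : 8 * R ≤ D) (a : ℝ) :
    mean T a (fun u => cutExp R (dirPoly s z u))
      ≤ (1 + 2 * Real.exp (-(4 * R))) * (Real.exp (∑ p ∈ s, ‖z p‖ ^ 2) + meanErr D Y T)
        + (2 * Real.exp (-(4 * R)) + (2 * Real.exp (-(4 * R))) ^ 2) := by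
  set ε := 2 * Real.exp (-(4 * R))
  have hε : 0 ≤ ε := by positivity
  have h1 : mean T a (fun u => cutExp R (dirPoly s z u))
      ≤ mean T a (fun u => (1 + ε) * ‖expTrunc D (dirPoly s z u)‖ ^ 2 + (ε + ε ^ 2)) := by
    refine mean_mono hT (intervalIntegrable_cutExp R (by fun_prop) _ _)
      (Continuous.intervalIntegrable (by fun_prop) _ _) fun u => ?_
    unfold cutExp
    split_ifs with h
    · rw [← sq_norm_exp]
      exact sq_le_of_norm_sub_le (norm_exp_sub_expTrunc_le hD h)
    · positivity
  refine h1.trans ?_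
  rw [mean_add (Continuous.intervalIntegrable (by fun_prop) _ _)
    (Continuous.intervalIntegrable (by fun_prop) _ _), mean_const_mul, mean_const hT]
  gcongr
  exact mean_expTrunc_le hs hY hsY hz hT D a

lemma le_mean_cutExp (hs : ∀ p ∈ s, p.Prime) (hY : 1 ≤ Y)
    (hsY : ∀ p ∈ s, (p : ℝ) ≤ Y) (hz : ∀ p ∈ s, ‖z p‖ ≤ 1) (hT : 0 < T) {D : ℕ} {R : ℝ}
    (hR : 0 < R) (hD : 8 * R ≤ D) (a : ℝ) :
    Real.exp (∑ p ∈ s, ‖z p‖ ^ 2 - ∑ p ∈ s, ‖z p‖ ^ 4)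
        - Real.exp (2 * ∑ p ∈ s, ‖z p‖ ^ 2) / 2 ^ (D + 1) - meanErr D Y T
        - (2 * Real.exp (-(4 * R)) + (2 * Real.exp (-(4 * R))) ^ 2)
        - Real.exp (2 * R) *
          ((D.factorial * (∑ p ∈ s, ‖z p‖ ^ 2) ^ D + meanErr D Y T) / R ^ (2 * D))
      ≤ (1 + 2 * Real.exp (-(4 * R))) * mean T a (fun u => cutExp R (dirPoly s z u)) := by
  set ε := 2 * Real.exp (-(4 * R))
  have hε : 0 ≤ ε := by positivity
  have h1 : mean T a (fun u => ‖expTrunc D (dirPoly s z u)‖ ^ 2)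
      ≤ mean T a (fun u => ((1 + ε) * cutExp R (dirPoly s z u) + (ε + ε ^ 2))
        + Real.exp (2 * R) / R ^ (2 * D) * ‖dirPoly s z u‖ ^ (2 * D)) := by
    refine mean_mono hT (Continuous.intervalIntegrable (by fun_prop) _ _) ?_ fun u => ?_
    · refine ((((intervalIntegrable_cutExp R (by fun_prop) _ _).const_mul _).add
        (Continuous.intervalIntegrable (by fun_prop) _ _)).add
        (Continuous.intervalIntegrable (by fun_prop) _ _))
    · by_cases h : ‖dirPoly s z u‖ ≤ R
      · have h2 : cutExp R (dirPoly s z u) = Real.exp (2 * (dirPoly s z u).re) := by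
          simp [cutExp, h]
        rw [h2, ← sq_norm_exp]
        have h3 := norm_exp_sub_expTrunc_le hD h
        rw [norm_sub_rev] at h3
        have h4 := sq_le_of_norm_sub_le h3
        have h5 : 0 ≤ Real.exp (2 * R) / R ^ (2 * D) * ‖dirPoly s z u‖ ^ (2 * D) := by positivity
        linarith
      · have h2 := norm_expTrunc_sq_le_of_le_norm D hR (not_le.1 h).le
        have h3 := cutExp_nonneg R (dirPoly s z u)
        have h4 : 0 ≤ (1 + ε) * cutExp R (dirPoly s z u) + (ε + ε ^ 2) := by positivity
        have h5 : Real.exp (2 * R) / R ^ (2 * D) * ‖dirPoly s z u‖ ^ (2 * D)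
          = Real.exp (2 * R) * (‖dirPoly s z u‖ ^ (2 * D) / R ^ (2 * D)) := by ring
        linarith
  rw [mean_add (((intervalIntegrable_cutExp R (by fun_prop) _ _).const_mul _).add
        (Continuous.intervalIntegrable (by fun_prop) _ _))
        (Continuous.intervalIntegrable (by fun_prop) _ _),
    mean_add ((intervalIntegrable_cutExp R (by fun_prop) _ _).const_mul _)
      (Continuous.intervalIntegrable (by fun_prop) _ _), mean_const_mul, mean_const hT,
    mean_const_mul] at h1
  have h2 := le_mean_expTrunc hs hY hsY hz hT D a
  have h3 := mean_norm_pow_le hs hY hsY hz hT D a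
  have h4 : Real.exp (2 * R) / R ^ (2 * D) * mean T a (fun u => ‖dirPoly s z u‖ ^ (2 * D))
      ≤ Real.exp (2 * R) *
          ((D.factorial * (∑ p ∈ s, ‖z p‖ ^ 2) ^ D + meanErr D Y T) / R ^ (2 * D)) := by
    rw [div_mul_eq_mul_div, ← mul_div_assoc]
    gcongr
  linarith

lemma mean_large_le (hs : ∀ p ∈ s, p.Prime) (hY : 1 ≤ Y)
    (hsY : ∀ p ∈ s, (p : ℝ) ≤ Y) (hz : ∀ p ∈ s, ‖z p‖ ≤ 1) (hT : 0 < T) (D : ℕ) {R : ℝ}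
    (hR : 0 < R) (a : ℝ) :
    mean T a (fun u => if R < ‖dirPoly s z u‖ then 1 else 0)
      ≤ (D.factorial * (∑ p ∈ s, ‖z p‖ ^ 2) ^ D + meanErr D Y T) / R ^ (2 * D) := by
  have h1 : mean T a (fun u => if R < ‖dirPoly s z u‖ then 1 else 0)
      ≤ mean T a (fun u => (R ^ (2 * D))⁻¹ * ‖dirPoly s z u‖ ^ (2 * D)) := by
    refine mean_mono hT ?_ (Continuous.intervalIntegrable (by fun_prop) _ _) fun u => ?_
    · exact intervalIntegrable_ite (f := fun _ => (1 : ℝ)) continuous_const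
        (isOpen_lt (by fun_prop) (by fun_prop)).measurableSet _ _
    · split_ifs with h
      · rw [inv_mul_eq_div, one_le_div (by positivity)]
        gcongr
      · positivity
  refine h1.trans ?_
  rw [mean_const_mul, inv_mul_eq_div]
  gcongr
  exact mean_norm_pow_le hs hY hsY hz hT D a

end Mean

/-! ### Exponential moments of Dirichlet polynomials -/

/-- The truncation degree attached to `A = log T`: eight times the bound `C (log A) ^ 2` imposed on
the Dirichlet polynomial, as `norm_exp_sub_expTrunc_le` requires. -/
def degD (C A : ℝ) : ℕ := ⌈8 * (C * Real.log A ^ 2)⌉₊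

lemma le_degD (C A : ℝ) : 8 * (C * Real.log A ^ 2) ≤ degD C A := Nat.le_ceil _

lemma tendsto_log_sq {C : ℝ} (hC : 0 < C) :
    Tendsto (fun A : ℝ => C * Real.log A ^ 2) atTop atTop :=
  Tendsto.const_mul_atTop hC ((tendsto_pow_atTop two_ne_zero).comp Real.tendsto_log_atTop)

lemma eventually_degD_le {C : ℝ} (hC : 0 < C) :
    ∀ᶠ A : ℝ in atTop, (degD C A : ℝ) ≤ 9 * (C * Real.log A ^ 2) := by
  filter_upwards [(tendsto_log_sq hC).eventually_ge_atTop 1] with A hA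
  have := (Nat.ceil_lt_add_one (a := 8 * (C * Real.log A ^ 2)) (by positivity)).le
  unfold degD
  linarith

/-- The error in the mean value theorem is negligible: `exp (A ^ υ)` to the power `O((log A) ^ 2)` is
much smaller than `exp A` if `υ < 1`. -/
lemma eventually_meanErr_le {υ C ε : ℝ} (hυ : υ < 1) (hC : 0 < C) (hε : 0 < ε) :
    ∀ᶠ A : ℝ in atTop, meanErr (degD C A) (Real.exp (A ^ υ)) (Real.exp A) ≤ ε := by
  wlog hυ0 : 0 ≤ υ generalizing υ
  · filter_upwards [this (υ := 0) zero_lt_one le_rfl, eventually_ge_atTop 1] with A hA hA1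
    refine le_trans ?_ hA
    unfold meanErr
    gcongr
    exact (not_le.1 hυ0).le
  have h1 : (fun A : ℝ => Real.log A ^ (2 : ℝ)) =o[atTop] fun A => A ^ (1 - υ) :=
    isLittleO_log_rpow_rpow_atTop 2 (by linarith)
  have h2 := h1.bound (show (0 : ℝ) < 1 / (90 * C) by positivity)
  have h3 : Tendsto (fun A : ℝ => 2 * Real.exp (-(A / 2))) atTop (𝓝 0) := by
    have : Tendsto (fun A : ℝ => Real.exp (-(A / 2))) atTop (𝓝 0) :=
      Real.tendsto_exp_neg_atTop_nhds_zero.comp (tendsto_id.atTop_div_const two_pos)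
    simpa using this.const_mul 2
  filter_upwards [h2, h3.eventually_le_const hε, eventually_degD_le hC, eventually_ge_atTop 1]
    with A hA2 hA3 hD hA1
  refine le_trans ?_ hA3
  set D := degD C A
  have hA0 : (0 : ℝ) < A := by linarith
  have hlog : 0 ≤ Real.log A := Real.log_nonneg hA1
  have hD5 : 5 * (D : ℝ) * A ^ υ ≤ A / 2 := by
    rw [Real.norm_of_nonneg (by positivity), Real.norm_of_nonneg (by positivity),
      Real.rpow_two] at hA2
    have h4 : A ^ (1 - υ) * A ^ υ = A := by
      rw [← Real.rpow_add hA0]; simp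
    calc 5 * (D : ℝ) * A ^ υ ≤ 5 * (9 * (C * Real.log A ^ 2)) * A ^ υ := by gcongr
      _ ≤ 5 * (9 * (C * (1 / (90 * C) * A ^ (1 - υ)))) * A ^ υ := by gcongr
      _ = A ^ (1 - υ) * A ^ υ / 2 := by field_simp; norm_num
      _ = A / 2 := by rw [h4]
  have hυ1 : 1 ≤ A ^ υ := Real.one_le_rpow hA1 hυ0
  have h5 : ((D : ℝ) + 1) ^ 2 ≤ Real.exp (2 * D * A ^ υ) := by
    calc ((D : ℝ) + 1) ^ 2 ≤ (Real.exp D) ^ 2 := by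
          gcongr; exact Real.add_one_le_exp _
      _ = Real.exp (2 * D * 1) := by rw [← Real.exp_nat_mul]; push_cast; ring_nf
      _ ≤ _ := by gcongr
  unfold meanErr
  rw [div_le_iff₀ (Real.exp_pos _)]
  calc 2 * ((D : ℝ) + 1) ^ 2 * Real.exp (A ^ υ) ^ (3 * D)
      ≤ 2 * Real.exp (2 * D * A ^ υ) * Real.exp (3 * D * A ^ υ) := by
        rw [← Real.exp_nat_mul]; push_cast; gcongr
    _ = 2 * Real.exp (5 * D * A ^ υ) := by rw [mul_assoc, ← Real.exp_add]; ring_nf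
    _ ≤ 2 * Real.exp (-(A / 2) + A) := by
        gcongr; linarith
    _ = _ := by rw [Real.exp_add]; ring

/-- The high moments show that a sum of squares of order `log A` makes values of order
`(log A) ^ 2` extremely rare: rarer than any `exp (-B (log A) ^ 2)`. -/
lemma eventually_tail_le {υ C₁ C₂ ε : ℝ} (hυ : υ < 1) (hC₁ : 0 < C₁) (hC₂ : 0 < C₂)
    (hε : 0 < ε) (B : ℝ) :
    ∀ᶠ A : ℝ in atTop, ∀ V : ℝ, 0 ≤ V → V ≤ C₁ * Real.log A →
      ((degD C₂ A).factorial * V ^ degD C₂ A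
          + meanErr (degD C₂ A) (Real.exp (A ^ υ)) (Real.exp A))
        / (C₂ * Real.log A ^ 2) ^ (2 * degD C₂ A) ≤ ε * Real.exp (-(B * Real.log A ^ 2)) := by
  obtain ⟨B', hB'⟩ : ∃ B' : ℝ, 0 ≤ B' ∧ B + 1 ≤ 8 * B' * C₂ :=
    ⟨|B + 1| / (8 * C₂), by positivity, by
      have := le_abs_self (B + 1)
      field_simp
      linarith⟩
  have hl := Real.tendsto_log_atTop
  have h3 : Tendsto (fun A : ℝ => 2 * Real.exp (-(1 * Real.log A ^ 2))) atTop (𝓝 0) := by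
    have : Tendsto (fun A : ℝ => Real.exp (-(1 * Real.log A ^ 2))) atTop (𝓝 0) :=
      Real.tendsto_exp_neg_atTop_nhds_zero.comp (tendsto_log_sq one_pos)
    simpa using this.const_mul 2
  filter_upwards [eventually_meanErr_le hυ hC₂ one_pos, eventually_degD_le hC₂,
    hl.eventually_ge_atTop (9 * C₁ * Real.exp B' / C₂), hl.eventually_ge_atTop 1,
    (tendsto_log_sq hC₂).eventually_ge_atTop (Real.exp B'), h3.eventually_le_const hε]
    with A hE hD hn1 hn2 hn3 hn4 V hV0 hV
  have hDl := le_degD C₂ A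
  set D := degD C₂ A
  set n := Real.log A
  have hn0 : 0 < n := by linarith
  have hR1 : 1 ≤ C₂ * n ^ 2 := le_trans (Real.one_le_exp hB'.1) hn3
  have h5 : (D.factorial : ℝ) * V ^ D / (C₂ * n ^ 2) ^ (2 * D) ≤ Real.exp (-B') ^ D := by
    have h6 : (D.factorial : ℝ) ≤ (D : ℝ) ^ D := by exact_mod_cast Nat.factorial_le_pow D
    calc (D.factorial : ℝ) * V ^ D / (C₂ * n ^ 2) ^ (2 * D)
        ≤ (D : ℝ) ^ D * V ^ D / (C₂ * n ^ 2) ^ (2 * D) := by gcongr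
      _ = ((D : ℝ) * V / (C₂ * n ^ 2) ^ 2) ^ D := by
          rw [div_pow, mul_pow (D : ℝ) V, pow_mul (C₂ * n ^ 2)]
      _ ≤ Real.exp (-B') ^ D := by
          gcongr
          rw [div_le_iff₀ (by positivity), Real.exp_neg]
          have h7 : 9 * C₁ * Real.exp B' ≤ n * C₂ := by rwa [div_le_iff₀ hC₂] at hn1
          calc (D : ℝ) * V ≤ (9 * (C₂ * n ^ 2)) * (C₁ * n) := by gcongr
            _ = (Real.exp B')⁻¹ * ((9 * C₁ * Real.exp B') * C₂ * n ^ 3) := by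
                field_simp
            _ ≤ (Real.exp B')⁻¹ * ((n * C₂) * C₂ * n ^ 3) := by gcongr
            _ = _ := by ring
  have h6 : meanErr D (Real.exp (A ^ υ)) (Real.exp A) / (C₂ * n ^ 2) ^ (2 * D)
      ≤ Real.exp (-B') ^ D := by
    rw [div_le_iff₀ (by positivity)]
    refine hE.trans ?_
    rw [mul_comm 2 D, pow_mul', ← mul_pow]
    apply one_le_pow₀
    rw [Real.exp_neg, inv_mul_eq_div, one_le_div (Real.exp_pos _)]
    refine hn3.trans ?_
    nlinarith
  have h7 : Real.exp (-B') ^ D ≤ Real.exp (-((B + 1) * n ^ 2)) := by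
    rw [← Real.exp_nat_mul]
    apply Real.exp_le_exp.2
    have : (B + 1) * n ^ 2 ≤ 8 * B' * C₂ * n ^ 2 := by gcongr; exact hB'.2
    nlinarith [hB'.1]
  rw [add_div]
  calc _ ≤ 2 * Real.exp (-((B + 1) * n ^ 2)) := by linarith
    _ = 2 * Real.exp (-(1 * n ^ 2)) * Real.exp (-(B * n ^ 2)) := by
        rw [mul_assoc, ← Real.exp_add]; ring_nf
    _ ≤ _ := by gcongr

/-- The hypotheses under which the mean values of Dirichlet polynomials are those of independent
variables: the sum is over primes at most `exp ((log T) ^ υ)`, the coefficients are at most `1` and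
the sum of their squares is `O(log log T)`. -/
structure Admissible (υ C T : ℝ) (s : Finset ℕ) (z : ℕ → ℂ) : Prop where
  prime : ∀ p ∈ s, p.Prime
  le : ∀ p ∈ s, (p : ℝ) ≤ Real.exp (Real.log T ^ υ)
  norm_le : ∀ p ∈ s, ‖z p‖ ≤ 1
  sum_le : ∑ p ∈ s, ‖z p‖ ^ 2 ≤ C * Real.log (Real.log T)

/-- Upper bound for exponential moments, as for independent variables. -/
lemma eventually_mean_cutExp_le {υ C₁ C₂ ε : ℝ} (hυ : υ < 1) (hC₂ : 0 < C₂) (hε : 0 < ε) :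
    ∀ᶠ T : ℝ in atTop, ∀ s z, Admissible υ C₁ T s z → ∀ a,
      mean T a (fun u => cutExp (C₂ * Real.log (Real.log T) ^ 2) (dirPoly s z u))
        ≤ (1 + ε) * Real.exp (∑ p ∈ s, ‖z p‖ ^ 2) := by
  have h3 : Tendsto (fun A : ℝ => 2 * Real.exp (-(4 * (C₂ * Real.log A ^ 2)))) atTop (𝓝 0) := by
    have : Tendsto (fun A : ℝ => Real.exp (-(4 * (C₂ * Real.log A ^ 2)))) atTop (𝓝 0) :=
      Real.tendsto_exp_neg_atTop_nhds_zero.comp ((tendsto_log_sq hC₂).const_mul_atTop four_pos)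
    simpa using this.const_mul 2
  obtain ⟨e, he0, he1, he2⟩ : ∃ e : ℝ, 0 < e ∧ e ≤ 1 ∧ 5 * e ≤ ε :=
    ⟨min 1 (ε / 5), by positivity, min_le_left _ _, by
      have := min_le_right 1 (ε / 5); linarith⟩
  filter_upwards [Real.tendsto_log_atTop.eventually (eventually_meanErr_le hυ hC₂ he0),
    Real.tendsto_log_atTop.eventually (h3.eventually_le_const he0),
    eventually_gt_atTop 1] with T hE hR hT s z hz a
  have hT0 : 0 < T := by linarith
  rw [Real.exp_log hT0] at hE
  have h := mean_cutExp_le hz.prime (Real.one_le_exp (Real.rpow_nonneg (Real.log_nonneg hT.le) _))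
    hz.le hz.norm_le hT0 (le_degD C₂ (Real.log T)) a
  refine h.trans ?_
  set e₁ := 2 * Real.exp (-(4 * (C₂ * Real.log (Real.log T) ^ 2)))
  have he₁ : 0 ≤ e₁ := by positivity
  set X := Real.exp (∑ p ∈ s, ‖z p‖ ^ 2)
  have hX : 1 ≤ X := Real.one_le_exp (Finset.sum_nonneg fun p _ => by positivity)
  have hE0 : 0 ≤ meanErr (degD C₂ (Real.log T)) (Real.exp (Real.log T ^ υ)) T := by
    unfold meanErr; positivity
  calc _ ≤ (1 + e) * (X + e) + (e + e ^ 2) := by gcongr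
    _ ≤ (1 + 5 * e) * X := by nlinarith
    _ ≤ _ := by gcongr

/-- The truncation in `cutExp` concerns an extremely small set of points. -/
lemma eventually_mean_large_le {υ C₁ C₂ ε : ℝ} (hυ : υ < 1) (hC₁ : 0 < C₁) (hC₂ : 0 < C₂)
    (hε : 0 < ε) (B : ℝ) :
    ∀ᶠ T : ℝ in atTop, ∀ s z, Admissible υ C₁ T s z → ∀ a,
      mean T a (fun u => if C₂ * Real.log (Real.log T) ^ 2 < ‖dirPoly s z u‖ then 1 else 0)
        ≤ ε * Real.exp (-(B * Real.log (Real.log T) ^ 2)) := by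
  filter_upwards [Real.tendsto_log_atTop.eventually (eventually_tail_le hυ hC₁ hC₂ hε B),
    Real.tendsto_log_atTop.eventually ((tendsto_log_sq hC₂).eventually_gt_atTop 0),
    eventually_gt_atTop 1] with T hE hR hT s z hz a
  have hT0 : 0 < T := by linarith
  rw [Real.exp_log hT0] at hE
  refine (mean_large_le hz.prime (Real.one_le_exp (Real.rpow_nonneg (Real.log_nonneg hT.le) _))
    hz.le hz.norm_le hT0 (degD C₂ (Real.log T)) hR a).trans ?_
  exact hE _ (Finset.sum_nonneg fun p _ => by positivity) hz.sum_le

/-- Lower bound for exponential moments, as for independent variables. -/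
lemma eventually_le_mean_cutExp {υ C₁ C₂ ε : ℝ} (hυ : υ < 1) (hC₁ : 0 < C₁) (hC₂ : 0 < C₂)
    (hε : 0 < ε) :
    ∀ᶠ T : ℝ in atTop, ∀ s z, Admissible υ C₁ T s z → ∑ p ∈ s, ‖z p‖ ^ 4 ≤ ε → ∀ a,
      (1 - 8 * ε) * Real.exp (∑ p ∈ s, ‖z p‖ ^ 2)
        ≤ mean T a (fun u => cutExp (C₂ * Real.log (Real.log T) ^ 2) (dirPoly s z u)) := by
  -- for larger `ε` the left side is not positive
  wlog hε1 : ε ≤ 1 / 8 generalizing ε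
  · filter_upwards [eventually_gt_atTop 1] with T hT s z _ _ a
    have h1 : mean T a (fun _ => 0) ≤
        mean T a (fun u => cutExp (C₂ * Real.log (Real.log T) ^ 2) (dirPoly s z u)) :=
      mean_mono (by linarith) (Continuous.intervalIntegrable (by fun_prop) _ _)
        (intervalIntegrable_cutExp _ (by fun_prop) _ _) fun u => cutExp_nonneg _ _
    rw [mean_const (by linarith)] at h1
    refine le_trans ?_ h1
    have : 1 - 8 * ε ≤ 0 := by linarith [not_le.1 hε1]
    exact mul_nonpos_of_nonpos_of_nonneg this (Real.exp_pos _).le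
  have h3 : Tendsto (fun A : ℝ => 2 * Real.exp (-(4 * (C₂ * Real.log A ^ 2)))) atTop (𝓝 0) := by
    have : Tendsto (fun A : ℝ => Real.exp (-(4 * (C₂ * Real.log A ^ 2)))) atTop (𝓝 0) :=
      Real.tendsto_exp_neg_atTop_nhds_zero.comp ((tendsto_log_sq hC₂).const_mul_atTop four_pos)
    simpa using this.const_mul 2
  have h4 : Tendsto (fun A : ℝ => Real.exp (-(C₂ * Real.log A ^ 2))) atTop (𝓝 0) :=
      Real.tendsto_exp_neg_atTop_nhds_zero.comp (tendsto_log_sq hC₂)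
  filter_upwards [Real.tendsto_log_atTop.eventually
      (eventually_tail_le hυ hC₁ hC₂ hε (2 * C₂)),
    Real.tendsto_log_atTop.eventually ((tendsto_log_sq hC₂).eventually_gt_atTop 0),
    Real.tendsto_log_atTop.eventually (eventually_meanErr_le hυ hC₂ hε),
    Real.tendsto_log_atTop.eventually (h3.eventually_le_const hε),
    Real.tendsto_log_atTop.eventually (h4.eventually_le_const hε),
    (Real.tendsto_log_atTop.comp Real.tendsto_log_atTop).eventually_ge_atTop (C₁ / C₂),
    (Real.tendsto_log_atTop.comp Real.tendsto_log_atTop).eventually_ge_atTop 0,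
    eventually_gt_atTop 1] with T hTail hR hE hR2 hR3 hn hn0 hT s z hz hz4 a
  have hT0 : 0 < T := by linarith
  rw [Real.exp_log hT0] at hE hTail
  simp only [Function.comp] at hn hn0
  have h := le_mean_cutExp hz.prime
    (Real.one_le_exp (Real.rpow_nonneg (Real.log_nonneg hT.le) _))
    hz.le hz.norm_le hT0 hR (le_degD C₂ (Real.log T)) a
  have hV0 : 0 ≤ ∑ p ∈ s, ‖z p‖ ^ 2 := Finset.sum_nonneg fun p _ => by positivity
  have hT1 := hTail _ hV0 hz.sum_le
  have hD := le_degD C₂ (Real.log T)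
  set n := Real.log (Real.log T)
  set D := degD C₂ (Real.log T)
  set M := mean T a (fun u => cutExp (C₂ * n ^ 2) (dirPoly s z u))
  have hM : 0 ≤ M := by
    have h1 : mean T a (fun _ => 0) ≤ M :=
      mean_mono (by linarith) (Continuous.intervalIntegrable (by fun_prop) _ _)
        (intervalIntegrable_cutExp _ (by fun_prop) _ _) fun u => cutExp_nonneg _ _
    rwa [mean_const (by linarith)] at h1
  set V := ∑ p ∈ s, ‖z p‖ ^ 2 with hVdef
  have hX : 1 ≤ Real.exp V := Real.one_le_exp hV0
  have h5 : Real.exp (2 * (C₂ * n ^ 2)) * ((D.factorial * V ^ D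
      + meanErr D (Real.exp (Real.log T ^ υ)) T) / (C₂ * n ^ 2) ^ (2 * D)) ≤ ε := by
    calc _ ≤ Real.exp (2 * (C₂ * n ^ 2)) * (ε * Real.exp (-(2 * C₂ * n ^ 2))) := by gcongr
      _ = ε * Real.exp (2 * (C₂ * n ^ 2) + -(2 * C₂ * n ^ 2)) := by rw [Real.exp_add]; ring
      _ = ε := by ring_nf; simp
  have h6 : (1 - ε) * Real.exp V ≤ Real.exp (V - ∑ p ∈ s, ‖z p‖ ^ 4) := by
    rw [sub_eq_add_neg V, Real.exp_add, mul_comm]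
    gcongr
    have := Real.add_one_le_exp (-∑ p ∈ s, ‖z p‖ ^ 4)
    linarith
  have h7 : Real.exp (2 * V) / 2 ^ (D + 1) ≤ ε := by
    have hD2 : Real.exp (3 * (C₂ * n ^ 2)) ≤ 2 ^ (D + 1) := by
      have hl2 := Real.log_two_gt_d9
      rw [← Real.le_log_iff_exp_le (by positivity), Real.log_pow]
      push_cast
      nlinarith
    have hV2 : V ≤ C₂ * n ^ 2 := by
      have h8 : C₁ ≤ n * C₂ := by rwa [div_le_iff₀ hC₂] at hn
      calc V ≤ C₁ * n := hz.sum_le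
        _ ≤ n * C₂ * n := by gcongr
        _ = _ := by ring
    rw [div_le_iff₀ (by positivity)]
    calc Real.exp (2 * V) ≤ Real.exp (-(C₂ * n ^ 2) + 3 * (C₂ * n ^ 2)) := by
          apply Real.exp_le_exp.2; linarith
      _ = Real.exp (-(C₂ * n ^ 2)) * Real.exp (3 * (C₂ * n ^ 2)) := Real.exp_add _ _
      _ ≤ ε * 2 ^ (D + 1) := by gcongr
  set e₁ := 2 * Real.exp (-(4 * (C₂ * n ^ 2)))
  have he₁ : 0 ≤ e₁ := by positivity
  have h9 : (1 - ε) * Real.exp V - 5 * ε ≤ (1 + ε) * M := by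
    have h10 : (1 + e₁) * M ≤ (1 + ε) * M := by gcongr
    have h11 : e₁ + e₁ ^ 2 ≤ 2 * ε := by nlinarith
    linarith
  have h12 : (1 - 6 * ε) * Real.exp V ≤ (1 + ε) * M := by nlinarith
  have h13 : (1 + ε) * ((1 - 8 * ε) * Real.exp V) ≤ (1 + ε) * M := by
    refine le_trans ?_ h12
    rw [← mul_assoc]
    gcongr
    nlinarith
  exact le_of_mul_le_mul_left h13 (by linarith)

/-! ### The zeta function near the line `Re s = 1` -/

lemma hasDerivAt_ofReal_cpow_neg {s : ℂ} {x : ℝ} (hx : 0 < x) :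
    HasDerivAt (fun y : ℝ => (y : ℂ) ^ (-s)) (-s * (x : ℂ) ^ (-s - 1)) x := by
  by_cases hs : s = 0
  · subst hs
    simpa using hasDerivAt_const x (1 : ℂ)
  · have h := hasDerivAt_ofReal_cpow_const' hx.ne' (r := -s - 1) (by
      intro h; apply hs
      have : -s = 0 := by linear_combination h
      simpa using this)
    have h2 := h.const_mul (-s)
    have h3 : (fun y : ℝ => -s * ((y : ℂ) ^ (-s - 1 + 1) / (-s - 1 + 1)))
        = fun y : ℝ => (y : ℂ) ^ (-s) := by
      funext y
      rw [sub_add_cancel, mul_div_cancel₀ _ (neg_ne_zero.2 hs)]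
    rwa [h3] at h2

lemma norm_cpow_neg_sub_le {s : ℂ} (hs : 1 ≤ s.re) {n x : ℝ} (hn : 1 ≤ n) (hx : n ≤ x)
    (hx1 : x ≤ n + 1) :
    ‖(x : ℂ) ^ (-s) - (n : ℂ) ^ (-s)‖ ≤ ‖s‖ / n ^ 2 := by
  have h := (convex_Icc n (n + 1)).norm_image_sub_le_of_norm_hasDerivWithin_le
    (f := fun y : ℝ => (y : ℂ) ^ (-s)) (f' := fun y => -s * (y : ℂ) ^ (-s - 1))
    (C := ‖s‖ / n ^ 2)
    (fun y hy => (hasDerivAt_ofReal_cpow_neg (by linarith [hy.1])).hasDerivWithinAt)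
    (fun y hy => by
      have hy0 : 0 < y := by linarith [hy.1]
      rw [norm_mul, norm_neg, Complex.norm_cpow_eq_rpow_re_of_pos hy0]
      rw [div_eq_mul_inv]
      gcongr
      have h1 : y ^ (-s - 1).re ≤ y ^ (-2 : ℝ) := by
        apply Real.rpow_le_rpow_of_exponent_le (by linarith [hy.1])
        simp; linarith
      refine h1.trans ?_
      rw [Real.rpow_neg hy0.le, Real.rpow_two]
      have := hy.1
      gcongr)
    (Set.left_mem_Icc.2 (by linarith)) (Set.mem_Icc.2 ⟨hx, hx1⟩)
  refine h.trans ?_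
  rw [Real.norm_eq_abs, abs_of_nonneg (by linarith)]
  have : 0 ≤ ‖s‖ / n ^ 2 := by positivity
  nlinarith

lemma norm_cpow_neg_sub_integral_le {s : ℂ} (hs : 1 < s.re) {n : ℝ} (hn : 1 ≤ n) :
    ‖(n : ℂ) ^ (-s) - ((n : ℂ) ^ (1 - s) - ((n + 1 : ℝ) : ℂ) ^ (1 - s)) / (s - 1)‖
      ≤ ‖s‖ / n ^ 2 := by
  have hs1 : s - 1 ≠ 0 := by
    intro h; have : s = 1 := by linear_combination h
    rw [this] at hs; simp at hs
  have h := (convex_Icc n (n + 1)).norm_image_sub_le_of_norm_hasDerivWithin_le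
    (f := fun y : ℝ => -((y : ℂ) ^ (-(s - 1)) / (s - 1)) - (y : ℂ) * (n : ℂ) ^ (-s))
    (f' := fun y : ℝ => (y : ℂ) ^ (-s) - (n : ℂ) ^ (-s))
    (C := ‖s‖ / n ^ 2)
    (fun y hy => by
      have hy0 : 0 < y := by linarith [hy.1]
      have h1 := ((hasDerivAt_ofReal_cpow_neg (s := s - 1) hy0).div_const (s - 1)).neg.sub
        ((hasDerivAt_id y).ofReal_comp.mul_const ((n : ℂ) ^ (-s)))
      refine (HasDerivAt.congr_deriv h1 ?_).hasDerivWithinAt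
      have : -(s - 1) - 1 = -s := by ring
      rw [this]
      field_simp
      simp)
    (fun y hy => norm_cpow_neg_sub_le hs.le hn hy.1 hy.2)
    (Set.left_mem_Icc.2 (by linarith)) (Set.right_mem_Icc.2 (by linarith))
  have h2 : ‖(n + 1) - n‖ = 1 := by rw [add_sub_cancel_left]; simp
  rw [h2, mul_one] at h
  have h3 : -(s - 1) = 1 - s := by ring
  rw [h3] at h
  rw [← norm_neg]
  refine le_trans (le_of_eq (congrArg norm ?_)) h
  push_cast
  ring

lemma sum_inv_sq_le {N : ℕ} (hN : 1 ≤ N) (M : ℕ) :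
    ∑ k ∈ Finset.range M, 1 / ((N + k + 1 : ℕ) : ℝ) ^ 2 ≤ (1 : ℝ) / N := by
  have hN' : (0 : ℝ) < N := by exact_mod_cast hN
  suffices h : ∑ k ∈ Finset.range M, 1 / ((N + k + 1 : ℕ) : ℝ) ^ 2
      ≤ (1 : ℝ) / N - 1 / ((N + M : ℕ) : ℝ) by
    have : (0 : ℝ) ≤ 1 / ((N + M : ℕ) : ℝ) := by positivity
    linarith
  induction M with
  | zero => simp
  | succ M ih =>
    rw [Finset.sum_range_succ]
    have h1 : 1 / ((N + M + 1 : ℕ) : ℝ) ^ 2 ≤ 1 / ((N + M : ℕ) : ℝ) - 1 / ((N + M + 1 : ℕ) : ℝ) := by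
      have h2 : (0 : ℝ) < (N : ℝ) + M := by positivity
      push_cast
      rw [div_sub_div _ _ h2.ne' (by positivity), div_le_div_iff₀ (by positivity) (by positivity)]
      nlinarith
    have h3 : ((N + (M + 1) : ℕ) : ℝ) = ((N + M + 1 : ℕ) : ℝ) := by push_cast; ring
    rw [h3]
    linarith

/-- Approximation of `ζ` by a partial sum of its Dirichlet series. -/
lemma norm_zeta_sub_sum_le {s : ℂ} (hs : 1 < s.re) {N : ℕ} (hN : 1 ≤ N) :
    ‖riemannZeta s - ∑ k ∈ Finset.range N, ((k + 1 : ℕ) : ℂ) ^ (-s)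
        - ((N + 1 : ℕ) : ℂ) ^ (1 - s) / (s - 1)‖ ≤ ‖s‖ / N := by
  have hs1 : s - 1 ≠ 0 := by
    intro h; have : s = 1 := by linear_combination h
    rw [this] at hs; simp at hs
  have hsum : HasSum (fun k : ℕ => ((k + 1 : ℕ) : ℂ) ^ (-s)) (riemannZeta s) := by
    rw [zeta_eq_tsum_one_div_nat_add_one_cpow hs]
    have h1 : Summable (fun k : ℕ => 1 / ((k : ℂ) + 1) ^ s) := by
      have := (summable_nat_add_iff 1).2 (Complex.summable_one_div_nat_cpow.2 hs)
      simpa using this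
    convert h1.hasSum using 1
    funext k
    rw [Complex.cpow_neg, one_div]; push_cast; rfl
  have hlim1 := hsum.tendsto_sum_nat
  have hlim2 : Tendsto (fun M : ℕ => ((N + M + 1 : ℕ) : ℂ) ^ (1 - s) / (s - 1)) atTop (𝓝 0) := by
    rw [tendsto_zero_iff_norm_tendsto_zero]
    have h1 : Tendsto (fun M : ℕ => ((N + M + 1 : ℕ) : ℝ) ^ (-(s.re - 1)) / ‖s - 1‖) atTop
        (𝓝 (0 / ‖s - 1‖)) := by
      refine Tendsto.div_const ?_ _
      refine (tendsto_rpow_neg_atTop (by linarith)).comp ?_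
      refine tendsto_natCast_atTop_atTop.comp ?_
      exact tendsto_atTop_mono (fun M => (by omega : M ≤ N + M + 1)) tendsto_id
    rw [zero_div] at h1
    refine h1.congr fun M => ?_
    rw [norm_div, Complex.norm_natCast_cpow_of_pos (by omega)]
    simp
  have hlim : Tendsto (fun M : ℕ => ∑ k ∈ Finset.range (N + M), ((k + 1 : ℕ) : ℂ) ^ (-s)
      - ∑ k ∈ Finset.range N, ((k + 1 : ℕ) : ℂ) ^ (-s)
      - (((N + 1 : ℕ) : ℂ) ^ (1 - s) / (s - 1) - ((N + M + 1 : ℕ) : ℂ) ^ (1 - s) / (s - 1)))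
      atTop (𝓝 (riemannZeta s - ∑ k ∈ Finset.range N, ((k + 1 : ℕ) : ℂ) ^ (-s)
        - (((N + 1 : ℕ) : ℂ) ^ (1 - s) / (s - 1) - 0))) := by
    refine Tendsto.sub (Tendsto.sub ?_ tendsto_const_nhds) (Tendsto.sub tendsto_const_nhds hlim2)
    have h2 := hlim1.comp (tendsto_add_atTop_nat N)
    refine h2.congr fun M => ?_
    simp only [Function.comp, add_comm M N]
  rw [sub_zero] at hlim
  refine le_of_tendsto hlim.norm (Eventually.of_forall fun M => ?_)
  rw [Finset.sum_range_add, add_sub_cancel_left]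
  have htel : ((N + 1 : ℕ) : ℂ) ^ (1 - s) / (s - 1) - ((N + M + 1 : ℕ) : ℂ) ^ (1 - s) / (s - 1)
      = ∑ k ∈ Finset.range M, (((N + k + 1 : ℕ) : ℂ) ^ (1 - s) / (s - 1)
          - ((N + (k + 1) + 1 : ℕ) : ℂ) ^ (1 - s) / (s - 1)) := by
    rw [Finset.sum_range_sub' (fun k => ((N + k + 1 : ℕ) : ℂ) ^ (1 - s) / (s - 1))]
  rw [htel, ← Finset.sum_sub_distrib]
  refine (norm_sum_le _ _).trans ?_
  have hterm : ∀ k ∈ Finset.range M, ‖((N + k + 1 : ℕ) : ℂ) ^ (-s)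
      - (((N + k + 1 : ℕ) : ℂ) ^ (1 - s) / (s - 1)
          - ((N + (k + 1) + 1 : ℕ) : ℂ) ^ (1 - s) / (s - 1))‖
      ≤ ‖s‖ * (1 / ((N + k + 1 : ℕ) : ℝ) ^ 2) := by
    intro k _
    have h1 := norm_cpow_neg_sub_integral_le hs (n := ((N + k + 1 : ℕ) : ℝ))
      (by exact_mod_cast (by omega : 1 ≤ N + k + 1))
    rw [sub_div] at h1
    rw [mul_one_div]
    have h3 : ((((N + k + 1 : ℕ) : ℝ) + 1 : ℝ) : ℂ) = ((N + (k + 1) + 1 : ℕ) : ℂ) := by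
      push_cast; ring
    rw [h3] at h1
    exact h1
  refine (Finset.sum_le_sum hterm).trans ?_
  rw [← Finset.mul_sum, div_eq_mul_one_div]
  gcongr
  exact sum_inv_sq_le hN M

lemma sum_one_div_le (N : ℕ) :
    ∑ k ∈ Finset.range N, 1 / ((k + 1 : ℕ) : ℝ) ≤ 1 + Real.log (N + 1) := by
  have h := harmonic_le_one_add_log N
  have h1 : ((harmonic N : ℚ) : ℝ) = ∑ k ∈ Finset.range N, 1 / ((k + 1 : ℕ) : ℝ) := by
    simp [harmonic]
  rw [← h1]
  refine h.trans ?_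
  rcases Nat.eq_zero_or_pos N with rfl | hN
  · simp
  · have : (0 : ℝ) < N := by exact_mod_cast hN
    gcongr
    linarith

lemma abs_exp_neg_sub_le {u v L : ℝ} (hu : 0 ≤ u) (hv : 0 ≤ v) (hL : 0 ≤ L) :
    |Real.exp (-(u * L)) - Real.exp (-(v * L))| ≤ |u - v| * L := by
  wlog h : u ≤ v generalizing u v
  · rw [abs_sub_comm, abs_sub_comm u v]
    exact this hv hu (not_le.1 h).le
  have h1 : Real.exp (-(v * L)) = Real.exp (-(u * L)) * Real.exp (-((v - u) * L)) := by
    rw [← Real.exp_add]; ring_nf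
  have h2 : Real.exp (-(u * L)) ≤ 1 := Real.exp_le_one_iff.2 (by nlinarith)
  have h3 := Real.add_one_le_exp (-((v - u) * L))
  have h4 : Real.exp (-((v - u) * L)) ≤ 1 := Real.exp_le_one_iff.2 (by nlinarith)
  have h5 := Real.exp_pos (-(u * L))
  rw [abs_of_nonneg (by rw [h1]; nlinarith), abs_sub_comm, abs_of_nonneg (by linarith), h1]
  nlinarith

lemma natCast_cpow_eq {n : ℕ} (hn : 1 ≤ n) (c u t : ℝ) :
    (n : ℂ) ^ (-((c : ℂ) + u + Complex.I * t))
      = ((Real.exp (-(u * Real.log n)) : ℝ) : ℂ) * (n : ℂ) ^ (-((c : ℂ) + Complex.I * t)) := by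
  have hn0 : (n : ℂ) ≠ 0 := by exact_mod_cast (by omega : n ≠ 0)
  rw [Complex.cpow_def_of_ne_zero hn0, Complex.cpow_def_of_ne_zero hn0, Complex.ofReal_exp,
    ← Complex.exp_add, ← Complex.natCast_log]
  congr 1
  push_cast; ring

lemma norm_natCast_cpow_eq {n : ℕ} (hn : 1 ≤ n) (c t : ℝ) :
    ‖(n : ℂ) ^ (-((c : ℂ) + Complex.I * t))‖ = (n : ℝ) ^ (-c) := by
  rw [Complex.norm_natCast_cpow_of_pos (by omega)]
  simp

lemma norm_one_add_le {u t : ℝ} (hu : 0 < u) (hu1 : u ≤ 1) :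
    ‖(1 + u + Complex.I * t : ℂ)‖ ≤ 2 + |t| := by
  refine (norm_add_le _ _).trans ?_
  have h1 : ‖(1 + u : ℂ)‖ = 1 + u := by
    rw [← Complex.ofReal_one, ← Complex.ofReal_add, Complex.norm_real, Real.norm_of_nonneg]
    linarith
  rw [h1, norm_mul, Complex.norm_I, Complex.norm_real, Real.norm_eq_abs]
  linarith

lemma abs_le_norm_add_I_mul (u t : ℝ) : |t| ≤ ‖(u + Complex.I * t : ℂ)‖ := by
  have h := Complex.abs_im_le_norm (u + Complex.I * t : ℂ)
  simpa using h

lemma one_lt_re_aux {u : ℝ} (hu : 0 < u) (t : ℝ) : 1 < (1 + u + Complex.I * t : ℂ).re := by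
  simp [hu]

/-- `ζ` is at most logarithmic at heights `|t| ≥ 1`: all terms of the partial sum are bounded by
those of the harmonic series. -/
lemma norm_zeta_le {u t : ℝ} (hu : 0 < u) (hu1 : u ≤ 1) (ht : 1 ≤ |t|) {N : ℕ}
    (hN : 1 ≤ N) (hNt : 2 + |t| ≤ N) :
    ‖riemannZeta (1 + u + Complex.I * t)‖ ≤ 3 + Real.log (N + 1) := by
  have h := norm_zeta_sub_sum_le (one_lt_re_aux hu t) hN
  have hN0 : (0 : ℝ) < N := by exact_mod_cast hN
  have h1 : ‖(1 + u + Complex.I * t : ℂ)‖ / N ≤ 1 := by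
    rw [div_le_one hN0]
    exact (norm_one_add_le hu hu1).trans hNt
  have h2 : ‖∑ k ∈ Finset.range N, ((k + 1 : ℕ) : ℂ) ^ (-(1 + u + Complex.I * t : ℂ))‖
      ≤ 1 + Real.log (N + 1) := by
    refine (norm_sum_le _ _).trans (le_trans (Finset.sum_le_sum fun k _ => ?_) (sum_one_div_le N))
    have h3 := natCast_cpow_eq (n := k + 1) (by omega) 1 u t
    rw [Complex.ofReal_one] at h3
    rw [h3, norm_mul, ← Complex.ofReal_one, norm_natCast_cpow_eq (by omega), Complex.norm_real,
      Real.norm_of_nonneg (Real.exp_pos _).le, Real.rpow_neg_one, ← one_div]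
    refine mul_le_of_le_one_left (by positivity) (Real.exp_le_one_iff.2 ?_)
    have : 0 ≤ Real.log ((k + 1 : ℕ) : ℝ) := Real.log_natCast_nonneg _
    nlinarith
  have h4 : ‖((N + 1 : ℕ) : ℂ) ^ (1 - (1 + u + Complex.I * t : ℂ))
      / ((1 + u + Complex.I * t : ℂ) - 1)‖ ≤ 1 := by
    have e1 : (1 : ℂ) - (1 + u + Complex.I * t) = -((u : ℂ) + Complex.I * t) := by ring
    have e2 : (1 + u + Complex.I * t : ℂ) - 1 = u + Complex.I * t := by ring
    rw [e1, e2, norm_div, norm_natCast_cpow_eq (by omega)]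
    have h5 := abs_le_norm_add_I_mul u t
    rw [div_le_one (by linarith)]
    refine le_trans ?_ (ht.trans h5)
    apply Real.rpow_le_one_of_one_le_of_nonpos
    · exact_mod_cast (by omega : 1 ≤ N + 1)
    · linarith
  set S := ∑ k ∈ Finset.range N, ((k + 1 : ℕ) : ℂ) ^ (-(1 + u + Complex.I * t : ℂ))
  set Q := ((N + 1 : ℕ) : ℂ) ^ (1 - (1 + u + Complex.I * t : ℂ))
      / ((1 + u + Complex.I * t : ℂ) - 1)
  have h6 : riemannZeta (1 + u + Complex.I * t)
      = (riemannZeta (1 + u + Complex.I * t) - S - Q) + S + Q := by ring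
  rw [h6]
  refine (norm_add₃_le).trans ?_
  linarith

/-- `ζ` varies slowly in the horizontal direction at heights `|t| ≥ 1`. -/
lemma norm_zeta_sub_le {u v t : ℝ} (hu : 0 < u) (hu1 : u ≤ 1) (hv : 0 < v) (hv1 : v ≤ 1)
    (ht : 1 ≤ |t|) {N : ℕ} (hN : 1 ≤ N) :
    ‖riemannZeta (1 + u + Complex.I * t) - riemannZeta (1 + v + Complex.I * t)‖
      ≤ |u - v| * (2 + Real.log (N + 1)) ^ 2 + 2 * ((2 + |t|) / N) := by
  have hN0 : (0 : ℝ) < N := by exact_mod_cast hN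
  have hlog : 0 ≤ Real.log ((N : ℝ) + 1) := Real.log_nonneg (by linarith)
  have happ : ∀ w : ℝ, 0 < w → w ≤ 1 →
      ‖riemannZeta (1 + w + Complex.I * t)
        - ∑ k ∈ Finset.range N, ((k + 1 : ℕ) : ℂ) ^ (-(1 + w + Complex.I * t : ℂ))
        - ((N + 1 : ℕ) : ℂ) ^ (1 - (1 + w + Complex.I * t : ℂ))
          / ((1 + w + Complex.I * t : ℂ) - 1)‖ ≤ (2 + |t|) / N := fun w hw hw1 =>
    (norm_zeta_sub_sum_le (one_lt_re_aux hw t) hN).trans (by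
      gcongr; exact norm_one_add_le hw hw1)
  have h2 : ‖∑ k ∈ Finset.range N, ((k + 1 : ℕ) : ℂ) ^ (-(1 + u + Complex.I * t : ℂ))
      - ∑ k ∈ Finset.range N, ((k + 1 : ℕ) : ℂ) ^ (-(1 + v + Complex.I * t : ℂ))‖
      ≤ |u - v| * Real.log (N + 1) * (1 + Real.log (N + 1)) := by
    rw [← Finset.sum_sub_distrib]
    refine (norm_sum_le _ _).trans ?_
    calc _ ≤ ∑ k ∈ Finset.range N, |u - v| * Real.log (N + 1) * (1 / ((k + 1 : ℕ) : ℝ)) := by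
          refine Finset.sum_le_sum fun k hk => ?_
          have hkN : ((k + 1 : ℕ) : ℝ) ≤ N + 1 := by
            have := Finset.mem_range.1 hk
            exact_mod_cast (by omega : k + 1 ≤ N + 1)
          have h3 := natCast_cpow_eq (n := k + 1) (by omega) 1 u t
          have h4 := natCast_cpow_eq (n := k + 1) (by omega) 1 v t
          rw [Complex.ofReal_one] at h3 h4
          rw [h3, h4, ← sub_mul, norm_mul, ← Complex.ofReal_one, norm_natCast_cpow_eq (by omega),
            ← Complex.ofReal_sub, Complex.norm_real, Real.rpow_neg_one, ← one_div,
            Real.norm_eq_abs]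
          gcongr
          refine (abs_exp_neg_sub_le hu.le hv.le (Real.log_natCast_nonneg _)).trans ?_
          gcongr
      _ = |u - v| * Real.log (N + 1) * ∑ k ∈ Finset.range N, 1 / ((k + 1 : ℕ) : ℝ) := by
          rw [Finset.mul_sum]
      _ ≤ _ := by
          gcongr
          exact sum_one_div_le N
  have h4 : ‖((N + 1 : ℕ) : ℂ) ^ (1 - (1 + u + Complex.I * t : ℂ))
        / ((1 + u + Complex.I * t : ℂ) - 1)
      - ((N + 1 : ℕ) : ℂ) ^ (1 - (1 + v + Complex.I * t : ℂ))
        / ((1 + v + Complex.I * t : ℂ) - 1)‖ ≤ |u - v| * Real.log (N + 1) + |u - v| := by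
    have e1 : ∀ w : ℝ, (1 : ℂ) - (1 + w + Complex.I * t) = -(((0 : ℝ) : ℂ) + w + Complex.I * t) := by
      intro w; push_cast; ring
    have e2 : ∀ w : ℝ, (1 + w + Complex.I * t : ℂ) - 1 = w + Complex.I * t := by
      intro w; ring
    rw [e1, e1, e2, e2, natCast_cpow_eq (by omega), natCast_cpow_eq (n := N + 1) (by omega) 0 v]
    have hnu := ht.trans (abs_le_norm_add_I_mul u t)
    have hnv := ht.trans (abs_le_norm_add_I_mul v t)
    have hu0 : (u + Complex.I * t : ℂ) ≠ 0 := norm_ne_zero_iff.1 (by linarith)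
    have hv0 : (v + Complex.I * t : ℂ) ≠ 0 := norm_ne_zero_iff.1 (by linarith)
    set q := ((N + 1 : ℕ) : ℂ) ^ (-(((0 : ℝ) : ℂ) + Complex.I * t))
    have hq : ‖q‖ = 1 := by
      rw [norm_natCast_cpow_eq (by omega)]; simp
    set x := Real.exp (-(u * Real.log ((N + 1 : ℕ) : ℝ)))
    set y := Real.exp (-(v * Real.log ((N + 1 : ℕ) : ℝ)))
    have hxy : |x - y| ≤ |u - v| * Real.log (N + 1) := by
      have := abs_exp_neg_sub_le hu.le hv.le (Real.log_natCast_nonneg (N + 1))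
      push_cast at this
      simpa [x, y] using this
    have hy1 : |y| ≤ 1 := by
      rw [abs_of_pos (Real.exp_pos _)]
      exact Real.exp_le_one_iff.2 (by
        have := Real.log_natCast_nonneg (N + 1)
        nlinarith)
    have e3 : (x : ℂ) * q / (u + Complex.I * t) - (y : ℂ) * q / (v + Complex.I * t)
        = ((x - y : ℝ) : ℂ) * q / (u + Complex.I * t)
          + (y : ℂ) * q * ((v - u : ℝ) : ℂ) / ((u + Complex.I * t) * (v + Complex.I * t)) := by
      field_simp
      push_cast
      ring
    rw [e3]
    refine (norm_add_le _ _).trans ?_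
    rw [norm_div, norm_div, norm_mul, norm_mul, norm_mul, norm_mul, hq, Complex.norm_real,
      Complex.norm_real, Complex.norm_real, Real.norm_eq_abs, Real.norm_eq_abs, Real.norm_eq_abs,
      abs_sub_comm v u]
    gcongr
    · rw [mul_one]
      exact (div_le_self (abs_nonneg _) hnu).trans hxy
    · rw [mul_one]
      refine (div_le_self (by positivity) (by nlinarith)).trans ?_
      exact mul_le_of_le_one_left (abs_nonneg _) hy1
  have hU := happ u hu hu1
  have hV := happ v hv hv1
  set Su := ∑ k ∈ Finset.range N, ((k + 1 : ℕ) : ℂ) ^ (-(1 + u + Complex.I * t : ℂ))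
  set Sv := ∑ k ∈ Finset.range N, ((k + 1 : ℕ) : ℂ) ^ (-(1 + v + Complex.I * t : ℂ))
  set Qu := ((N + 1 : ℕ) : ℂ) ^ (1 - (1 + u + Complex.I * t : ℂ))
      / ((1 + u + Complex.I * t : ℂ) - 1)
  set Qv := ((N + 1 : ℕ) : ℂ) ^ (1 - (1 + v + Complex.I * t : ℂ))
      / ((1 + v + Complex.I * t : ℂ) - 1)
  have e : riemannZeta (1 + u + Complex.I * t) - riemannZeta (1 + v + Complex.I * t)
      = (riemannZeta (1 + u + Complex.I * t) - Su - Qu)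
        - (riemannZeta (1 + v + Complex.I * t) - Sv - Qv) + (Su - Sv) + (Qu - Qv) := by ring
  rw [e]
  refine (norm_add₃_le).trans ?_
  have h5 := norm_sub_le (riemannZeta (1 + u + Complex.I * t) - Su - Qu)
    (riemannZeta (1 + v + Complex.I * t) - Sv - Qv)
  have h6 : |u - v| * Real.log (N + 1) * (1 + Real.log (N + 1))
      + (|u - v| * Real.log (N + 1) + |u - v|) ≤ |u - v| * (2 + Real.log (N + 1)) ^ 2 := by
    have := abs_nonneg (u - v)
    nlinarith [mul_nonneg this hlog]
  linarith

lemma norm_zeta_one_add_le {u : ℝ} (hu : 0 < u) (hu1 : u ≤ 1) :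
    ‖riemannZeta (1 + u)‖ ≤ 4 / u := by
  have h := norm_zeta_sub_sum_le (s := 1 + u) (by simp [hu]) (le_refl 1)
  have h1 : ‖(1 + u : ℂ)‖ = 1 + u := by
    rw [← Complex.ofReal_one, ← Complex.ofReal_add, Complex.norm_real, Real.norm_of_nonneg]
    linarith
  have h2 : ‖((1 + 1 : ℕ) : ℂ) ^ (1 - (1 + u : ℂ)) / ((1 + u : ℂ) - 1)‖ ≤ 1 / u := by
    have e1 : (1 : ℂ) - (1 + u) = ((-u : ℝ) : ℂ) := by push_cast; ring
    have e2 : (1 + u : ℂ) - 1 = u := by ring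
    rw [e1, e2, norm_div, Complex.norm_natCast_cpow_of_pos (by omega), Complex.norm_real,
      Real.norm_of_nonneg hu.le]
    gcongr
    apply Real.rpow_le_one_of_one_le_of_nonpos
    · norm_num
    · simp [hu.le]
  rw [Finset.sum_range_one, zero_add, Nat.cast_one, Complex.one_cpow, h1] at h
  set Q := ((1 + 1 : ℕ) : ℂ) ^ (1 - (1 + u : ℂ)) / ((1 + u : ℂ) - 1)
  have h6 : riemannZeta (1 + u) = (riemannZeta (1 + u) - 1 - Q) + 1 + Q := by ring
  rw [h6]
  refine (norm_add₃_le).trans ?_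
  rw [norm_one]
  have h7 : 1 ≤ 1 / u := by rw [le_div_iff₀ hu]; linarith
  have h8 : 4 / u = 4 * (1 / u) := by ring
  simp only [Nat.cast_one, div_one] at h
  rw [h8]
  linarith

/-- The `3-4-1` inequality. -/
lemma one_le_norm_zeta_mul {u : ℝ} (hu : 0 < u) (t : ℝ) :
    1 ≤ ‖riemannZeta (1 + u)‖ ^ 3 * ‖riemannZeta (1 + u + Complex.I * t)‖ ^ 4
      * ‖riemannZeta (1 + u + Complex.I * (2 * t : ℝ))‖ := by
  have h := DirichletCharacter.norm_LFunction_product_ge_one (N := 1) 1 hu t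
  rw [one_pow] at h
  simp only [DirichletCharacter.LFunctionTrivChar, DirichletCharacter.LFunction_modOne_eq,
    norm_mul, norm_pow] at h
  have e : (1 + u + Complex.I * (2 * t : ℝ) : ℂ) = 1 + u + 2 * Complex.I * t := by
    push_cast; ring
  rw [e]
  exact h

/-! ### Increments of `log |ζ|` -/

lemma eventually_log_pow_le {C κ : ℝ} (hκ : 0 < κ) :
    ∀ᶠ A : ℝ in atTop, (C * Real.log A) ^ 2 ≤ A ^ κ := by
  have h1 : (fun A : ℝ => Real.log A ^ (2 : ℝ)) =o[atTop] fun A => A ^ κ :=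
    isLittleO_log_rpow_rpow_atTop 2 hκ
  filter_upwards [h1.bound (show (0 : ℝ) < 1 / (C ^ 2 + 1) by positivity), eventually_ge_atTop 1]
    with A hA hA1
  have hA0 : (0 : ℝ) < A := by linarith
  rw [Real.rpow_two, Real.norm_of_nonneg (by positivity), Real.norm_of_nonneg (by positivity),
    one_div, inv_mul_eq_div, le_div_iff₀ (by positivity)] at hA
  nlinarith [sq_nonneg (Real.log A)]

lemma eventually_rpow_neg_le {κ ε : ℝ} (hκ : 0 < κ) (hε : 0 < ε) :
    ∀ᶠ A : ℝ in atTop, A ^ (-κ) ≤ ε :=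
  (tendsto_rpow_neg_atTop hκ).eventually_le_const hε

/-- On polynomially large heights, `ζ` and its variation to the right of the line `Re s = 1` are
bounded by any fixed positive power of `A`. -/
lemma eventually_norm_zeta_le {Θ κ : ℝ} (G : ℝ) (hΘ : 0 ≤ Θ) (hκ : 0 < κ) :
    ∀ᶠ A : ℝ in atTop, ∀ t : ℝ, 1 ≤ |t| → |t| ≤ A ^ Θ → ∀ u : ℝ, 0 < u → u ≤ 1 →
      ‖riemannZeta (1 + u + Complex.I * t)‖ ≤ A ^ κ ∧
      ∀ v : ℝ, 0 < v → v ≤ 1 →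
        ‖riemannZeta (1 + u + Complex.I * t) - riemannZeta (1 + v + Complex.I * t)‖
          ≤ |u - v| * A ^ κ + A ^ (-G) := by
  set E : ℝ := Θ + |G| + 1 with hE
  have hE0 : 0 < E := by positivity
  filter_upwards [eventually_log_pow_le (C := E + 4) hκ, eventually_ge_atTop 6,
    Real.tendsto_log_atTop.eventually_ge_atTop 1] with A hlog hA6 hl1 t ht1 ht u hu hu1
  have hA1 : (1 : ℝ) ≤ A := by linarith
  have hA0 : (0 : ℝ) < A := by linarith
  set N := ⌈A ^ E⌉₊
  have hNge : A ^ E ≤ N := Nat.le_ceil _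
  have hAE : 1 ≤ A ^ E := Real.one_le_rpow hA1 hE0.le
  have hN1 : 1 ≤ N := by
    have : (1 : ℝ) ≤ N := hAE.trans hNge
    exact_mod_cast this
  have hN0 : (0 : ℝ) < N := by exact_mod_cast hN1
  have hNle : (N : ℝ) + 1 ≤ 3 * A ^ E := by
    have := (Nat.ceil_lt_add_one (a := A ^ E) (by positivity)).le
    linarith
  have ht3 : 2 + |t| ≤ 3 * A ^ Θ := by
    have : 1 ≤ A ^ Θ := Real.one_le_rpow hA1 hΘ
    linarith
  have hlogN : Real.log ((N : ℝ) + 1) ≤ (E + 1) * Real.log A := by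
    calc Real.log ((N : ℝ) + 1) ≤ Real.log (3 * A ^ E) := Real.log_le_log (by positivity) hNle
      _ ≤ Real.log (A ^ (E + 1)) := by
          apply Real.log_le_log (by positivity)
          have h1 := Real.rpow_add_one hA0.ne' E
          rw [h1]
          nlinarith
      _ = _ := Real.log_rpow hA0 _
  have hlogN0 : 0 ≤ Real.log ((N : ℝ) + 1) := Real.log_nonneg (by linarith)
  have h3l : 3 + Real.log ((N : ℝ) + 1) ≤ (E + 4) * Real.log A := by nlinarith
  have hpow : 3 + Real.log ((N : ℝ) + 1) ≤ A ^ κ := by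
    refine le_trans ?_ hlog
    nlinarith
  have hratio : (2 + |t|) / N ≤ A ^ (-G) / 2 := by
    rw [div_le_iff₀ hN0]
    have h1 : A ^ (-G) * A ^ E = A ^ Θ * A ^ (|G| - G) * A := by
      rw [← Real.rpow_add hA0, ← Real.rpow_add hA0, ← Real.rpow_add_one hA0.ne']
      congr 1
      rw [hE]; ring
    have h2 : 1 ≤ A ^ (|G| - G) := Real.one_le_rpow hA1 (by linarith [le_abs_self G])
    have h3 : 0 < A ^ Θ := by positivity
    have h4 : 6 * A ^ Θ ≤ A ^ Θ * A ^ (|G| - G) * A := by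
      calc 6 * A ^ Θ = A ^ Θ * 1 * 6 := by ring
        _ ≤ _ := by gcongr
    have h5 : A ^ (-G) * A ^ E ≤ A ^ (-G) * N := by gcongr
    linarith
  refine ⟨?_, fun v hv hv1 => ?_⟩
  · refine (norm_zeta_le hu hu1 ht1 hN1 ?_).trans hpow
    refine le_trans ?_ hNge
    have h1 : A ^ E = A ^ Θ * A ^ |G| * A := by
      rw [← Real.rpow_add hA0, ← Real.rpow_add_one hA0.ne']
    have h2 : 1 ≤ A ^ |G| := Real.one_le_rpow hA1 (abs_nonneg _)
    have h3 : 3 * A ^ Θ ≤ A ^ Θ * A ^ |G| * A := by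
      calc 3 * A ^ Θ = A ^ Θ * 1 * 3 := by ring
        _ ≤ A ^ Θ * A ^ |G| * A := by gcongr; linarith
    linarith
  · refine (norm_zeta_sub_le hu hu1 hv hv1 ht1 hN1).trans ?_
    have h1 : (2 + Real.log ((N : ℝ) + 1)) ^ 2 ≤ A ^ κ := by
      refine le_trans ?_ hlog
      gcongr
      linarith
    have h2 : |u - v| * (2 + Real.log ((N : ℝ) + 1)) ^ 2 ≤ |u - v| * A ^ κ := by gcongr
    linarith

/-- Quantitative non-vanishing of `ζ` near the line `Re s = 1` at polynomially large heights. -/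
lemma eventually_le_norm_zeta {Θ γ : ℝ} (hΘ : 0 ≤ Θ) (hγ : 0 < γ) :
    ∀ᶠ A : ℝ in atTop, ∀ t : ℝ, 1 ≤ |t| → |t| ≤ A ^ Θ → ∀ u : ℝ, 0 < u → u ≤ A ^ (-γ) →
      A ^ (-γ) ≤ ‖riemannZeta (1 + u + Complex.I * t)‖ := by
  filter_upwards [eventually_norm_zeta_le (Θ := Θ + 1) (κ := γ / 10) γ (by linarith) (by linarith),
    eventually_ge_atTop 2, (tendsto_rpow_atTop (show 0 < γ / 2 by linarith)).eventually_gt_atTop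
      5184] with A hA hA2 hAγ t ht1 ht u hu hu1
  have hA0 : (0 : ℝ) < A := by linarith
  have hAneg : A ^ (-γ) ≤ 1 := Real.rpow_le_one_of_one_le_of_nonpos (by linarith) (by linarith)
  have hAγ0 : 0 < A ^ (-γ) := by positivity
  have hA1 : A ^ Θ ≤ A ^ (Θ + 1) := Real.rpow_le_rpow_of_exponent_le (by linarith) (by linarith)
  have h2t : |2 * t| ≤ A ^ (Θ + 1) := by
    rw [abs_mul, Real.rpow_add_one hA0.ne', abs_two]
    nlinarith [abs_nonneg t]
  have h2t1 : 1 ≤ |2 * t| := by rw [abs_mul, abs_two]; linarith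
  -- the `3-4-1` inequality is applied at abscissa `1 + A ^ (-γ)`; `ζ` hardly changes from there to
  -- the abscissa `1 + u`
  have hmain := one_le_norm_zeta_mul hAγ0 t
  have h1 := norm_zeta_one_add_le hAγ0 hAneg
  have h2 := (hA (2 * t) h2t1 h2t (A ^ (-γ)) hAγ0 hAneg).1
  have h3 := ((hA t ht1 (ht.trans hA1) (A ^ (-γ)) hAγ0 hAneg).2 u hu (hu1.trans hAneg))
  set X := ‖riemannZeta (1 + (A ^ (-γ) : ℝ) + Complex.I * t)‖
  have hX0 : 0 ≤ X := norm_nonneg _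
  have h4 : 3 * A ^ (-γ + γ / 10) ≤ X := by
    by_contra hcon
    have hcon := not_le.1 hcon
    have h5 : (1 : ℝ) ≤ (4 / A ^ (-γ)) ^ 3 * (3 * A ^ (-γ + γ / 10)) ^ 4 * A ^ (γ / 10) := by
      refine hmain.trans ?_
      gcongr
    have h6 : (4 / A ^ (-γ)) ^ 3 * (3 * A ^ (-γ + γ / 10)) ^ 4 * A ^ (γ / 10)
        = 5184 * A ^ (-(γ / 2)) := by
      have e1 : (4 / A ^ (-γ)) ^ 3 = 64 * A ^ (3 * γ) := by
        rw [Real.rpow_neg hA0.le, div_inv_eq_mul, mul_pow, ← Real.rpow_natCast (A ^ γ),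
          ← Real.rpow_mul hA0.le]
        norm_num
        ring_nf
      have e2 : (3 * A ^ (-γ + γ / 10)) ^ 4 = 81 * A ^ (4 * (-γ + γ / 10)) := by
        rw [mul_pow, ← Real.rpow_natCast (A ^ (-γ + γ / 10)), ← Real.rpow_mul hA0.le]
        norm_num
        ring_nf
      rw [e1, e2]
      calc _ = 5184 * (A ^ (3 * γ) * A ^ (4 * (-γ + γ / 10)) * A ^ (γ / 10)) := by ring
        _ = _ := by
          rw [← Real.rpow_add hA0, ← Real.rpow_add hA0]
          ring_nf
    rw [h6, Real.rpow_neg hA0.le, ← div_eq_mul_inv, le_div_iff₀ (by positivity)] at h5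
    linarith
  have h5 : |A ^ (-γ) - u| ≤ A ^ (-γ) := by
    rw [abs_of_nonneg (by linarith)]; linarith
  have h6 : |A ^ (-γ) - u| * A ^ (γ / 10) ≤ A ^ (-γ + γ / 10) := by
    rw [Real.rpow_add hA0]; gcongr
  have h7 : A ^ (-γ) ≤ A ^ (-γ + γ / 10) :=
    Real.rpow_le_rpow_of_exponent_le (by linarith) (by linarith)
  have h8 := norm_sub_norm_le (riemannZeta (1 + (A ^ (-γ) : ℝ) + Complex.I * t))
    (riemannZeta (1 + u + Complex.I * t))
  linarith

lemma log_norm_sub_log_norm_le {x y : ℂ} (hx : x ≠ 0) (hy : y ≠ 0) :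
    Real.log ‖x‖ - Real.log ‖y‖ ≤ ‖x - y‖ / ‖y‖ := by
  have hx0 : 0 < ‖x‖ := norm_pos_iff.2 hx
  have hy0 : 0 < ‖y‖ := norm_pos_iff.2 hy
  rw [← Real.log_div hx0.ne' hy0.ne']
  refine (Real.log_le_sub_one_of_pos (by positivity)).trans ?_
  rw [le_div_iff₀ hy0, sub_mul, div_mul_cancel₀ _ hy0.ne', one_mul]
  exact norm_sub_norm_le _ _

lemma zeta_ne_zero {u : ℝ} (hu : 0 < u) (t : ℝ) : riemannZeta (1 + u + Complex.I * t) ≠ 0 :=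
  riemannZeta_ne_zero_of_one_le_re (one_lt_re_aux hu t).le

/-- The variation of `log |ζ|` at heights `|t| ≥ 1`: the variation of `ζ`, divided by its lower
bound. -/
lemma eventually_log_zeta_sub_le_of_one_le {Θ σ ε : ℝ} (hΘ : 0 ≤ Θ) (hσ : 0 < σ) (hε : 0 < ε) :
    ∀ᶠ A : ℝ in atTop, ∀ t : ℝ, 1 ≤ |t| → |t| ≤ A ^ Θ → ∀ δ δ' : ℝ, 0 < δ' → δ' ≤ δ →
      δ ≤ A ^ (-σ) →
      Real.log ‖riemannZeta (1 + δ' + Complex.I * t)‖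
        - Real.log ‖riemannZeta (1 + δ + Complex.I * t)‖ ≤ ε := by
  filter_upwards [eventually_norm_zeta_le (Θ := Θ) (κ := σ / 4) σ hΘ (by linarith),
    eventually_le_norm_zeta (Θ := Θ) (γ := σ / 2) hΘ (by linarith), eventually_ge_atTop 1,
    eventually_rpow_neg_le (κ := σ / 4) (show 0 < σ / 4 by linarith) (half_pos hε)]
    with A hA hA' hA1 hAε t ht1 ht δ δ' hδ' hδδ' hδ
  have hA0 : (0 : ℝ) < A := by linarith
  have hδ0 : 0 < δ := hδ'.trans_le hδδ'
  have hδ1 : δ ≤ 1 :=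
    hδ.trans (Real.rpow_le_one_of_one_le_of_nonpos hA1 (by linarith))
  refine (log_norm_sub_log_norm_le (zeta_ne_zero hδ' t) (zeta_ne_zero hδ0 t)).trans ?_
  have h1 := (hA t ht1 ht δ' hδ' (hδδ'.trans hδ1)).2 δ hδ0 hδ1
  have h2 := hA' t ht1 ht δ hδ0
    (hδ.trans (Real.rpow_le_rpow_of_exponent_le hA1 (by linarith)))
  have h3 : |δ' - δ| ≤ A ^ (-σ) := by
    rw [abs_sub_comm, abs_of_nonneg (by linarith)]; linarith
  have hz0 : 0 < ‖riemannZeta (1 + δ + Complex.I * t)‖ := lt_of_lt_of_le (by positivity) h2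
  rw [div_le_iff₀ hz0]
  have h4 : |δ' - δ| * A ^ (σ / 4) ≤ A ^ (-(σ / 4)) * A ^ (-(σ / 2)) := by
    calc |δ' - δ| * A ^ (σ / 4) ≤ A ^ (-σ) * A ^ (σ / 4) := by gcongr
      _ = _ := by rw [← Real.rpow_add hA0, ← Real.rpow_add hA0]; ring_nf
  have h5 : A ^ (-σ) ≤ A ^ (-(σ / 4)) * A ^ (-(σ / 2)) := by
    rw [← Real.rpow_add hA0]
    exact Real.rpow_le_rpow_of_exponent_le hA1 (by linarith)
  calc _ ≤ 2 * (A ^ (-(σ / 4)) * A ^ (-(σ / 2))) := by linarith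
    _ ≤ 2 * (ε / 2 * A ^ (-(σ / 2))) := by gcongr
    _ = ε * A ^ (-(σ / 2)) := by ring
    _ ≤ _ := by gcongr

lemma riemannZeta₁_ne_zero {u t : ℝ} (hu : 0 ≤ u) : riemannZeta₁ (1 + u + Complex.I * t) ≠ 0 := by
  by_cases h1 : (1 + u + Complex.I * t : ℂ) = 1
  · rw [h1, riemannZeta₁_one]; exact one_ne_zero
  · intro h
    have h2 := riemannZeta_eq_inv_sub_mul h1
    rw [h, mul_zero] at h2
    exact riemannZeta_ne_zero_of_one_le_re (by simp [hu]) h2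

/-- Uniform continuity of `log |(s - 1) ζ(s)|` near the segment `[1 - i, 1 + i]`. -/
lemma exists_log_zeta₁_sub_le {ε : ℝ} (hε : 0 < ε) :
    ∃ δ₀ > 0, δ₀ ≤ 1 ∧ ∀ t : ℝ, |t| ≤ 1 → ∀ u v : ℝ, 0 ≤ u → u ≤ δ₀ → 0 ≤ v → v ≤ δ₀ →
      Real.log ‖riemannZeta₁ (1 + u + Complex.I * t)‖
        - Real.log ‖riemannZeta₁ (1 + v + Complex.I * t)‖ ≤ ε := by
  have hK : IsCompact (Set.Icc (0 : ℝ) 1 ×ˢ Set.Icc (-1 : ℝ) 1) := isCompact_Icc.prod isCompact_Icc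
  have hc : ContinuousOn (fun q : ℝ × ℝ => Real.log ‖riemannZeta₁ (1 + q.1 + Complex.I * q.2)‖)
      (Set.Icc (0 : ℝ) 1 ×ˢ Set.Icc (-1 : ℝ) 1) := by
    refine ContinuousOn.log ?_ ?_
    · have := differentiable_riemannZeta₁.continuous
      fun_prop
    · rintro ⟨u, t⟩ hq
      exact norm_ne_zero_iff.2 (riemannZeta₁_ne_zero (hq.1.1))
  have hu := hK.uniformContinuousOn_of_continuous hc
  rw [Metric.uniformContinuousOn_iff] at hu
  obtain ⟨d, hd, h⟩ := hu ε hε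
  refine ⟨min 1 (d / 2), by positivity, min_le_left _ _, fun t ht u v hu0 hu1 hv0 hv1 => ?_⟩
  have ht' := abs_le.1 ht
  have hd2 := min_le_right 1 (d / 2)
  have hd1 := min_le_left 1 (d / 2)
  have h1 := h (u, t) ⟨⟨hu0, hu1.trans hd1⟩, ⟨ht'.1, ht'.2⟩⟩ (v, t)
    ⟨⟨hv0, hv1.trans hd1⟩, ⟨ht'.1, ht'.2⟩⟩ (by
      rw [Prod.dist_eq, dist_self, max_eq_left dist_nonneg, Real.dist_eq, abs_lt]
      constructor <;> linarith)
  rw [Real.dist_eq] at h1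
  exact (le_abs_self _).trans h1.le

/-- Separation of the pole: `riemannZeta₁ s = (s - 1) ζ(s)`. -/
lemma log_norm_zeta_eq {u : ℝ} (hu : 0 < u) (t : ℝ) :
    Real.log ‖riemannZeta (1 + u + Complex.I * t)‖
      = Real.log ‖riemannZeta₁ (1 + u + Complex.I * t)‖ - Real.log ‖(u + Complex.I * t : ℂ)‖ := by
  have hne : (u + Complex.I * t : ℂ) ≠ 0 := by
    intro h
    have := congrArg Complex.re h
    simp at this
    exact hu.ne' this
  have h1 : (1 + u + Complex.I * t : ℂ) ≠ 1 := by
    intro h; apply hne; linear_combination h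
  rw [riemannZeta_eq_inv_sub_mul h1]
  have e : (1 + u + Complex.I * t : ℂ) - 1 = u + Complex.I * t := by ring
  rw [e, norm_mul, norm_inv, Real.log_mul, Real.log_inv]
  · ring
  · exact inv_ne_zero (norm_ne_zero_iff.2 hne)
  · exact norm_ne_zero_iff.2 (riemannZeta₁_ne_zero hu.le)

/-- Decorrelation: the variation of `log |ζ(1 + δ + it)|` for `δ ≤ A ^ (-(σ + η))` is negligible
as soon as `|t| ≥ A ^ (-σ)`. -/
lemma eventually_log_zeta_sub_le {Θ σ η ε : ℝ} (hΘ : 0 ≤ Θ) (hσ : 0 < σ) (hη : 0 < η)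
    (hε : 0 < ε) :
    ∀ᶠ A : ℝ in atTop, ∀ t : ℝ, A ^ (-σ) ≤ |t| → |t| ≤ A ^ Θ → ∀ δ δ' : ℝ, 0 < δ' → δ' ≤ δ →
      δ ≤ A ^ (-(σ + η)) →
      Real.log ‖riemannZeta (1 + δ' + Complex.I * t)‖
        - Real.log ‖riemannZeta (1 + δ + Complex.I * t)‖ ≤ ε := by
  obtain ⟨δ₀, hδ₀, hδ₀1, hunif⟩ := exists_log_zeta₁_sub_le (half_pos hε)
  filter_upwards [eventually_log_zeta_sub_le_of_one_le hΘ hσ hε, eventually_ge_atTop 1,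
    eventually_rpow_neg_le hη (half_pos hε), eventually_rpow_neg_le (add_pos hσ hη) hδ₀]
    with A hA hA1 hAη hAσ t ht1 ht δ δ' hδ' hδδ' hδ
  have hA0 : (0 : ℝ) < A := by linarith
  have hδ0 : 0 < δ := hδ'.trans_le hδδ'
  rcases le_total 1 |t| with h1 | h1
  · exact hA t h1 ht δ δ' hδ' hδδ'
      (hδ.trans (Real.rpow_le_rpow_of_exponent_le hA1 (by linarith)))
  · have h2 := hunif t h1 δ' δ hδ'.le (hδδ'.trans (hδ.trans hAσ)) hδ0.le (hδ.trans hAσ)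
    rw [log_norm_zeta_eq hδ' t, log_norm_zeta_eq hδ0 t]
    have ht0 : 0 < |t| := lt_of_lt_of_le (by positivity) ht1
    have hne : ∀ w : ℝ, (w + Complex.I * t : ℂ) ≠ 0 := fun w =>
      norm_ne_zero_iff.1 (lt_of_lt_of_le ht0 (abs_le_norm_add_I_mul w t)).ne'
    have h3 := log_norm_sub_log_norm_le (hne δ) (hne δ')
    have h4 : ‖(δ + Complex.I * t : ℂ) - (δ' + Complex.I * t)‖ / ‖(δ' + Complex.I * t : ℂ)‖
        ≤ ε / 2 := by
      have e : (δ + Complex.I * t : ℂ) - (δ' + Complex.I * t) = ((δ - δ' : ℝ) : ℂ) := by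
        push_cast; ring
      rw [e, Complex.norm_real, Real.norm_of_nonneg (by linarith)]
      calc (δ - δ') / ‖(δ' + Complex.I * t : ℂ)‖ ≤ A ^ (-(σ + η)) / A ^ (-σ) := by
            gcongr
            · linarith
            · exact ht1.trans (abs_le_norm_add_I_mul δ' t)
        _ = A ^ (-η) := by
            rw [← Real.rpow_sub hA0]; ring_nf
        _ ≤ _ := hAη
    linarith

/-- On the real axis the pole of `ζ` at `1` is the only source of growth. -/
lemma eventually_abs_log_zeta_sub_le {σ σ' : ℝ} (hσ : 0 < σ) (hσ' : 0 < σ') {ε : ℝ}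
    (hε : 0 < ε) :
    ∀ᶠ A : ℝ in atTop,
      |Real.log ‖riemannZeta (1 + (A ^ (-σ') : ℝ) + Complex.I * (0 : ℝ))‖
        - Real.log ‖riemannZeta (1 + (A ^ (-σ) : ℝ) + Complex.I * (0 : ℝ))‖
        - (σ' - σ) * Real.log A| ≤ ε := by
  obtain ⟨δ₀, hδ₀, -, hunif⟩ := exists_log_zeta₁_sub_le hε
  filter_upwards [eventually_rpow_neg_le hσ hδ₀, eventually_rpow_neg_le hσ' hδ₀,
    eventually_gt_atTop 0] with A h1 h2 hA0
  have hp : ∀ w : ℝ, 0 < A ^ (-w) := fun w => by positivity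
  have hl : ∀ w : ℝ, Real.log ‖((A ^ (-w) : ℝ) + Complex.I * (0 : ℝ) : ℂ)‖ = -w * Real.log A := by
    intro w
    rw [Complex.ofReal_zero, mul_zero, add_zero, Complex.norm_real, Real.norm_of_nonneg (hp w).le,
      Real.log_rpow hA0]
  rw [log_norm_zeta_eq (hp σ'), log_norm_zeta_eq (hp σ), hl, hl, abs_le]
  have h3 := hunif 0 (by simp) _ _ (hp σ).le h1 (hp σ').le h2
  have h4 := hunif 0 (by simp) _ _ (hp σ').le h2 (hp σ).le h1
  constructor <;> linarith

/-! ### Smoothly weighted sums over primes -/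

/-- The primes `p` with `lo < log p ≤ hi`. -/
def primesIn (lo hi : ℝ) : Finset ℕ :=
  (Finset.range (⌊Real.exp hi⌋₊ + 1)).filter
    fun p => p.Prime ∧ lo < Real.log p ∧ Real.log p ≤ hi

lemma mem_primesIn {lo hi : ℝ} {p : ℕ} :
    p ∈ primesIn lo hi ↔ p.Prime ∧ lo < Real.log p ∧ Real.log p ≤ hi := by
  rw [primesIn, Finset.mem_filter, and_iff_right_iff_imp]
  rintro ⟨hp, -, h⟩
  have hp0 : (0 : ℝ) < p := by exact_mod_cast hp.pos
  rw [Finset.mem_range, Nat.lt_succ_iff]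
  exact Nat.le_floor ((Real.log_le_iff_le_exp hp0).1 h)

lemma norm_prime_cpow (p : Nat.Primes) (u t : ℝ) :
    ‖(p : ℂ) ^ (-(1 + u + Complex.I * t : ℂ))‖ = (p : ℝ) ^ (-(1 + u)) := by
  have hp : 1 ≤ (p : ℕ) := p.prop.one_lt.le
  have := norm_natCast_cpow_eq hp (1 + u) t
  push_cast at this
  exact this

lemma re_prime_cpow (p : Nat.Primes) (u t : ℝ) :
    ((p : ℂ) ^ (-(1 + u + Complex.I * t : ℂ))).re
      = (p : ℝ) ^ (-(1 + u)) * Real.cos (t * Real.log p) := by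
  have hp : (0 : ℝ) < (p : ℕ) := by exact_mod_cast p.prop.pos
  have hp0 : ((p : ℕ) : ℂ) ≠ 0 := by exact_mod_cast p.prop.ne_zero
  rw [Complex.cpow_def_of_ne_zero hp0, ← Complex.natCast_log, Complex.exp_re,
    Real.rpow_def_of_pos hp]
  have h1 : (((Real.log (p : ℕ) : ℝ) : ℂ) * -(1 + u + Complex.I * t)).re
      = Real.log (p : ℕ) * -(1 + u) := by
    rw [Complex.re_ofReal_mul]; simp
  have h2 : (((Real.log (p : ℕ) : ℝ) : ℂ) * -(1 + u + Complex.I * t)).im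
      = -(t * Real.log (p : ℕ)) := by
    rw [Complex.im_ofReal_mul]; simp; ring
  rw [h1, h2, Real.cos_neg]

lemma summable_prime_rpow {u : ℝ} (hu : 0 < u) :
    Summable fun p : Nat.Primes => (p : ℝ) ^ (-(1 + u)) :=
  Nat.Primes.summable_rpow.2 (by linarith)

lemma hasSum_log_norm_zeta {u : ℝ} (hu : 0 < u) (t : ℝ) :
    HasSum (fun p : Nat.Primes => -Real.log ‖1 - (p : ℂ) ^ (-(1 + u + Complex.I * t : ℂ))‖)
      (Real.log ‖riemannZeta (1 + u + Complex.I * t)‖) := by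
  have hs := one_lt_re_aux hu t
  have hsum : Summable fun p : Nat.Primes =>
      -Complex.log (1 - (p : ℂ) ^ (-(1 + u + Complex.I * t : ℂ))) := by
    refine Summable.neg (Summable.clog_one_sub ?_)
    refine Summable.of_norm ?_
    simp_rw [norm_prime_cpow]
    exact summable_prime_rpow hu
  have h1 := riemannZeta_eulerProduct_exp_log hs
  rw [← h1, Complex.norm_exp, Real.log_exp]
  have h2 := Complex.hasSum_re hsum.hasSum
  simpa [Complex.log_re] using h2

/-- The sum of `p ^ (-(1 + u))` over the primes. -/
def primeZeta (u : ℝ) : ℝ := ∑' p : Nat.Primes, (p : ℝ) ^ (-(1 + u))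

lemma primeZeta_le {u : ℝ} (hu : 0 < u) (hu1 : u ≤ 1) : primeZeta u ≤ Real.log (4 / u) := by
  have h1 := hasSum_log_norm_zeta hu 0
  have h2 : primeZeta u ≤ Real.log ‖riemannZeta (1 + u + Complex.I * (0 : ℝ))‖ := by
    refine hasSum_le (fun p => ?_) (summable_prime_rpow hu).hasSum h1
    have hp : (0 : ℝ) < (p : ℕ) := by exact_mod_cast p.prop.pos
    have hp1 : (1 : ℝ) < (p : ℕ) := by exact_mod_cast p.prop.one_lt
    have e : (p : ℂ) ^ (-(1 + u + Complex.I * (0 : ℝ) : ℂ)) = (((p : ℝ) ^ (-(1 + u)) : ℝ) : ℂ) := by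
      rw [Complex.ofReal_cpow hp.le]
      push_cast
      simp
    rw [e, ← Complex.ofReal_one, ← Complex.ofReal_sub, Complex.norm_real]
    have h3 : (p : ℝ) ^ (-(1 + u)) < 1 := Real.rpow_lt_one_of_one_lt_of_neg hp1 (by linarith)
    rw [Real.norm_of_nonneg (by linarith)]
    have h4 := Real.log_le_sub_one_of_pos (x := 1 - (p : ℝ) ^ (-(1 + u))) (by linarith)
    linarith
  refine h2.trans (Real.log_le_log ?_ ?_)
  · exact norm_pos_iff.2 (zeta_ne_zero hu 0)
  · have h3 := norm_zeta_one_add_le hu hu1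
    simpa using h3

lemma norm_log_one_sub_add_sub_le {r : ℝ} (hr : r ≤ 1 / 2) {x y : ℂ} (hx : ‖x‖ ≤ r)
    (hy : ‖y‖ ≤ r) :
    ‖(Complex.log (1 - x) + x) - (Complex.log (1 - y) + y)‖ ≤ 2 * r * ‖x - y‖ := by
  have hr0 : 0 ≤ r := (norm_nonneg x).trans hx
  refine (convex_closedBall (0 : ℂ) r).norm_image_sub_le_of_norm_hasDerivWithin_le
    (f := fun w : ℂ => Complex.log (1 - w) + w) (f' := fun w => (-1) / (1 - w) + 1)
    (fun w hw => ?_) (fun w hw => ?_) (by simpa using hy) (by simpa using hx)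
  · have hw' : ‖w‖ ≤ r := by simpa using hw
    have hmem : 1 - w ∈ Complex.slitPlane := by
      rw [Complex.mem_slitPlane_iff]
      left
      have := (Complex.abs_re_le_norm w).trans hw'
      have := (abs_le.1 this).2
      simp; linarith
    exact ((((hasDerivAt_id w).const_sub 1).clog hmem).add (hasDerivAt_id w)).hasDerivWithinAt
  · have hw' : ‖w‖ ≤ r := by simpa using hw
    have h1 : 1 / 2 ≤ ‖1 - w‖ := by
      have := norm_sub_norm_le (1 : ℂ) w
      rw [norm_one] at this
      linarith
    have hne : (1 - w : ℂ) ≠ 0 := norm_ne_zero_iff.1 (by linarith)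
    have e : (-1) / (1 - w) + 1 = -w / (1 - w) := by field_simp; ring
    rw [e, norm_div, norm_neg, div_le_iff₀ (by linarith)]
    nlinarith

/-- The weight `p⁻¹ (p ^ (-δ') - p ^ (-δ))`. It is negligible unless `log p` is
between about `1 / δ` and `1 / δ'`, and its Fourier transform is governed by `log ζ`. -/
def smoothWeight (δ δ' : ℝ) (p : ℕ) : ℝ := (p : ℝ) ^ (-(1 + δ')) - (p : ℝ) ^ (-(1 + δ))

lemma smoothWeight_nonneg {δ δ' : ℝ} (h : δ' ≤ δ) {p : ℕ} (hp : 1 ≤ p) :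
    0 ≤ smoothWeight δ δ' p := by
  unfold smoothWeight
  have := Real.rpow_le_rpow_of_exponent_le (x := p) (by exact_mod_cast hp)
    (show -(1 + δ) ≤ -(1 + δ') by linarith)
  linarith

lemma smoothWeight_le_rpow (δ δ' : ℝ) (p : ℕ) : smoothWeight δ δ' p ≤ (p : ℝ) ^ (-(1 + δ')) := by
  unfold smoothWeight
  have : 0 ≤ (p : ℝ) ^ (-(1 + δ)) := by positivity
  linarith

lemma smoothWeight_le {δ δ' : ℝ} (hδ' : 0 < δ') (h : δ' ≤ δ) {p : ℕ} (hp : 1 ≤ p) :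
    smoothWeight δ δ' p ≤ δ * Real.log p * (p : ℝ)⁻¹ := by
  have hp0 : (0 : ℝ) < p := by exact_mod_cast hp
  have h0 : ∀ w : ℝ, (p : ℝ) ^ (-(1 + w)) = Real.exp (-(w * Real.log p)) * (p : ℝ)⁻¹ := by
    intro w
    rw [neg_add, add_comm, Real.rpow_add hp0, Real.rpow_neg_one, Real.rpow_def_of_pos hp0]
    ring_nf
  have hl : 0 ≤ Real.log p := Real.log_natCast_nonneg p
  have h1 := abs_exp_neg_sub_le hδ'.le (hδ'.le.trans h) hl
  have h2 := (abs_le.1 h1).2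
  have h3 : |δ' - δ| ≤ δ := by rw [abs_sub_comm, abs_of_nonneg (by linarith)]; linarith
  unfold smoothWeight
  rw [h0, h0, ← sub_mul]
  gcongr
  refine h2.trans ?_
  gcongr

lemma smoothWeight_le_inv {δ δ' : ℝ} (hδ' : 0 < δ') {p : ℕ} (hp : 1 ≤ p) :
    smoothWeight δ δ' p ≤ (p : ℝ)⁻¹ := by
  refine (smoothWeight_le_rpow δ δ' p).trans ?_
  rw [← Real.rpow_neg_one]
  exact Real.rpow_le_rpow_of_exponent_le (by exact_mod_cast hp) (by linarith)

/-- A smoothly weighted cosine sum over a window of primes is the variation of `log |ζ|`. -/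
lemma abs_sum_smoothWeight_sub_le {δ δ' lo hi : ℝ} (hδ' : 0 < δ') (h : δ' ≤ δ) (hlo : 0 < lo)
    (t : ℝ) :
    |∑ p ∈ primesIn lo hi, smoothWeight δ δ' p * Real.cos (t * Real.log p)
        - (Real.log ‖riemannZeta (1 + δ' + Complex.I * t)‖
          - Real.log ‖riemannZeta (1 + δ + Complex.I * t)‖)|
      ≤ 4 * δ * primeZeta (1 / 2) + lo * δ * Real.exp 1 * primeZeta (1 / lo)
        + Real.exp (-(δ' * hi / 2)) * primeZeta (δ' / 2) := by
  have hδ : 0 < δ := hδ'.trans_le h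
  set F : Finset Nat.Primes := (primesIn lo hi).subtype Nat.Prime with hF
  have hmemF : ∀ p : Nat.Primes, p ∈ F ↔ lo < Real.log p ∧ Real.log p ≤ hi := by
    intro p
    refine (Finset.mem_subtype (p := Nat.Prime) (s := primesIn lo hi) (a := p)).trans ?_
    rw [mem_primesIn]
    exact and_iff_right p.prop
  have hsumF : ∑ p ∈ primesIn lo hi, smoothWeight δ δ' p * Real.cos (t * Real.log p)
      = ∑ p ∈ F, smoothWeight δ δ' p * Real.cos (t * Real.log p) :=
    (Finset.sum_subtype_of_mem (fun p : ℕ => smoothWeight δ δ' p * Real.cos (t * Real.log p))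
      fun p hp => (mem_primesIn.1 hp).1).symm
  have hfin : HasSum (fun p : Nat.Primes =>
      if p ∈ F then smoothWeight δ δ' p * Real.cos (t * Real.log p) else 0)
      (∑ p ∈ F, smoothWeight δ δ' p * Real.cos (t * Real.log p)) := by
    have h1 : HasSum (fun p : Nat.Primes =>
        if p ∈ F then smoothWeight δ δ' p * Real.cos (t * Real.log p) else 0)
        (∑ p ∈ F, if p ∈ F then smoothWeight δ δ' p * Real.cos (t * Real.log p) else 0) :=
      hasSum_sum_of_ne_finset_zero fun p hp => by simp [hp]
    rwa [Finset.sum_congr rfl fun p hp => if_pos hp] at h1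
  have hmain := hfin.sub ((hasSum_log_norm_zeta hδ' t).sub (hasSum_log_norm_zeta hδ t))
  have hbound := (((summable_prime_rpow (u := 1 / 2) (by norm_num)).hasSum.mul_left (4 * δ)).add
    ((summable_prime_rpow (u := 1 / lo) (by positivity)).hasSum.mul_left
      (lo * δ * Real.exp 1))).add
    ((summable_prime_rpow (u := δ' / 2) (by positivity)).hasSum.mul_left
      (Real.exp (-(δ' * hi / 2))))
  rw [hsumF, ← Real.norm_eq_abs]
  refine hmain.norm_le_of_bounded hbound fun p => ?_
  have hp1 : 1 ≤ (p : ℕ) := p.prop.one_lt.le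
  have hp0 : (0 : ℝ) < (p : ℕ) := by exact_mod_cast p.prop.pos
  have hp2 : (2 : ℝ) ≤ (p : ℕ) := by exact_mod_cast p.prop.two_le
  have hl : 0 ≤ Real.log (p : ℕ) := Real.log_natCast_nonneg p
  set z' := (p : ℂ) ^ (-(1 + δ' + Complex.I * t : ℂ)) with hz'
  set z := (p : ℂ) ^ (-(1 + δ + Complex.I * t : ℂ)) with hz
  have hcos : |Real.cos (t * Real.log (p : ℕ))| ≤ 1 := Real.abs_cos_le_one _
  have hw0 := smoothWeight_nonneg h hp1
  have hre : z'.re - z.re = smoothWeight δ δ' p * Real.cos (t * Real.log (p : ℕ)) := by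
    rw [hz', hz, re_prime_cpow, re_prime_cpow, smoothWeight]; ring
  have hnorm : ‖z' - z‖ = smoothWeight δ δ' p := by
    have e : ∀ w : ℝ, (p : ℂ) ^ (-(1 + w + Complex.I * t : ℂ))
        = (((p : ℝ) ^ (-(1 + w)) : ℝ) : ℂ) * (p : ℂ) ^ (-(((0 : ℝ) : ℂ) + Complex.I * t)) := by
      intro w
      have hp0' : ((p : ℕ) : ℂ) ≠ 0 := by exact_mod_cast p.prop.ne_zero
      rw [Complex.ofReal_cpow hp0.le, Complex.ofReal_natCast, ← Complex.cpow_add _ _ hp0']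
      congr 1
      push_cast; ring
    rw [hz', hz, e, e, ← sub_mul, norm_mul, norm_natCast_cpow_eq hp1, ← Complex.ofReal_sub,
      Complex.norm_real, neg_zero, Real.rpow_zero, mul_one]
    exact Real.norm_of_nonneg hw0
  have hinv : (p : ℝ)⁻¹ ≤ 1 / 2 := by rw [one_div]; gcongr
  have hzr : ‖z‖ ≤ (p : ℝ)⁻¹ := by
    rw [hz, norm_prime_cpow, ← Real.rpow_neg_one]
    exact Real.rpow_le_rpow_of_exponent_le (by linarith) (by linarith)
  have hzr' : ‖z'‖ ≤ (p : ℝ)⁻¹ := by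
    rw [hz', norm_prime_cpow, ← Real.rpow_neg_one]
    exact Real.rpow_le_rpow_of_exponent_le (by linarith) (by linarith)
  -- the contribution of the prime powers
  have hpow : |(-Real.log ‖1 - z'‖ - -Real.log ‖1 - z‖) - (z'.re - z.re)|
      ≤ 4 * δ * (p : ℝ) ^ (-(1 + 1 / 2) : ℝ) := by
    have h1 := norm_log_one_sub_add_sub_le hinv hzr' hzr
    have h2 := (Complex.abs_re_le_norm _).trans h1
    have e : ((Complex.log (1 - z') + z') - (Complex.log (1 - z) + z)).re
        = -((-Real.log ‖1 - z'‖ - -Real.log ‖1 - z‖) - (z'.re - z.re)) := by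
      simp only [Complex.sub_re, Complex.add_re, Complex.log_re]; ring
    rw [e, abs_neg, hnorm] at h2
    refine h2.trans ?_
    have h3 := smoothWeight_le hδ' h hp1
    have h4 : Real.log (p : ℕ) ≤ (p : ℝ) ^ (1 / 2 : ℝ) / (1 / 2) :=
      Real.log_le_rpow_div hp0.le (by norm_num)
    have h5 : (p : ℝ) ^ (-(1 + 1 / 2) : ℝ) = (p : ℝ) ^ (1 / 2 : ℝ) * ((p : ℝ)⁻¹ * (p : ℝ)⁻¹) := by
      rw [← Real.rpow_neg_one, ← Real.rpow_add hp0, ← Real.rpow_add hp0]; norm_num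
    calc 2 * (p : ℝ)⁻¹ * smoothWeight δ δ' p
        ≤ 2 * (p : ℝ)⁻¹ * (δ * ((p : ℝ) ^ (1 / 2 : ℝ) / (1 / 2)) * (p : ℝ)⁻¹) := by
          gcongr
          refine h3.trans ?_
          gcongr
      _ = _ := by rw [h5]; ring
  have hn1 : 0 ≤ (p : ℝ) ^ (-(1 + 1 / lo)) := by positivity
  have hn2 : 0 ≤ (p : ℝ) ^ (-(1 + δ' / 2)) := by positivity
  have ht1 : 0 ≤ lo * δ * Real.exp 1 * (p : ℝ) ^ (-(1 + 1 / lo)) := by positivity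
  have ht2 : 0 ≤ Real.exp (-(δ' * hi / 2)) * (p : ℝ) ^ (-(1 + δ' / 2)) := by positivity
  have hwc : |smoothWeight δ δ' p * Real.cos (t * Real.log (p : ℕ))| ≤ smoothWeight δ δ' p := by
    rw [abs_mul, abs_of_nonneg hw0]
    exact mul_le_of_le_one_right hw0 hcos
  rw [hre] at hpow
  rw [Real.norm_eq_abs]
  by_cases hpF : p ∈ F
  · rw [if_pos hpF, abs_sub_comm]
    linarith
  · rw [if_neg hpF, zero_sub, abs_neg]
    -- outside the window the weight itself is small
    have hout : smoothWeight δ δ' p ≤ lo * δ * Real.exp 1 * (p : ℝ) ^ (-(1 + 1 / lo))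
        + Real.exp (-(δ' * hi / 2)) * (p : ℝ) ^ (-(1 + δ' / 2)) := by
      rw [hmemF, not_and_or, not_lt, not_le] at hpF
      rcases hpF with hlow | hhigh
      · have h3 := smoothWeight_le hδ' h hp1
        have h4 : (p : ℝ)⁻¹ ≤ Real.exp 1 * (p : ℝ) ^ (-(1 + 1 / lo)) := by
          rw [neg_add, Real.rpow_add hp0, Real.rpow_neg_one, Real.rpow_def_of_pos hp0]
          have : (1 : ℝ) ≤ Real.exp 1 * Real.exp (Real.log (p : ℕ) * -(1 / lo)) := by
            rw [← Real.exp_add]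
            apply Real.one_le_exp
            have : Real.log (p : ℕ) / lo ≤ 1 := (div_le_one hlo).2 hlow
            have e : Real.log (p : ℕ) * -(1 / lo) = -(Real.log (p : ℕ) / lo) := by ring
            linarith
          calc (p : ℝ)⁻¹ = (p : ℝ)⁻¹ * 1 := by ring
            _ ≤ (p : ℝ)⁻¹ * (Real.exp 1 * Real.exp (Real.log (p : ℕ) * -(1 / lo))) := by gcongr
            _ = _ := by ring
        have h5 : δ * Real.log (p : ℕ) * (p : ℝ)⁻¹
            ≤ δ * lo * (Real.exp 1 * (p : ℝ) ^ (-(1 + 1 / lo))) := by gcongr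
        have e : δ * lo * (Real.exp 1 * (p : ℝ) ^ (-(1 + 1 / lo)))
          = lo * δ * Real.exp 1 * (p : ℝ) ^ (-(1 + 1 / lo)) := by ring
        linarith
      · have h3 := smoothWeight_le_rpow δ δ' p
        have h4 : (p : ℝ) ^ (-(1 + δ')) ≤ Real.exp (-(δ' * hi / 2)) * (p : ℝ) ^ (-(1 + δ' / 2)) := by
          rw [Real.rpow_def_of_pos hp0, Real.rpow_def_of_pos hp0, ← Real.exp_add]
          apply Real.exp_le_exp.2
          nlinarith
        linarith
    have e : ∀ x y : ℝ, |x| ≤ |x - y| + |y| := fun x y => by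
      have := abs_add_le (x - y) y
      simpa using this
    have := e (-Real.log ‖1 - z'‖ - -Real.log ‖1 - z‖)
      (smoothWeight δ δ' p * Real.cos (t * Real.log (p : ℕ)))
    linarith

/-! ### Windows of primes -/

lemma primeZeta_nonneg (u : ℝ) : 0 ≤ primeZeta u := tsum_nonneg fun p => by positivity

/-- The weight attached to the window `A ^ s < log p ≤ A ^ s'`; the exponents are moved inwards by
`η` so that the weight is negligible at the ends of the window. -/
def windowWeight (s s' η A : ℝ) (p : ℕ) : ℝ := smoothWeight (A ^ (-(s + η))) (A ^ (-(s' - η))) p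

lemma eventually_abs_sum_windowWeight_sub_le {s s' η ε : ℝ} (hs : 0 < s) (hη : 0 < η)
    (hss' : s + 2 * η ≤ s') (hε : 0 < ε) :
    ∀ᶠ A : ℝ in atTop, ∀ t : ℝ,
      |∑ p ∈ primesIn (A ^ s) (A ^ s'), windowWeight s s' η A p * Real.cos (t * Real.log p)
        - (Real.log ‖riemannZeta (1 + (A ^ (-(s' - η)) : ℝ) + Complex.I * t)‖
          - Real.log ‖riemannZeta (1 + (A ^ (-(s + η)) : ℝ) + Complex.I * t)‖)| ≤ ε := by
  have hC : 0 ≤ primeZeta (1 / 2) := primeZeta_nonneg _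
  filter_upwards [eventually_gt_atTop 1, eventually_log_pow_le (C := s + 3) (half_pos hη),
    eventually_log_pow_le (C := s' + 3) (half_pos hη),
    eventually_rpow_neg_le (κ := s + η) (by linarith)
      (show 0 < ε / 3 / (4 * (primeZeta (1 / 2) + 1)) by positivity),
    eventually_rpow_neg_le (κ := η / 2) (by linarith) (show 0 < ε / 9 by positivity),
    Real.tendsto_log_atTop.eventually_ge_atTop 1] with A hA1 hl1 hl2 hA2 hA3 hlog t
  have hA0 : (0 : ℝ) < A := by linarith
  have hδ' : 0 < A ^ (-(s' - η)) := by positivity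
  have hδδ' : A ^ (-(s' - η)) ≤ A ^ (-(s + η)) :=
    Real.rpow_le_rpow_of_exponent_le hA1.le (by linarith)
  have hδ'1 : A ^ (-(s' - η)) ≤ 1 := Real.rpow_le_one_of_one_le_of_nonpos hA1.le (by linarith)
  have hlo : 0 < A ^ s := by positivity
  have hlo1 : 1 ≤ A ^ s := Real.one_le_rpow hA1.le hs.le
  have hlog4 : Real.log 4 ≤ 2 := by
    rw [show (4 : ℝ) = 2 ^ 2 by norm_num, Real.log_pow]
    have := Real.log_two_lt_d9
    push_cast; linarith
  have hlog8 : Real.log 8 ≤ 3 := by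
    rw [show (8 : ℝ) = 2 ^ 3 by norm_num, Real.log_pow]
    have := Real.log_two_lt_d9
    push_cast; linarith
  refine (abs_sum_smoothWeight_sub_le hδ' hδδ' hlo t).trans ?_
  have h1 : 4 * A ^ (-(s + η)) * primeZeta (1 / 2) ≤ ε / 3 := by
    have h0 : primeZeta (1 / 2) / (primeZeta (1 / 2) + 1) ≤ 1 := by
      rw [div_le_one (by positivity)]; linarith
    calc 4 * A ^ (-(s + η)) * primeZeta (1 / 2)
        ≤ 4 * (ε / 3 / (4 * (primeZeta (1 / 2) + 1))) * primeZeta (1 / 2) := by gcongr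
      _ = ε / 3 * (primeZeta (1 / 2) / (primeZeta (1 / 2) + 1)) := by field_simp
      _ ≤ ε / 3 * 1 := by gcongr
      _ = ε / 3 := mul_one _
  have h2 : A ^ s * A ^ (-(s + η)) * Real.exp 1 * primeZeta (1 / A ^ s) ≤ ε / 3 := by
    have h3 : primeZeta (1 / A ^ s) ≤ A ^ (η / 2) := by
      refine (primeZeta_le (by positivity) (by rw [div_le_one hlo]; exact hlo1)).trans ?_
      rw [one_div, div_inv_eq_mul, Real.log_mul (by norm_num) hlo.ne', Real.log_rpow hA0]
      have h4 : Real.log 4 + s * Real.log A ≤ (s + 3) * Real.log A := by linarith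
      refine (h4.trans ?_).trans hl1
      have : 1 ≤ (s + 3) * Real.log A := by nlinarith
      nlinarith
    have he := Real.exp_one_lt_d9
    calc A ^ s * A ^ (-(s + η)) * Real.exp 1 * primeZeta (1 / A ^ s)
        ≤ A ^ s * A ^ (-(s + η)) * 3 * A ^ (η / 2) := by
          gcongr
          · exact primeZeta_nonneg _
          · linarith
      _ = 3 * (A ^ s * A ^ (-(s + η)) * A ^ (η / 2)) := by ring
      _ = 3 * A ^ (-(η / 2)) := by
          rw [← Real.rpow_add hA0, ← Real.rpow_add hA0]; ring_nf
      _ ≤ ε / 3 := by linarith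
  have h3 : Real.exp (-(A ^ (-(s' - η)) * A ^ s' / 2)) * primeZeta (A ^ (-(s' - η)) / 2)
      ≤ ε / 3 := by
    have h4 : primeZeta (A ^ (-(s' - η)) / 2) ≤ A ^ (η / 2) := by
      refine (primeZeta_le (by positivity) (by linarith)).trans ?_
      have e : 4 / (A ^ (-(s' - η)) / 2) = 8 * A ^ (s' - η) := by
        rw [Real.rpow_neg hA0.le]; field_simp; norm_num
      rw [e, Real.log_mul (by norm_num) (by positivity), Real.log_rpow hA0]
      have h4 : Real.log 8 + (s' - η) * Real.log A ≤ (s' + 3) * Real.log A := by nlinarith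
      refine (h4.trans ?_).trans hl2
      have : 1 ≤ (s' + 3) * Real.log A := by nlinarith
      nlinarith
    have e : A ^ (-(s' - η)) * A ^ s' = A ^ η := by
      rw [← Real.rpow_add hA0]; ring_nf
    have hη0 : 0 < A ^ η := by positivity
    have h5 : Real.exp (-(A ^ η / 2)) ≤ 2 * A ^ (-η) := by
      rw [Real.exp_neg, Real.rpow_neg hA0.le, ← div_eq_mul_inv, inv_le_comm₀ (Real.exp_pos _)
        (by positivity), inv_div]
      have := Real.add_one_le_exp (A ^ η / 2)
      linarith
    rw [e]
    calc Real.exp (-(A ^ η / 2)) * primeZeta (A ^ (-(s' - η)) / 2)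
        ≤ 2 * A ^ (-η) * A ^ (η / 2) := by
          gcongr
          exact primeZeta_nonneg _
      _ = 2 * A ^ (-(η / 2)) := by
          rw [mul_assoc, ← Real.rpow_add hA0]; ring_nf
      _ ≤ ε / 3 := by linarith
  linarith

/-- Mass of the weights of a window. -/
lemma eventually_abs_sum_windowWeight_le {s s' η ε : ℝ} (hs : 0 < s) (hη : 0 < η)
    (hss' : s + 2 * η ≤ s') (hε : 0 < ε) :
    ∀ᶠ A : ℝ in atTop,
      |∑ p ∈ primesIn (A ^ s) (A ^ s'), windowWeight s s' η A p
        - (s' - s - 2 * η) * Real.log A| ≤ ε := by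
  filter_upwards [eventually_abs_sum_windowWeight_sub_le hs hη hss' (half_pos hε),
    eventually_abs_log_zeta_sub_le (σ := s + η) (σ' := s' - η) (by linarith) (by linarith)
      (half_pos hε)] with A h1 h2
  have h3 := h1 0
  simp only [zero_mul, Real.cos_zero, mul_one] at h3
  have h4 := abs_le.1 h3
  have h5 := abs_le.1 h2
  rw [abs_le]
  constructor <;> linarith [h4.1, h4.2, h5.1, h5.2]

/-- Decorrelation of a window at distances `|t| ≥ A ^ (-s)`. -/
lemma eventually_sum_windowWeight_cos_le {Θ s s' η ε : ℝ} (hΘ : 0 ≤ Θ) (hs : 0 < s) (hη : 0 < η)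
    (hss' : s + 2 * η ≤ s') (hε : 0 < ε) :
    ∀ᶠ A : ℝ in atTop, ∀ t : ℝ, A ^ (-s) ≤ |t| → |t| ≤ A ^ Θ →
      ∑ p ∈ primesIn (A ^ s) (A ^ s'), windowWeight s s' η A p * Real.cos (t * Real.log p)
        ≤ ε := by
  filter_upwards [eventually_abs_sum_windowWeight_sub_le hs hη hss' (half_pos hε),
    eventually_log_zeta_sub_le hΘ hs hη (half_pos hε), eventually_gt_atTop 1]
    with A h1 h2 hA1 t ht1 ht
  have hA0 : (0 : ℝ) < A := by linarith
  have h3 := (abs_le.1 (h1 t)).2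
  have h4 := h2 t ht1 ht (A ^ (-(s + η))) (A ^ (-(s' - η))) (by positivity)
    (Real.rpow_le_rpow_of_exponent_le hA1.le (by linarith)) le_rfl
  linarith

/-- A weak form of Mertens' theorem: `p⁻¹ ≤ 3 p ^ (-(1 + 1 / A))` in this range, and the sum over all
primes of the right side is controlled by `ζ(1 + 1 / A)`. -/
lemma sum_inv_primesIn_le {lo A : ℝ} (hA : 1 ≤ A) :
    ∑ p ∈ primesIn lo A, (p : ℝ)⁻¹ ≤ 3 * (2 + Real.log A) := by
  have hA0 : (0 : ℝ) < A := by linarith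
  have h1 : ∑ p ∈ primesIn lo A, (p : ℝ)⁻¹
      ≤ ∑ p ∈ primesIn lo A, 3 * (p : ℝ) ^ (-(1 + 1 / A)) := by
    refine Finset.sum_le_sum fun p hp => ?_
    rw [mem_primesIn] at hp
    have hp0 : (0 : ℝ) < p := by exact_mod_cast hp.1.pos
    have h2 : (p : ℝ) ^ (-(1 + 1 / A)) = (p : ℝ)⁻¹ * Real.exp (-(Real.log p / A)) := by
      rw [neg_add, Real.rpow_add hp0, Real.rpow_neg_one, Real.rpow_def_of_pos hp0]
      ring_nf
    have h3 : 1 ≤ 3 * Real.exp (-(Real.log p / A)) := by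
      have h4 : Real.exp (-1) ≤ Real.exp (-(Real.log p / A)) := by
        apply Real.exp_le_exp.2
        have : Real.log p / A ≤ 1 := (div_le_one hA0).2 hp.2.2
        linarith
      have h5 : 1 ≤ 3 * Real.exp (-1) := by
        rw [Real.exp_neg, ← div_eq_mul_inv, le_div_iff₀ (Real.exp_pos _)]
        have := Real.exp_one_lt_d9
        linarith
      linarith
    rw [h2]
    have : 0 < (p : ℝ)⁻¹ := by positivity
    nlinarith
  have h2 : ∑ p ∈ primesIn lo A, (p : ℝ) ^ (-(1 + 1 / A)) ≤ primeZeta (1 / A) := by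
    have h3 := Finset.sum_subtype_of_mem (s := primesIn lo A)
      (fun p : ℕ => (p : ℝ) ^ (-(1 + 1 / A))) (fun p hp => (mem_primesIn.1 hp).1)
    have h4 : ∀ F : Finset Nat.Primes,
        ∑ p ∈ F, (p : ℝ) ^ (-(1 + 1 / A)) ≤ primeZeta (1 / A) := fun F =>
      Summable.sum_le_tsum F (fun p _ => by positivity)
        (summable_prime_rpow (u := 1 / A) (by positivity))
    exact (le_of_eq h3.symm).trans (h4 _)
  have h3 := primeZeta_le (u := 1 / A) (by positivity) (by rw [div_le_one hA0]; exact hA)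
  have hlog4 : Real.log 4 ≤ 2 := by
    rw [show (4 : ℝ) = 2 ^ 2 by norm_num, Real.log_pow]
    have := Real.log_two_lt_d9
    push_cast; linarith
  rw [one_div, div_inv_eq_mul, Real.log_mul (by norm_num) hA0.ne', ← one_div] at h3
  rw [← Finset.mul_sum] at h1
  linarith

/-! ### The second moment method -/

lemma isProbabilityMeasure_uniformLaw {T : ℝ} (hT : 0 < T) :
    IsProbabilityMeasure (uniformLaw T) := by
  refine cond_isProbabilityMeasure_of_finite ?_ ?_
  · rw [Real.volume_Icc]
    simp; linarith
  · rw [Real.volume_Icc]; exact ENNReal.ofReal_ne_top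

lemma integral_uniformLaw {T : ℝ} (hT : 0 < T) (f : ℝ → ℝ) (h : ℝ) :
    ∫ t, f (t + h) ∂(uniformLaw T) = mean T (T + h) f := by
  have h1 : ((volume : Measure ℝ) (Set.Icc T (2 * T)))⁻¹.toReal = T⁻¹ := by
    rw [Real.volume_Icc, ENNReal.toReal_inv, ENNReal.toReal_ofReal (by linarith)]
    congr 1; ring
  rw [uniformLaw, ProbabilityTheory.cond, integral_smul_measure, h1, mean, smul_eq_mul,
    integral_Icc_eq_integral_Ioc, ← intervalIntegral.integral_of_le (by linarith),
    intervalIntegral.integral_comp_add_right]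
  congr 2
  ring

/-- Second moment method for the total mass `∫ φ (t + h) dh`, with a correlation bound by
multiples of indicators of short distances. -/
lemma second_moment {T L M ε B : ℝ} (hT : 0 < T) (hL : 0 < L) (hM : 0 < M) (hε0 : 0 ≤ ε)
    (hε1 : ε ≤ 1) {φ : ℝ → ℝ} (hφ : Measurable φ) (hφ0 : ∀ u, 0 ≤ φ u) (hφB : ∀ u, φ u ≤ B)
    (h1 : ∀ h, -L ≤ h → h ≤ L → (1 - ε) * M ≤ mean T (T + h) φ)
    {r : ℕ} {c d : ℕ → ℝ} (hc : ∀ j, 0 ≤ c j) (hd : ∀ j, 0 ≤ d j)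
    (h2 : ∀ h h', -L ≤ h → h ≤ L → -L ≤ h' → h' ≤ L →
      mean T (T + h) (fun u => φ u * φ (u + (h' - h)))
        ≤ M ^ 2 * ((1 + ε) * (1 + ∑ j ∈ Finset.range r, c j * if |h' - h| ≤ d j then 1 else 0)))
    (hcd : ∑ j ∈ Finset.range r, c j * d j ≤ ε * L) :
    (uniformLaw T).real {t | ∫ h in (-L)..L, φ (t + h) ≤ L * M} ≤ 20 * ε := by
  have := isProbabilityMeasure_uniformLaw hT
  set μ := uniformLaw T
  set ν : Measure ℝ := volume.restrict (Set.Ioc (-L) L) with hν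
  have hνreal : ν.real Set.univ = 2 * L := by
    rw [hν, measureReal_restrict_apply_univ, Real.volume_real_Ioc_of_le (by linarith)]; ring
  have hνmem : ∀ᵐ h ∂ν, -L ≤ h ∧ h ≤ L := by
    filter_upwards [ae_restrict_mem measurableSet_Ioc] with h hh using ⟨hh.1.le, hh.2⟩
  have hB : 0 ≤ B := (hφ0 0).trans (hφB 0)
  set Z : ℝ → ℝ := fun t => ∫ h, φ (t + h) ∂ν with hZ
  have hZeq : ∀ t, ∫ h in (-L)..L, φ (t + h) = Z t := fun t =>
    intervalIntegral.integral_of_le (by linarith)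
  have hint1 : Integrable (fun q : ℝ × ℝ => φ (q.1 + q.2)) (μ.prod ν) := by
    refine Integrable.of_bound (hφ.comp (measurable_fst.add measurable_snd)).aestronglyMeasurable
      B (ae_of_all _ fun q => ?_)
    rw [Real.norm_of_nonneg (hφ0 _)]; exact hφB _
  have hint2 : Integrable (fun q : ℝ × ℝ × ℝ => φ (q.1 + q.2.1) * φ (q.1 + q.2.2))
      (μ.prod (ν.prod ν)) := by
    refine Integrable.of_bound (Measurable.aestronglyMeasurable (by fun_prop)) (B * B)
      (ae_of_all _ fun q => ?_)
    rw [Real.norm_of_nonneg (mul_nonneg (hφ0 _) (hφ0 _))]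
    exact mul_le_mul (hφB _) (hφB _) (hφ0 _) hB
  have hZint : Integrable Z μ := hint1.integral_prod_left
  have hZsq : ∀ t, Z t ^ 2 = ∫ q, φ (t + q.1) * φ (t + q.2) ∂(ν.prod ν) := by
    intro t
    rw [integral_prod_mul (fun h => φ (t + h)) (fun h => φ (t + h)), sq]
  have hZ2int : Integrable (fun t => Z t ^ 2) μ := by
    simp_rw [hZsq]
    exact hint2.integral_prod_left
  have hEZ : (1 - ε) * M * (2 * L) ≤ ∫ t, Z t ∂μ := by
    rw [hZ, integral_integral_swap hint1]
    calc (1 - ε) * M * (2 * L) = ∫ _h, (1 - ε) * M ∂ν := by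
          rw [integral_const, hνreal, smul_eq_mul]; ring
      _ ≤ _ := by
          refine integral_mono_ae (integrable_const _) hint1.integral_prod_right ?_
          filter_upwards [hνmem] with h hh
          change _ ≤ ∫ t, φ (t + h) ∂μ
          rw [integral_uniformLaw hT]
          exact h1 h hh.1 hh.2
  set ρ : ℝ → ℝ → ℝ := fun h h' =>
    M ^ 2 * ((1 + ε) * (1 + ∑ j ∈ Finset.range r, c j * if |h' - h| ≤ d j then 1 else 0)) with hρ
  have hind : ∀ (h : ℝ) (j : ℕ), Integrable (fun h' => if |h' - h| ≤ d j then (1 : ℝ) else 0) ν ∧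
      ∫ h', (if |h' - h| ≤ d j then (1 : ℝ) else 0) ∂ν ≤ 2 * d j := by
    intro h j
    have e : (fun h' => if |h' - h| ≤ d j then (1 : ℝ) else 0)
        = (Metric.closedBall h (d j)).indicator 1 := by
      funext x
      by_cases hx : |x - h| ≤ d j
      · rw [if_pos hx, Set.indicator_of_mem (Metric.mem_closedBall.2 hx), Pi.one_apply]
      · rw [if_neg hx, Set.indicator_of_notMem fun hm => hx (Metric.mem_closedBall.1 hm)]
    rw [e]
    refine ⟨(integrable_const (1 : ℝ)).indicator Metric.isClosed_closedBall.measurableSet, ?_⟩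
    rw [integral_indicator_one Metric.isClosed_closedBall.measurableSet]
    calc ν.real (Metric.closedBall h (d j)) ≤ volume.real (Metric.closedBall h (d j)) := by
          refine ENNReal.toReal_mono ?_ (Measure.restrict_apply_le _ _)
          rw [Real.volume_closedBall]; exact ENNReal.ofReal_ne_top
      _ = 2 * d j := by
          rw [Measure.real, Real.volume_closedBall, ENNReal.toReal_ofReal (by linarith [hd j])]
  have hρint : ∀ h, Integrable (ρ h) ν := fun h =>
    (((integrable_const _).add (integrable_finsetSum _ fun j _ =>
      (hind h j).1.const_mul _)).const_mul _).const_mul _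
  have hρle : ∀ h, ∫ h', ρ h h' ∂ν ≤ M ^ 2 * ((1 + ε) * (2 * L + 2 * (ε * L))) := by
    intro h
    rw [hρ, integral_const_mul, integral_const_mul, integral_add (integrable_const _)
      (integrable_finsetSum _ fun j _ => (hind h j).1.const_mul _), integral_const, hνreal,
      integral_finsetSum _ fun j _ => (hind h j).1.const_mul _]
    simp_rw [integral_const_mul]
    gcongr
    · exact le_of_eq (mul_one _)
    · calc ∑ j ∈ Finset.range r, c j * ∫ h', (if |h' - h| ≤ d j then (1 : ℝ) else 0) ∂ν
          ≤ ∑ j ∈ Finset.range r, c j * (2 * d j) :=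
            Finset.sum_le_sum fun j _ => mul_le_mul_of_nonneg_left (hind h j).2 (hc j)
        _ = 2 * ∑ j ∈ Finset.range r, c j * d j := by
            rw [Finset.mul_sum]; exact Finset.sum_congr rfl fun j _ => by ring
        _ ≤ _ := by linarith
  have hEZ2 : ∫ t, Z t ^ 2 ∂μ ≤ M ^ 2 * ((1 + ε) * (2 * L + 2 * (ε * L))) * (2 * L) := by
    simp_rw [hZsq]
    rw [integral_integral_swap hint2]
    have hint3 : Integrable (fun q : ℝ × ℝ => ∫ t, φ (t + q.1) * φ (t + q.2) ∂μ) (ν.prod ν) :=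
      hint2.integral_prod_right
    rw [integral_prod _ hint3]
    calc _ ≤ ∫ _h, M ^ 2 * ((1 + ε) * (2 * L + 2 * (ε * L))) ∂ν := by
          refine integral_mono_ae hint3.integral_prod_left (integrable_const _) ?_
          filter_upwards [hνmem, hint3.prod_right_ae] with h hh hhint
          refine le_trans ?_ (hρle h)
          refine integral_mono_ae hhint (hρint h) ?_
          filter_upwards [hνmem] with h' hh'
          have e := integral_uniformLaw hT (fun u => φ u * φ (u + (h' - h))) h
          have e2 : (fun t => φ (t + h) * φ (t + h + (h' - h))) = fun t => φ (t + h) * φ (t + h') := by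
            funext t; congr 2; ring
          rw [e2] at e
          change ∫ t, φ (t + h) * φ (t + h') ∂μ ≤ ρ h h'
          rw [e]
          exact h2 h h' hh.1 hh.2 hh'.1 hh'.2
      _ = _ := by rw [integral_const, hνreal, smul_eq_mul]; ring
  -- the second moment around `2 L M`, which is close to the mean
  have hvar : ∫ t, (Z t - 2 * (L * M)) ^ 2 ∂μ ≤ 20 * ε * (L * M) ^ 2 := by
    have e : ∀ t, (Z t - 2 * (L * M)) ^ 2
        = Z t ^ 2 - 4 * (L * M) * Z t + 4 * (L * M) ^ 2 := fun t => by ring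
    simp_rw [e]
    have hi1 : Integrable (fun t => 4 * (L * M) * Z t) μ := hZint.const_mul _
    have hi2 : Integrable (fun t => Z t ^ 2 - 4 * (L * M) * Z t) μ := hZ2int.sub hi1
    rw [integral_add hi2 (integrable_const _), integral_sub hZ2int hi1, integral_const_mul,
      integral_const]
    simp only [probReal_univ, smul_eq_mul, one_mul]
    have hLM : 0 < L * M := by positivity
    have h3 : 4 * (L * M) * ((1 - ε) * M * (2 * L)) ≤ 4 * (L * M) * ∫ t, Z t ∂μ := by gcongr
    have h4 : M ^ 2 * ((1 + ε) * (2 * L + 2 * (ε * L))) * (2 * L)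
        = 4 * (1 + ε) ^ 2 * (L * M) ^ 2 := by ring
    have h5 : (1 + ε) ^ 2 ≤ 1 + 3 * ε := by nlinarith
    have h6 : 4 * (1 + ε) ^ 2 * (L * M) ^ 2 ≤ 4 * (1 + 3 * ε) * (L * M) ^ 2 := by gcongr
    nlinarith
  have hcheb := mul_meas_ge_le_integral_of_nonneg (μ := μ)
    (f := fun t => (Z t - 2 * (L * M)) ^ 2) (ae_of_all _ fun t => by positivity)
    (by
      have e : ∀ t, (Z t - 2 * (L * M)) ^ 2
        = Z t ^ 2 - 4 * (L * M) * Z t + 4 * (L * M) ^ 2 := fun t => by ring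
      simp_rw [e]
      exact (hZ2int.sub (hZint.const_mul _)).add (integrable_const _)) ((L * M) ^ 2)
  have hLM : 0 < L * M := by positivity
  have hsub : {t | ∫ h in (-L)..L, φ (t + h) ≤ L * M}
      ⊆ {t | (L * M) ^ 2 ≤ (Z t - 2 * (L * M)) ^ 2} := by
    intro t ht
    simp only [Set.mem_ofPred_eq, hZeq] at ht ⊢
    nlinarith
  have h3 : μ.real {t | ∫ h in (-L)..L, φ (t + h) ≤ L * M}
      ≤ μ.real {t | (L * M) ^ 2 ≤ (Z t - 2 * (L * M)) ^ 2} := measureReal_mono hsub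
  refine h3.trans ?_
  have h4 := hcheb.trans hvar
  have h5 : 0 < (L * M) ^ 2 := by positivity
  rw [mul_comm (20 * ε)] at h4
  exact le_of_mul_le_mul_left h4 h5

/-! ### Multiscale fields and their truncated densities -/

lemma dirPoly_add (s : Finset ℕ) (y z : ℕ → ℂ) (u : ℝ) :
    dirPoly s (fun p => y p + z p) u = dirPoly s y u + dirPoly s z u := by
  simp only [dirPoly, add_mul, Finset.sum_add_distrib]

lemma dirPoly_const_mul (s : Finset ℕ) (a : ℂ) (z : ℕ → ℂ) (u : ℝ) :
    dirPoly s (fun p => a * z p) u = a * dirPoly s z u := by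
  simp only [dirPoly, mul_assoc, Finset.mul_sum]

lemma dirPoly_sum {ι : Type*} (s : Finset ℕ) (I : Finset ι) (z : ι → ℕ → ℂ) (u : ℝ) :
    dirPoly s (fun p => ∑ i ∈ I, z i p) u = ∑ i ∈ I, dirPoly s (z i) u := by
  simp only [dirPoly, Finset.sum_mul]
  exact Finset.sum_comm

lemma dirPoly_shift (s : Finset ℕ) (z : ℕ → ℂ) (u t : ℝ) :
    dirPoly s z (u + t) = dirPoly s
      (fun p => z p * Complex.exp (-(Complex.I * ((t * Real.log p : ℝ) : ℂ)))) u := by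
  simp only [dirPoly]
  refine Finset.sum_congr rfl fun p _ => ?_
  rw [mul_assoc, ← Complex.exp_add]
  congr 2
  push_cast; ring

/-- The data of a multiscale field: `r` blocks of coefficients `b i p`, and the coefficients `c p`
of the field of interest. -/
structure ScaleData where
  /-- The set of primes. -/
  primes : Finset ℕ
  /-- The number of blocks. -/
  r : ℕ
  /-- The coefficients of the blocks. -/
  b : ℕ → ℕ → ℝ
  /-- The coefficients of the field of interest. -/
  c : ℕ → ℝ

namespace ScaleData

/-- The total coefficient of the prime `p`. -/
def tot (D : ScaleData) (p : ℕ) : ℝ := ∑ i ∈ Finset.range D.r, D.b i p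

/-- The Dirichlet polynomial of the block `i`. -/
def F (D : ScaleData) (i : ℕ) (u : ℝ) : ℂ := dirPoly D.primes (fun p => (D.b i p : ℂ)) u

/-- The sum of the Dirichlet polynomials of the blocks. -/
def Ftot (D : ScaleData) (u : ℝ) : ℂ := ∑ i ∈ Finset.range D.r, D.F i u

/-- The Dirichlet polynomial whose real part is the field of interest. -/
def S (D : ScaleData) (u : ℝ) : ℂ := dirPoly D.primes (fun p => (D.c p : ℂ)) u

/-- Twice the variance of the block `i`. -/
def v (D : ScaleData) (i : ℕ) : ℝ := ∑ p ∈ D.primes, D.b i p ^ 2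

/-- Twice the covariance of the field of interest with the sum of the blocks. -/
def cov (D : ScaleData) : ℝ := ∑ p ∈ D.primes, D.tot p * D.c p

/-- Twice the variance of the sum of the blocks. -/
def V (D : ScaleData) : ℝ := ∑ i ∈ Finset.range D.r, D.v i

/-- No block exceeds its typical value under the density `exp (2 x Re F)` by more than `η n`, and the
field of interest is not smaller than its typical value minus `η n`; moreover the
polynomials are at most `n ^ 2`, so that their exponentials can be replaced by Taylor
polynomials. -/
def Good (D : ScaleData) (x η n u : ℝ) : Prop :=
  ‖D.S u‖ ≤ n ^ 2 ∧ (∀ i ∈ Finset.range D.r, ‖D.F i u‖ ≤ n ^ 2 ∧ (D.F i u).re ≤ x * D.v i + η * n)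
    ∧ x * D.cov - η * n ≤ (D.S u).re

open Classical in
/-- The density `exp (2 x Re F)` truncated to the good points. -/
def phi (D : ScaleData) (x η n u : ℝ) : ℝ :=
  if D.Good x η n u then Real.exp (2 * x * (D.Ftot u).re) else 0

/-- The properties of the coefficients that are used in the second moment method: disjoint blocks of
nonnegative coefficients over primes at most `exp ((log T) ^ υ)`, with sums of squares at most
`C log log T`, where the single coefficients and the sum of the fourth powers are at most `w`. -/
structure Regular (D : ScaleData) (υ C w T : ℝ) : Prop where
  prime : ∀ p ∈ D.primes, p.Prime
  le : ∀ p ∈ D.primes, (p : ℝ) ≤ Real.exp (Real.log T ^ υ)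
  b_nonneg : ∀ i p, 0 ≤ D.b i p
  b_disjoint : ∀ i j p, i ≠ j → D.b i p * D.b j p = 0
  c_nonneg : ∀ p, 0 ≤ D.c p
  tot_le : ∀ p ∈ D.primes, D.tot p ≤ w
  c_le : ∀ p ∈ D.primes, D.c p ≤ w
  V_le : D.V ≤ C * Real.log (Real.log T)
  c_sum_le : ∑ p ∈ D.primes, D.c p ^ 2 ≤ C * Real.log (Real.log T)
  tot_four_le : ∑ p ∈ D.primes, D.tot p ^ 4 ≤ w

variable {D : ScaleData}

@[fun_prop]
lemma continuous_F (i : ℕ) : Continuous (D.F i) := continuous_dirPoly _ _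

@[fun_prop]
lemma continuous_S : Continuous D.S := continuous_dirPoly _ _

@[fun_prop]
lemma continuous_Ftot : Continuous D.Ftot := by unfold Ftot; fun_prop

lemma Ftot_eq (u : ℝ) : D.Ftot u = dirPoly D.primes (fun p => (D.tot p : ℂ)) u := by
  unfold Ftot F tot
  rw [← dirPoly_sum]
  simp

lemma phi_nonneg (x η n u : ℝ) : 0 ≤ D.phi x η n u := by
  unfold phi; split_ifs <;> positivity

lemma measurableSet_good (x η n : ℝ) : MeasurableSet {u | D.Good x η n u} := by
  have h : {u | D.Good x η n u} = {u | ‖D.S u‖ ≤ n ^ 2}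
      ∩ ((⋂ i ∈ Finset.range D.r, {u | ‖D.F i u‖ ≤ n ^ 2} ∩ {u | (D.F i u).re ≤ x * D.v i + η * n})
        ∩ {u | x * D.cov - η * n ≤ (D.S u).re}) := by
    ext u
    simp only [Good, Set.mem_ofPred_eq, Set.mem_inter_iff, Set.mem_iInter]
  rw [h]
  refine (isClosed_le (by fun_prop) (by fun_prop)).measurableSet.inter (MeasurableSet.inter ?_
    (isClosed_le (by fun_prop) (by fun_prop)).measurableSet)
  exact Finset.measurableSet_biInter _ fun i _ =>
    (isClosed_le (by fun_prop) (by fun_prop)).measurableSet.inter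
      (isClosed_le (by fun_prop) (by fun_prop)).measurableSet

lemma intervalIntegrable_phi (x η n a b : ℝ) :
    IntervalIntegrable (D.phi x η n) volume a b := by
  classical
  have h := intervalIntegrable_ite (f := fun u => Real.exp (2 * x * (D.Ftot u).re)) (by fun_prop)
    (measurableSet_good (D := D) x η n) a b
  convert h using 2
  simp only [phi]

lemma measurable_phi (x η n : ℝ) : Measurable (D.phi x η n) := by
  classical
  unfold phi
  exact Measurable.ite (measurableSet_good x η n)
    (Continuous.measurable (by fun_prop)) measurable_const

lemma phi_le {x η n : ℝ} (hx : 0 ≤ x) (u : ℝ) :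
    D.phi x η n u ≤ Real.exp (2 * x ^ 2 * D.V + 2 * x * (D.r * (η * n))) := by
  unfold phi
  split_ifs with h
  · apply Real.exp_le_exp.2
    have h1 : (D.Ftot u).re ≤ x * D.V + D.r * (η * n) := by
      unfold Ftot V
      rw [Complex.re_sum, Finset.mul_sum]
      calc ∑ i ∈ Finset.range D.r, (D.F i u).re
          ≤ ∑ i ∈ Finset.range D.r, (x * D.v i + η * n) :=
            Finset.sum_le_sum fun i hi => (h.2.1 i hi).2
        _ = _ := by rw [Finset.sum_add_distrib]; simp
    nlinarith
  · positivity

section Sums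

variable (hb : ∀ i j p, i ≠ j → D.b i p * D.b j p = 0)
include hb

/-- Products of sums of blocks are diagonal, since the blocks have disjoint supports. -/
lemma sum_mul_sum_of_disjoint {I J : Finset ℕ} (hJI : J ⊆ I) (p : ℕ) :
    (∑ i ∈ I, D.b i p) * ∑ j ∈ J, D.b j p = ∑ j ∈ J, D.b j p ^ 2 := by
  rw [Finset.mul_sum]
  refine Finset.sum_congr rfl fun j hj => ?_
  rw [Finset.sum_mul, Finset.sum_eq_single j]
  · ring
  · intro i _ hij; exact hb i j p hij
  · intro h; exact absurd (hJI hj) h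

lemma sum_tot_sq : ∑ p ∈ D.primes, D.tot p ^ 2 = D.V := by
  unfold V v tot
  rw [Finset.sum_comm]
  refine Finset.sum_congr rfl fun p _ => ?_
  rw [sq, sum_mul_sum_of_disjoint hb (Finset.Subset.refl _)]

lemma sum_tot_mul_b {i : ℕ} (hi : i < D.r) : ∑ p ∈ D.primes, D.tot p * D.b i p = D.v i := by
  unfold v tot
  refine Finset.sum_congr rfl fun p _ => ?_
  have := sum_mul_sum_of_disjoint hb (I := Finset.range D.r) (J := {i})
    (Finset.singleton_subset_iff.2 (Finset.mem_range.2 hi)) p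
  simpa using this

end Sums

lemma v_nonneg (i : ℕ) : 0 ≤ D.v i := Finset.sum_nonneg fun _ _ => sq_nonneg _

lemma v_le_V {i : ℕ} (hi : i < D.r) : D.v i ≤ D.V :=
  Finset.single_le_sum (fun j _ => v_nonneg j) (Finset.mem_range.2 hi)

lemma Regular.b_le_tot {υ C w T : ℝ} (hD : D.Regular υ C w T) {i : ℕ} (hi : i < D.r) (p : ℕ) :
    D.b i p ≤ D.tot p :=
  Finset.single_le_sum (f := fun i => D.b i p) (fun j _ => hD.b_nonneg j p)
    (Finset.mem_range.2 hi)

lemma Regular.tot_nonneg {υ C w T : ℝ} (hD : D.Regular υ C w T) (p : ℕ) : 0 ≤ D.tot p :=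
  Finset.sum_nonneg fun j _ => hD.b_nonneg j p

lemma Regular.admissible {υ C w T C' : ℝ} (hD : D.Regular υ C w T) {z : ℕ → ℂ} {y : ℝ}
    (hy : 0 ≤ y) (hyw : 2 * y * w ≤ 1)
    (hC' : 4 * y ^ 2 * C ≤ C') (hn' : 0 ≤ Real.log (Real.log T))
    (hz : ∀ p ∈ D.primes, ‖z p‖ ≤ y * (D.tot p + D.c p)) :
    Admissible υ C' T D.primes z where
  prime := hD.prime
  le := hD.le
  norm_le p hp := by
    refine (hz p hp).trans (le_trans ?_ hyw)
    have h1 := hD.tot_le p hp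
    have h2 := hD.c_le p hp
    nlinarith
  sum_le := by
    have h1 : ∀ p ∈ D.primes, ‖z p‖ ^ 2 ≤ 2 * y ^ 2 * (D.tot p ^ 2 + D.c p ^ 2) := by
      intro p hp
      have h2 := hz p hp
      calc ‖z p‖ ^ 2 ≤ (y * (D.tot p + D.c p)) ^ 2 := by gcongr
        _ = y ^ 2 * (D.tot p + D.c p) ^ 2 := by ring
        _ ≤ y ^ 2 * (2 * (D.tot p ^ 2 + D.c p ^ 2)) := by
            gcongr
            nlinarith [sq_nonneg (D.tot p - D.c p)]
        _ = _ := by ring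
    refine (Finset.sum_le_sum h1).trans ?_
    rw [← Finset.mul_sum, Finset.sum_add_distrib, sum_tot_sq hD.b_disjoint]
    have h2 := hD.V_le
    have h3 := hD.c_sum_le
    calc 2 * y ^ 2 * (D.V + ∑ p ∈ D.primes, D.c p ^ 2)
        ≤ 2 * y ^ 2 * (C * Real.log (Real.log T) + C * Real.log (Real.log T)) := by gcongr
      _ = 4 * y ^ 2 * C * Real.log (Real.log T) := by ring
      _ ≤ C' * Real.log (Real.log T) := by gcongr

/-- The truncation of the density to the good points is controlled by Chernoff's bound: if a block
exceeds its threshold then `exp (κ (Re F_i - threshold)) ≥ 1`, and similarly for `S`. The points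
where some polynomial is larger than `n ^ 2` are counted separately. -/
lemma cutExp_le_phi_add {x η κ n : ℝ} (hκ : 0 ≤ κ) (u : ℝ) :
    cutExp (n ^ 2) (x * D.Ftot u) ≤ D.phi x η n u
      + (Real.exp (2 * n ^ 2) * ((if n ^ 2 < ‖D.S u‖ then 1 else 0)
          + ∑ i ∈ Finset.range D.r, if n ^ 2 < ‖D.F i u‖ then 1 else 0)
        + (∑ i ∈ Finset.range D.r, Real.exp (-(κ * (x * D.v i + η * n)))
            * cutExp ((1 + κ) * n ^ 2) (x * D.Ftot u + (κ / 2 : ℝ) * D.F i u)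
          + Real.exp (κ * (x * D.cov - η * n))
            * cutExp ((1 + κ) * n ^ 2) (x * D.Ftot u - (κ / 2 : ℝ) * D.S u))) := by
  have hre : ((x : ℂ) * D.Ftot u).re = x * (D.Ftot u).re := Complex.re_ofReal_mul _ _
  have hF0 : ∀ i, (0 : ℝ) ≤ if n ^ 2 < ‖D.F i u‖ then 1 else 0 := by
    intro i; split_ifs <;> norm_num
  have hC0 : ∀ i, 0 ≤ Real.exp (-(κ * (x * D.v i + η * n)))
      * cutExp ((1 + κ) * n ^ 2) (x * D.Ftot u + (κ / 2 : ℝ) * D.F i u) := fun i =>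
    mul_nonneg (Real.exp_pos _).le (cutExp_nonneg _ _)
  have hphi0 := D.phi_nonneg x η n u
  have hS0 : (0 : ℝ) ≤ if n ^ 2 < ‖D.S u‖ then 1 else 0 := by split_ifs <;> norm_num
  have hS1 : n ^ 2 < ‖D.S u‖ → (1 : ℝ) ≤ if n ^ 2 < ‖D.S u‖ then 1 else 0 := fun h => by
    rw [if_pos h]
  have hFs0 : (0 : ℝ) ≤ ∑ i ∈ Finset.range D.r, if n ^ 2 < ‖D.F i u‖ then 1 else 0 :=
    Finset.sum_nonneg fun i _ => hF0 i
  have hFs1 : ∀ i ∈ Finset.range D.r, n ^ 2 < ‖D.F i u‖ →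
      (1 : ℝ) ≤ ∑ i ∈ Finset.range D.r, if n ^ 2 < ‖D.F i u‖ then 1 else 0 := by
    intro i hi hFi
    have := Finset.single_le_sum (f := fun i => if n ^ 2 < ‖D.F i u‖ then (1 : ℝ) else 0)
      (fun i _ => hF0 i) hi
    simpa [hFi] using this
  have hCs0 := Finset.sum_nonneg fun i (_ : i ∈ Finset.range D.r) => hC0 i
  have hCS0 : 0 ≤ Real.exp (κ * (x * D.cov - η * n))
      * cutExp ((1 + κ) * n ^ 2) (x * D.Ftot u - (κ / 2 : ℝ) * D.S u) :=
    mul_nonneg (Real.exp_pos _).le (cutExp_nonneg _ _)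
  have hval : ‖(x : ℂ) * D.Ftot u‖ ≤ n ^ 2 →
      cutExp (n ^ 2) (x * D.Ftot u) = Real.exp (2 * (x * (D.Ftot u).re)) := fun hcut => by
    rw [cutExp, if_pos hcut, hre]
  have hle : cutExp (n ^ 2) (x * D.Ftot u) ≤ Real.exp (2 * n ^ 2) := by
    by_cases hcut : ‖(x : ℂ) * D.Ftot u‖ ≤ n ^ 2
    · rw [hval hcut]
      apply Real.exp_le_exp.2
      have := (Complex.re_le_norm _).trans hcut
      rw [hre] at this
      linarith
    · rw [cutExp, if_neg hcut]; positivity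
  have hup : ‖(x : ℂ) * D.Ftot u‖ ≤ n ^ 2 → ∀ i ∈ Finset.range D.r, ‖D.F i u‖ ≤ n ^ 2 →
      x * D.v i + η * n < (D.F i u).re → cutExp (n ^ 2) (x * D.Ftot u)
        ≤ ∑ i ∈ Finset.range D.r, Real.exp (-(κ * (x * D.v i + η * n)))
            * cutExp ((1 + κ) * n ^ 2) (x * D.Ftot u + (κ / 2 : ℝ) * D.F i u) := by
    intro hcut i hi hFn hFi
    refine le_trans ?_ (Finset.single_le_sum (f := fun i => Real.exp (-(κ * (x * D.v i + η * n)))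
      * cutExp ((1 + κ) * n ^ 2) (x * D.Ftot u + (κ / 2 : ℝ) * D.F i u)) (fun i _ => hC0 i) hi)
    have h2 : ‖(x : ℂ) * D.Ftot u + (κ / 2 : ℝ) * D.F i u‖ ≤ (1 + κ) * n ^ 2 := by
      refine (norm_add_le _ _).trans ?_
      rw [norm_mul ((κ / 2 : ℝ) : ℂ), Complex.norm_real, Real.norm_of_nonneg (by positivity)]
      nlinarith [sq_nonneg n]
    rw [hval hcut]
    rw [cutExp, if_pos h2, ← Real.exp_add]
    apply Real.exp_le_exp.2
    rw [Complex.add_re, hre, Complex.re_ofReal_mul]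
    nlinarith
  have hlow : ‖(x : ℂ) * D.Ftot u‖ ≤ n ^ 2 → ‖D.S u‖ ≤ n ^ 2 →
      (D.S u).re < x * D.cov - η * n → cutExp (n ^ 2) (x * D.Ftot u)
        ≤ Real.exp (κ * (x * D.cov - η * n))
            * cutExp ((1 + κ) * n ^ 2) (x * D.Ftot u - (κ / 2 : ℝ) * D.S u) := by
    intro hcut hSn hSl
    have h2 : ‖(x : ℂ) * D.Ftot u - (κ / 2 : ℝ) * D.S u‖ ≤ (1 + κ) * n ^ 2 := by
      refine (norm_sub_le _ _).trans ?_
      rw [norm_mul ((κ / 2 : ℝ) : ℂ), Complex.norm_real, Real.norm_of_nonneg (by positivity)]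
      nlinarith [sq_nonneg n]
    rw [hval hcut, cutExp, if_pos h2, ← Real.exp_add]
    apply Real.exp_le_exp.2
    rw [Complex.sub_re, hre, Complex.re_ofReal_mul]
    nlinarith
  have hgood : ‖(x : ℂ) * D.Ftot u‖ ≤ n ^ 2 → D.Good x η n u →
      cutExp (n ^ 2) (x * D.Ftot u) ≤ D.phi x η n u := by
    intro hcut h
    rw [hval hcut, phi, if_pos h]
    apply le_of_eq; ring_nf
  have hzero : ¬ ‖(x : ℂ) * D.Ftot u‖ ≤ n ^ 2 → cutExp (n ^ 2) (x * D.Ftot u) = 0 := fun h => by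
    rw [cutExp, if_neg h]
  have hE := Real.exp_pos (2 * n ^ 2)
  unfold Good at hgood
  -- it remains to distinguish the ways in which a point may fail to be good
  generalize (if n ^ 2 < ‖D.S u‖ then (1 : ℝ) else 0) = a at *
  generalize (∑ i ∈ Finset.range D.r, if n ^ 2 < ‖D.F i u‖ then (1 : ℝ) else 0) = b at *
  generalize (∑ i ∈ Finset.range D.r, Real.exp (-(κ * (x * D.v i + η * n)))
            * cutExp ((1 + κ) * n ^ 2) (x * D.Ftot u + (κ / 2 : ℝ) * D.F i u)) = c at *
  generalize (Real.exp (κ * (x * D.cov - η * n))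
            * cutExp ((1 + κ) * n ^ 2) (x * D.Ftot u - (κ / 2 : ℝ) * D.S u)) = d at *
  generalize cutExp (n ^ 2) (x * D.Ftot u) = e at *
  generalize D.phi x η n u = f at *
  generalize Real.exp (2 * n ^ 2) = E at *
  have hEab : 0 ≤ E * (a + b) := by positivity
  by_cases hcut : ‖(x : ℂ) * D.Ftot u‖ ≤ n ^ 2
  swap
  · rw [hzero hcut]; linarith
  by_cases hS : n ^ 2 < ‖D.S u‖
  · nlinarith [hS1 hS]
  by_cases hF : ∃ i ∈ Finset.range D.r, n ^ 2 < ‖D.F i u‖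
  · obtain ⟨i, hi, hFi⟩ := hF
    nlinarith [hFs1 i hi hFi]
  push Not at hF hS
  by_cases hup' : ∃ i ∈ Finset.range D.r, x * D.v i + η * n < (D.F i u).re
  · obtain ⟨i, hi, hFi⟩ := hup'
    linarith [hup hcut i hi (hF i hi) hFi]
  by_cases hlow' : (D.S u).re < x * D.cov - η * n
  · linarith [hlow hcut hS hlow']
  push Not at hup' hlow'
  linarith [hgood hcut ⟨hS, fun i hi => ⟨hF i hi, hup' i hi⟩, hlow'⟩]

/-- In the product of the densities at two points the first `j` blocks are bounded by the truncation
at one of the points. -/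
lemma phi_mul_phi_le {x η n : ℝ} (hx : 0 ≤ x) {j : ℕ} (hj : j ≤ D.r) (u t : ℝ) :
    D.phi x η n u * D.phi x η n (u + t)
      ≤ Real.exp (2 * x * (x * ∑ i ∈ Finset.range j, D.v i + j * (η * n)))
        * cutExp ((2 * x * D.r + 1) * n ^ 2)
            (x * (D.Ftot u + ∑ i ∈ Finset.Ico j D.r, D.F i (u + t))) := by
  by_cases h : D.Good x η n u ∧ D.Good x η n (u + t)
  swap
  · have h0 : D.phi x η n u * D.phi x η n (u + t) = 0 := by
      rw [not_and_or] at h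
      rcases h with h | h
      · rw [phi, if_neg h, zero_mul]
      · rw [mul_comm, phi, if_neg h, zero_mul]
    rw [h0]
    exact mul_nonneg (Real.exp_pos _).le (cutExp_nonneg _ _)
  obtain ⟨h1, h2⟩ := h
  have hnorm : ‖(x : ℂ) * (D.Ftot u + ∑ i ∈ Finset.Ico j D.r, D.F i (u + t))‖
      ≤ (2 * x * D.r + 1) * n ^ 2 := by
    rw [norm_mul, Complex.norm_real, Real.norm_of_nonneg hx]
    have h3 : ‖D.Ftot u‖ ≤ D.r * n ^ 2 := by
      refine (norm_sum_le _ _).trans ?_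
      calc _ ≤ ∑ _i ∈ Finset.range D.r, n ^ 2 := Finset.sum_le_sum fun i hi => (h1.2.1 i hi).1
        _ = _ := by simp
    have h4 : ‖∑ i ∈ Finset.Ico j D.r, D.F i (u + t)‖ ≤ D.r * n ^ 2 := by
      refine (norm_sum_le _ _).trans ?_
      calc _ ≤ ∑ _i ∈ Finset.Ico j D.r, n ^ 2 := Finset.sum_le_sum fun i hi =>
            (h2.2.1 i (Finset.mem_range.2 (Finset.mem_Ico.1 hi).2)).1
        _ ≤ ∑ _i ∈ Finset.range D.r, n ^ 2 := by
            refine Finset.sum_le_sum_of_subset_of_nonneg ?_ fun _ _ _ => sq_nonneg _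
            intro i hi
            exact Finset.mem_range.2 (Finset.mem_Ico.1 hi).2
        _ = _ := by simp
    have h5 := norm_add_le (D.Ftot u) (∑ i ∈ Finset.Ico j D.r, D.F i (u + t))
    calc x * ‖D.Ftot u + ∑ i ∈ Finset.Ico j D.r, D.F i (u + t)‖
        ≤ x * (D.r * n ^ 2 + D.r * n ^ 2) := by gcongr; linarith
      _ ≤ _ := by nlinarith [sq_nonneg n]
  rw [phi, if_pos h1, phi, if_pos h2, cutExp, if_pos hnorm, ← Real.exp_add, ← Real.exp_add]
  apply Real.exp_le_exp.2
  rw [Complex.re_ofReal_mul, Complex.add_re]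
  have h3 : (D.Ftot (u + t)).re = (∑ i ∈ Finset.range j, D.F i (u + t)).re
      + (∑ i ∈ Finset.Ico j D.r, D.F i (u + t)).re := by
    rw [Ftot, ← Finset.sum_range_add_sum_Ico _ hj, Complex.add_re]
  have h4 : (∑ i ∈ Finset.range j, D.F i (u + t)).re
      ≤ x * ∑ i ∈ Finset.range j, D.v i + j * (η * n) := by
    rw [Complex.re_sum, Finset.mul_sum]
    calc _ ≤ ∑ i ∈ Finset.range j, (x * D.v i + η * n) := Finset.sum_le_sum fun i hi =>
          (h2.2.1 i (Finset.mem_range.2 ((Finset.mem_range.1 hi).trans_le hj))).2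
      _ = _ := by rw [Finset.sum_add_distrib]; simp
  rw [h3]
  have h5 : 2 * x * (∑ i ∈ Finset.range j, D.F i (u + t)).re
      ≤ 2 * x * (x * ∑ i ∈ Finset.range j, D.v i + j * (η * n)) := by gcongr
  linarith

end ScaleData

/-! ### One-point and two-point bounds -/

namespace ScaleData

variable {D : ScaleData}

lemma const_mul_Ftot_eq (x : ℝ) (u : ℝ) :
    (x : ℂ) * D.Ftot u = dirPoly D.primes (fun p => ((x * D.tot p : ℝ) : ℂ)) u := by
  rw [Ftot_eq, ← dirPoly_const_mul]
  simp only [Complex.ofReal_mul]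

lemma const_mul_Ftot_add_eq (x y : ℝ) (i : ℕ) (u : ℝ) :
    (x : ℂ) * D.Ftot u + (y : ℂ) * D.F i u
      = dirPoly D.primes (fun p => ((x * D.tot p + y * D.b i p : ℝ) : ℂ)) u := by
  rw [Ftot_eq, F, ← dirPoly_const_mul, ← dirPoly_const_mul, ← dirPoly_add]
  simp only [Complex.ofReal_mul, Complex.ofReal_add]

lemma const_mul_Ftot_sub_eq (x y : ℝ) (u : ℝ) :
    (x : ℂ) * D.Ftot u - (y : ℂ) * D.S u
      = dirPoly D.primes (fun p => ((x * D.tot p - y * D.c p : ℝ) : ℂ)) u := by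
  rw [sub_eq_add_neg, ← neg_mul, Ftot_eq, S, ← dirPoly_const_mul, ← dirPoly_const_mul,
    ← dirPoly_add]
  simp only [sub_eq_add_neg, Complex.ofReal_mul, Complex.ofReal_add, Complex.ofReal_neg, neg_mul]

lemma norm_sq_ofReal (y : ℝ) : ‖(y : ℂ)‖ ^ 2 = y ^ 2 := by
  rw [Complex.norm_real, Real.norm_eq_abs, sq_abs]

lemma sum_norm_sq_tot (hb : ∀ i j p, i ≠ j → D.b i p * D.b j p = 0) (x : ℝ) :
    ∑ p ∈ D.primes, ‖((x * D.tot p : ℝ) : ℂ)‖ ^ 2 = x ^ 2 * D.V := by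
  simp only [norm_sq_ofReal, mul_pow, ← Finset.mul_sum, sum_tot_sq hb]

lemma sum_norm_sq_tot_add (hb : ∀ i j p, i ≠ j → D.b i p * D.b j p = 0) (x y : ℝ) {i : ℕ}
    (hi : i < D.r) : ∑ p ∈ D.primes, ‖((x * D.tot p + y * D.b i p : ℝ) : ℂ)‖ ^ 2
      = x ^ 2 * D.V + 2 * x * y * D.v i + y ^ 2 * D.v i := by
  have h : ∀ p, ‖((x * D.tot p + y * D.b i p : ℝ) : ℂ)‖ ^ 2
      = x ^ 2 * D.tot p ^ 2 + 2 * x * y * (D.tot p * D.b i p) + y ^ 2 * D.b i p ^ 2 := by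
    intro p; rw [norm_sq_ofReal]; ring
  simp only [h, Finset.sum_add_distrib, ← Finset.mul_sum, sum_tot_sq hb, sum_tot_mul_b hb hi]
  rfl

lemma sum_norm_sq_tot_sub (hb : ∀ i j p, i ≠ j → D.b i p * D.b j p = 0) (x y : ℝ) :
    ∑ p ∈ D.primes, ‖((x * D.tot p - y * D.c p : ℝ) : ℂ)‖ ^ 2
      = x ^ 2 * D.V - 2 * x * y * D.cov + y ^ 2 * ∑ p ∈ D.primes, D.c p ^ 2 := by
  have h : ∀ p, ‖((x * D.tot p - y * D.c p : ℝ) : ℂ)‖ ^ 2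
      = x ^ 2 * D.tot p ^ 2 - 2 * x * y * (D.tot p * D.c p) + y ^ 2 * D.c p ^ 2 := by
    intro p; rw [norm_sq_ofReal]; ring
  simp only [h, Finset.sum_add_distrib, Finset.sum_sub_distrib, ← Finset.mul_sum, sum_tot_sq hb]
  rfl

lemma V_nonneg : 0 ≤ D.V := Finset.sum_nonneg fun i _ => v_nonneg i

lemma tendsto_loglog : Tendsto (fun T : ℝ => Real.log (Real.log T)) atTop atTop :=
  Real.tendsto_log_atTop.comp Real.tendsto_log_atTop

lemma intervalIntegrable_indicator {f : ℝ → ℂ} (hf : Continuous f) (R a b : ℝ) :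
    IntervalIntegrable (fun u => if R < ‖f u‖ then (1 : ℝ) else 0) volume a b := by
  have h := intervalIntegrable_ite (f := fun _ => (1 : ℝ)) continuous_const
    (p := fun u => R < ‖f u‖) (isOpen_lt continuous_const (by fun_prop)).measurableSet a b
  convert h using 2

/-- The mean value of the bound `cutExp_le_phi_add`, given a bound for the mean value of each of the
error terms. -/
lemma mean_cutExp_le_mean_phi_add {x η κ n T a q Q R : ℝ} (hT : 0 < T) (hκ : 0 ≤ κ)
    (hS : mean T a (fun u => if n ^ 2 < ‖D.S u‖ then 1 else 0) ≤ q * Real.exp (-(2 * n ^ 2)))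
    (hF : ∀ i < D.r, mean T a (fun u => if n ^ 2 < ‖D.F i u‖ then 1 else 0)
      ≤ q * Real.exp (-(2 * n ^ 2)))
    (hR : ∀ i < D.r, Real.exp (-(κ * (x * D.v i + η * n)))
      * mean T a (fun u => cutExp ((1 + κ) * n ^ 2) (x * D.Ftot u + (κ / 2 : ℝ) * D.F i u)) ≤ Q)
    (hRS : Real.exp (κ * (x * D.cov - η * n))
      * mean T a (fun u => cutExp ((1 + κ) * n ^ 2) (x * D.Ftot u - (κ / 2 : ℝ) * D.S u)) ≤ Q)
    (hlow : R ≤ mean T a (fun u => cutExp (n ^ 2) (x * D.Ftot u))) :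
    R - (D.r + 1) * (q + Q) ≤ mean T a (D.phi x η n) := by
  have i1 := fun b => intervalIntegrable_indicator (f := D.S) (by fun_prop) (n ^ 2) a b
  have i2 := fun i b => intervalIntegrable_indicator (f := D.F i) (by fun_prop) (n ^ 2) a b
  have i2' : ∀ b, IntervalIntegrable
      (fun u => ∑ i ∈ Finset.range D.r, if n ^ 2 < ‖D.F i u‖ then (1 : ℝ) else 0) volume a b :=
    fun b => by
      have := IntervalIntegrable.sum (Finset.range D.r) (fun i _ => i2 i b)
      exact this.congr fun u _ => by simp only [Finset.sum_apply]
  have i3 := fun i b => intervalIntegrable_cutExp ((1 + κ) * n ^ 2)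
    (f := fun u => (x : ℂ) * D.Ftot u + (κ / 2 : ℝ) * D.F i u) (by fun_prop) a b
  have i3' : ∀ b, IntervalIntegrable (fun u => ∑ i ∈ Finset.range D.r,
      Real.exp (-(κ * (x * D.v i + η * n)))
        * cutExp ((1 + κ) * n ^ 2) (x * D.Ftot u + (κ / 2 : ℝ) * D.F i u)) volume a b :=
    fun b => by
      have := IntervalIntegrable.sum (Finset.range D.r)
        (fun i _ => (i3 i b).const_mul (Real.exp (-(κ * (x * D.v i + η * n)))))
      exact this.congr fun u _ => by simp only [Finset.sum_apply]
  have i4 := fun b => intervalIntegrable_cutExp ((1 + κ) * n ^ 2)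
    (f := fun u => (x : ℂ) * D.Ftot u - (κ / 2 : ℝ) * D.S u) (by fun_prop) a b
  have i5 := fun b => intervalIntegrable_phi (D := D) x η n a b
  have h := mean_mono (a := a) hT (intervalIntegrable_cutExp (n ^ 2)
      (f := fun u => (x : ℂ) * D.Ftot u) (by fun_prop) _ _)
    ((i5 _).add ((((i1 _).add (i2' _)).const_mul (Real.exp (2 * n ^ 2))).add
      ((i3' _).add ((i4 _).const_mul (Real.exp (κ * (x * D.cov - η * n)))))))
    (fun u => cutExp_le_phi_add hκ u)
  rw [mean_add (i5 _) ((((i1 _).add (i2' _)).const_mul (Real.exp (2 * n ^ 2))).add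
      ((i3' _).add ((i4 _).const_mul _))),
    mean_add (((i1 _).add (i2' _)).const_mul _) ((i3' _).add ((i4 _).const_mul _)),
    mean_const_mul, mean_add (i1 _) (i2' _), mean_add (i3' _) ((i4 _).const_mul _),
    mean_const_mul, mean_sum _ (fun i _ => i2 i _),
    mean_sum _ (fun i _ => (i3 i _).const_mul _)] at h
  simp only [mean_const_mul] at h
  have h1 := Finset.sum_le_sum fun i (hi : i ∈ Finset.range D.r) => hF i (Finset.mem_range.1 hi)
  have h2 := Finset.sum_le_sum fun i (hi : i ∈ Finset.range D.r) => hR i (Finset.mem_range.1 hi)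
  rw [Finset.sum_const, Finset.card_range, nsmul_eq_mul] at h1 h2
  have h3 : Real.exp (2 * n ^ 2) * (mean T a (fun u => if n ^ 2 < ‖D.S u‖ then 1 else 0)
      + ∑ i ∈ Finset.range D.r, mean T a (fun u => if n ^ 2 < ‖D.F i u‖ then 1 else 0))
      ≤ (D.r + 1) * q := by
    have h4 := mul_le_mul_of_nonneg_left (add_le_add hS h1) (Real.exp_pos (2 * n ^ 2)).le
    refine h4.trans (le_of_eq ?_)
    have h5 : Real.exp (2 * n ^ 2) * Real.exp (-(2 * n ^ 2)) = 1 := by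
      rw [← Real.exp_add]; simp
    linear_combination ((D.r : ℝ) + 1) * q * h5
  linarith

set_option maxHeartbeats 600000 in
/-- The mean value of the truncated density is almost that of the density: Chernoff's bound shows
that the bad points are negligible. -/
lemma eventually_le_mean_phi {x η C υ ε : ℝ} (hx : 0 ≤ x) (hη : 0 < η) (hC : 0 < C) (hυ : υ < 1)
    (hε : 0 < ε) (r : ℕ) :
    ∃ w₀ : ℝ, 0 < w₀ ∧ ∀ w ≤ w₀, ∀ᶠ T : ℝ in atTop, ∀ D : ScaleData, D.Regular υ C w T → D.r = r →
      ∀ a, (1 - ε) * Real.exp (x ^ 2 * D.V) ≤ mean T a (D.phi x η (Real.log (Real.log T))) := by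
  -- `κ` makes the quadratic term `κ ^ 2 v_i / 4 ≤ κ ^ 2 C n / 4` at most half of the gain `κ η n`
  set κ : ℝ := 2 * η / C with hκdef
  have hκ : 0 < κ := by positivity
  set ε' : ℝ := ε / (4 * (r + 9)) with hε'def
  have hε' : 0 < ε' := by positivity
  set y : ℝ := x + κ + 1 with hydef
  have hy : 0 < y := by positivity
  have hC' : 0 < 4 * y ^ 2 * C := by positivity
  refine ⟨min (1 / (2 * y)) (ε' / (x ^ 4 + 1)), by positivity, fun w hw => ?_⟩
  have hw1 : 2 * y * w ≤ 1 := by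
    have := (le_div_iff₀ (by positivity)).1 (hw.trans (min_le_left _ _))
    linarith
  have hw2 : x ^ 4 * w ≤ ε' := by
    have := (le_div_iff₀ (by positivity)).1 (hw.trans (min_le_right _ _))
    rcases le_or_gt w 0 with h | h
    · have : x ^ 4 * w ≤ 0 := mul_nonpos_of_nonneg_of_nonpos (by positivity) h
      linarith
    · nlinarith
  have hdec : ∀ᶠ T : ℝ in atTop,
      2 * Real.exp (-(κ * η / 2 * Real.log (Real.log T))) ≤ ε' := by
    have h1 : Tendsto (fun T : ℝ => 2 * Real.exp (-(κ * η / 2 * Real.log (Real.log T)))) atTop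
        (𝓝 (2 * 0)) :=
      (Real.tendsto_exp_neg_atTop_nhds_zero.comp
        (tendsto_loglog.const_mul_atTop (by positivity))).const_mul 2
    rw [mul_zero] at h1
    exact h1.eventually (eventually_le_nhds hε')
  filter_upwards [eventually_mean_cutExp_le (C₁ := 4 * y ^ 2 * C) (C₂ := 1 + κ) hυ (by positivity)
      one_pos, eventually_mean_large_le (C₁ := 4 * y ^ 2 * C) (C₂ := 1) hυ hC' one_pos hε' 2,
    eventually_le_mean_cutExp (C₁ := 4 * y ^ 2 * C) (C₂ := 1) hυ hC' one_pos hε',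
    hdec, tendsto_loglog.eventually_ge_atTop 0, eventually_gt_atTop 0]
    with T hT1 hT2 hT3 hT4 hn hT0 D hD hr a
  set n := Real.log (Real.log T) with hndef
  have hb := hD.b_disjoint
  have hadm : ∀ z : ℕ → ℂ, (∀ p ∈ D.primes, ‖z p‖ ≤ y * (D.tot p + D.c p)) →
      Admissible υ (4 * y ^ 2 * C) T D.primes z := fun z hz =>
    hD.admissible hy.le hw1 le_rfl hn hz
  have hV0 : 0 ≤ x ^ 2 * D.V := mul_nonneg (sq_nonneg _) V_nonneg
  have key : κ ^ 2 / 4 * C = κ * η / 2 := by rw [hκdef]; field_simp; ring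
  have hlow := hT3 D.primes (fun p => ((x * D.tot p : ℝ) : ℂ)) (hadm _ fun p _ => by
      have := hD.tot_nonneg p
      have := hD.c_nonneg p
      rw [Complex.norm_real, Real.norm_of_nonneg (by positivity)]
      nlinarith) (by
      have h1 : ∀ p, ‖((x * D.tot p : ℝ) : ℂ)‖ ^ 4 = x ^ 4 * D.tot p ^ 4 := by
        intro p
        rw [show 4 = 2 * 2 from rfl, pow_mul, norm_sq_ofReal]; ring
      simp only [h1, ← Finset.mul_sum]
      exact (mul_le_mul_of_nonneg_left hD.tot_four_le (by positivity)).trans hw2) a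
  rw [sum_norm_sq_tot hb, one_mul] at hlow
  simp only [← const_mul_Ftot_eq] at hlow
  have hS := hT2 D.primes (fun p => (D.c p : ℂ)) (hadm _ fun p _ => by
      have := hD.tot_nonneg p
      have := hD.c_nonneg p
      rw [Complex.norm_real, Real.norm_of_nonneg (by positivity)]
      nlinarith) a
  rw [one_mul] at hS
  have hF : ∀ i < D.r, mean T a (fun u => if n ^ 2 < ‖D.F i u‖ then 1 else 0)
      ≤ ε' * Real.exp (-(2 * n ^ 2)) := fun i hi => by
    have := hT2 D.primes (fun p => (D.b i p : ℂ)) (hadm _ fun p _ => by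
      have := hD.b_le_tot hi p
      have := hD.b_nonneg i p
      have := hD.c_nonneg p
      rw [Complex.norm_real, Real.norm_of_nonneg (by positivity)]
      nlinarith) a
    rwa [one_mul] at this
  have hR : ∀ i < D.r, Real.exp (-(κ * (x * D.v i + η * n)))
      * mean T a (fun u => cutExp ((1 + κ) * n ^ 2) (x * D.Ftot u + (κ / 2 : ℝ) * D.F i u))
      ≤ ε' * Real.exp (x ^ 2 * D.V) := fun i hi => by
    have h := hT1 D.primes (fun p => ((x * D.tot p + κ / 2 * D.b i p : ℝ) : ℂ))
      (hadm _ fun p _ => by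
        have := hD.b_le_tot hi p
        have := hD.b_nonneg i p
        have := hD.tot_nonneg p
        have := hD.c_nonneg p
        rw [Complex.norm_real, Real.norm_of_nonneg (by positivity)]
        nlinarith) a
    rw [sum_norm_sq_tot_add hb _ _ hi] at h
    simp only [← const_mul_Ftot_add_eq] at h
    refine (mul_le_mul_of_nonneg_left h (Real.exp_pos _).le).trans ?_
    have hv : κ ^ 2 / 4 * D.v i ≤ κ * η / 2 * n := by
      rw [← key, mul_assoc]
      exact mul_le_mul_of_nonneg_left ((v_le_V hi).trans hD.V_le) (by positivity)
    calc _ = 2 * Real.exp (x ^ 2 * D.V + κ ^ 2 / 4 * D.v i - κ * η * n) := by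
          rw [mul_left_comm, ← Real.exp_add]
          norm_num
          ring_nf
      _ ≤ 2 * Real.exp (x ^ 2 * D.V + -(κ * η / 2 * n)) := by
          gcongr; linarith
      _ = 2 * Real.exp (-(κ * η / 2 * n)) * Real.exp (x ^ 2 * D.V) := by
          rw [Real.exp_add]; ring
      _ ≤ _ := by gcongr
  have hRS : Real.exp (κ * (x * D.cov - η * n))
      * mean T a (fun u => cutExp ((1 + κ) * n ^ 2) (x * D.Ftot u - (κ / 2 : ℝ) * D.S u))
      ≤ ε' * Real.exp (x ^ 2 * D.V) := by
    have h := hT1 D.primes (fun p => ((x * D.tot p - κ / 2 * D.c p : ℝ) : ℂ))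
      (hadm _ fun p _ => by
        have := hD.tot_nonneg p
        have := hD.c_nonneg p
        rw [Complex.norm_real, Real.norm_eq_abs]
        refine abs_le.2 ⟨?_, ?_⟩ <;> nlinarith [mul_nonneg hx this, mul_nonneg hκ.le this]) a
    rw [sum_norm_sq_tot_sub hb] at h
    simp only [← const_mul_Ftot_sub_eq] at h
    refine (mul_le_mul_of_nonneg_left h (Real.exp_pos _).le).trans ?_
    have hv : κ ^ 2 / 4 * ∑ p ∈ D.primes, D.c p ^ 2 ≤ κ * η / 2 * n := by
      rw [← key, mul_assoc]
      exact mul_le_mul_of_nonneg_left hD.c_sum_le (by positivity)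
    calc _ = 2 * Real.exp (x ^ 2 * D.V + κ ^ 2 / 4 * ∑ p ∈ D.primes, D.c p ^ 2 - κ * η * n) := by
          rw [mul_left_comm, ← Real.exp_add]
          norm_num
          ring_nf
      _ ≤ 2 * Real.exp (x ^ 2 * D.V + -(κ * η / 2 * n)) := by
          gcongr; linarith
      _ = 2 * Real.exp (-(κ * η / 2 * n)) * Real.exp (x ^ 2 * D.V) := by
          rw [Real.exp_add]; ring
      _ ≤ _ := by gcongr
  refine le_trans ?_ (mean_cutExp_le_mean_phi_add hT0 hκ.le hS hF hR hRS hlow)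
  have hE : 1 ≤ Real.exp (x ^ 2 * D.V) := Real.one_le_exp hV0
  rw [hr]
  have h1 : ((r : ℝ) + 1) * (ε' + ε' * Real.exp (x ^ 2 * D.V))
      ≤ ((r : ℝ) + 1) * (2 * ε' * Real.exp (x ^ 2 * D.V)) := by
    gcongr
    nlinarith
  have h2 : 8 * ε' + ((r : ℝ) + 1) * (2 * ε') ≤ ε := by
    have : ε = 4 * (r + 9) * ε' := by rw [hε'def]; field_simp
    rw [this]
    have : (0 : ℝ) ≤ r := r.cast_nonneg
    nlinarith
  have h3 := mul_le_mul_of_nonneg_right h2 (zero_le_one.trans hE)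
  linarith

/-- The coefficients of the sum of the blocks from `j` on. -/
def tail (D : ScaleData) (j p : ℕ) : ℝ := ∑ i ∈ Finset.Ico j D.r, D.b i p

lemma Ftot_add_tail_eq (x : ℝ) (j : ℕ) (u t : ℝ) :
    (x : ℂ) * (D.Ftot u + ∑ i ∈ Finset.Ico j D.r, D.F i (u + t)) = dirPoly D.primes
      (fun p => x * (D.tot p
        + D.tail j p * Complex.exp (-(Complex.I * ((t * Real.log p : ℝ) : ℂ))))) u := by
  rw [dirPoly_const_mul, dirPoly_add, ← Ftot_eq]
  congr 2
  rw [← dirPoly_shift _ (fun p => (D.tail j p : ℂ))]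
  unfold F tail
  rw [← dirPoly_sum]
  simp

lemma norm_sq_add_mul_exp (a b y : ℝ) :
    ‖(a : ℂ) + b * Complex.exp (-(Complex.I * (y : ℂ)))‖ ^ 2
      = a ^ 2 + 2 * (a * b) * Real.cos y + b ^ 2 := by
  rw [show -(Complex.I * (y : ℂ)) = ((-y : ℝ) : ℂ) * Complex.I by push_cast; ring,
    Complex.exp_mul_I, ← Complex.ofReal_cos, ← Complex.ofReal_sin, Complex.sq_norm,
    Complex.normSq_apply]
  simp only [Complex.add_re, Complex.add_im, Complex.mul_re, Complex.mul_im, Complex.ofReal_re,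
    Complex.ofReal_im, Complex.I_re, Complex.I_im, Real.cos_neg, Real.sin_neg]
  ring_nf
  nlinarith [Real.sin_sq_add_cos_sq y]

lemma sum_norm_sq_tot_add_tail (hb : ∀ i j p, i ≠ j → D.b i p * D.b j p = 0) (x : ℝ) {j : ℕ}
    (t : ℝ) :
    ∑ p ∈ D.primes, ‖(x : ℂ) * (D.tot p
        + D.tail j p * Complex.exp (-(Complex.I * ((t * Real.log p : ℝ) : ℂ))))‖ ^ 2
      = x ^ 2 * (D.V + ∑ i ∈ Finset.Ico j D.r, D.v i
        + 2 * ∑ i ∈ Finset.Ico j D.r, ∑ p ∈ D.primes, D.b i p ^ 2 * Real.cos (t * Real.log p)) := by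
  have hsub : Finset.Ico j D.r ⊆ Finset.range D.r := fun i hi =>
    Finset.mem_range.2 (Finset.mem_Ico.1 hi).2
  have h1 : ∀ p, D.tot p * D.tail j p = ∑ i ∈ Finset.Ico j D.r, D.b i p ^ 2 := fun p =>
    sum_mul_sum_of_disjoint hb hsub p
  have h2 : ∀ p, D.tail j p ^ 2 = ∑ i ∈ Finset.Ico j D.r, D.b i p ^ 2 := fun p => by
    rw [sq]; exact sum_mul_sum_of_disjoint hb (Finset.Subset.refl _) p
  have h3 : ∀ p ∈ D.primes, ‖(x : ℂ) * (D.tot p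
      + D.tail j p * Complex.exp (-(Complex.I * ((t * Real.log p : ℝ) : ℂ))))‖ ^ 2
      = x ^ 2 * (D.tot p ^ 2 + ∑ i ∈ Finset.Ico j D.r, D.b i p ^ 2
        + 2 * ∑ i ∈ Finset.Ico j D.r, D.b i p ^ 2 * Real.cos (t * Real.log p)) := by
    intro p _
    rw [norm_mul, mul_pow, norm_sq_ofReal, norm_sq_add_mul_exp, h1, h2, ← Finset.sum_mul]
    ring
  rw [Finset.sum_congr rfl h3, ← Finset.mul_sum, Finset.sum_add_distrib, Finset.sum_add_distrib,
    ← Finset.mul_sum, sum_tot_sq hb, Finset.sum_comm (s := D.primes),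
    Finset.sum_comm (s := D.primes)]
  rfl

/-- The two-point bound: the blocks from `j` on are decorrelated at distance `t` up to `q`, and
the earlier ones are bounded by the truncation. -/
lemma eventually_mean_phi_mul_phi_le {x η C υ ε w : ℝ} (hx : 0 < x)
    (hυ : υ < 1) (hε : 0 < ε) (hw : 4 * x * w ≤ 1) (r : ℕ) :
    ∀ᶠ T : ℝ in atTop, ∀ D : ScaleData, D.Regular υ C w T → D.r = r → ∀ j ≤ r, ∀ t q : ℝ,
      ∑ i ∈ Finset.Ico j r, ∑ p ∈ D.primes, D.b i p ^ 2 * Real.cos (t * Real.log p) ≤ q →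
      ∀ a, mean T a (fun u => D.phi x η (Real.log (Real.log T)) u
          * D.phi x η (Real.log (Real.log T)) (u + t))
        ≤ (1 + ε) * Real.exp (2 * x ^ 2 * D.V + x ^ 2 * ∑ i ∈ Finset.range j, D.v i
          + 2 * x * (j * (η * Real.log (Real.log T))) + 2 * x ^ 2 * q) := by
  filter_upwards [eventually_mean_cutExp_le (C₁ := 4 * (2 * x) ^ 2 * C) (C₂ := 2 * x * r + 1) hυ
    (by positivity) hε, tendsto_loglog.eventually_ge_atTop 0, eventually_gt_atTop 0]
    with T hT hn hT0 D hD hr j hj t q hq a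
  subst hr
  set n := Real.log (Real.log T) with hndef
  have hb := hD.b_disjoint
  have h := hT D.primes _ (hD.admissible (y := 2 * x) (by positivity) (by linarith) le_rfl hn
    (z := fun p => x * (D.tot p
        + D.tail j p * Complex.exp (-(Complex.I * ((t * Real.log p : ℝ) : ℂ))))) (fun p _ => by
      have h0 := hD.tot_nonneg p
      have h1 := hD.c_nonneg p
      have h2 : 0 ≤ D.tail j p := Finset.sum_nonneg fun i _ => hD.b_nonneg i p
      have h3 : D.tail j p ≤ D.tot p := Finset.sum_le_sum_of_subset_of_nonneg
        (fun i hi => Finset.mem_range.2 (Finset.mem_Ico.1 hi).2) fun i _ _ => hD.b_nonneg i p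
      rw [norm_mul, Complex.norm_real, Real.norm_of_nonneg hx.le]
      have h4 : ‖(D.tot p : ℂ)
          + D.tail j p * Complex.exp (-(Complex.I * ((t * Real.log p : ℝ) : ℂ)))‖
          ≤ D.tot p + D.tail j p := by
        refine (norm_add_le _ _).trans ?_
        rw [norm_mul, Complex.norm_real, Complex.norm_real, Real.norm_of_nonneg h0,
          Real.norm_of_nonneg h2, show -(Complex.I * ((t * Real.log p : ℝ) : ℂ))
            = ((-(t * Real.log p) : ℝ) : ℂ) * Complex.I by push_cast; ring,
          Complex.norm_exp_ofReal_mul_I, mul_one]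
      nlinarith)) a
  rw [sum_norm_sq_tot_add_tail hb] at h
  simp only [← Ftot_add_tail_eq] at h
  have h1 := mean_mono (a := a) hT0 (f := fun u => D.phi x η n u * D.phi x η n (u + t)) ?_
    ((intervalIntegrable_cutExp ((2 * x * D.r + 1) * n ^ 2)
      (f := fun u => (x : ℂ) * (D.Ftot u + ∑ i ∈ Finset.Ico j D.r, D.F i (u + t)))
      (by fun_prop) _ _).const_mul _) (fun u => phi_mul_phi_le (η := η) hx.le hj u t)
  swap
  · have hB : ∀ u, ‖D.phi x η n (u + t)‖
        ≤ Real.exp (2 * x ^ 2 * D.V + 2 * x * (D.r * (η * n))) := fun u => by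
      rw [Real.norm_of_nonneg (phi_nonneg _ _ _ _)]
      exact phi_le hx.le _
    have hm : Measurable fun u => D.phi x η n (u + t) :=
      (measurable_phi x η n).comp (measurable_id.add_const t)
    have hi := intervalIntegrable_phi (D := D) x η n a (a + T)
    have h2 : IntervalIntegrable (fun u => D.phi x η n (u + t) * D.phi x η n u) volume a (a + T) :=
      ⟨hi.1.bdd_mul hm.aestronglyMeasurable (Eventually.of_forall hB),
        hi.2.bdd_mul hm.aestronglyMeasurable (Eventually.of_forall hB)⟩
    exact h2.congr (fun u _ => mul_comm _ _)
  rw [mean_const_mul] at h1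
  refine h1.trans ((mul_le_mul_of_nonneg_left h (Real.exp_pos _).le).trans ?_)
  rw [mul_left_comm, ← Real.exp_add]
  refine mul_le_mul_of_nonneg_left (Real.exp_le_exp.2 ?_) (by positivity)
  have h2 : D.V = ∑ i ∈ Finset.range j, D.v i + ∑ i ∈ Finset.Ico j D.r, D.v i :=
    (Finset.sum_range_add_sum_Ico _ hj).symm
  have h3 := mul_le_mul_of_nonneg_left hq (by positivity : 0 ≤ 2 * x ^ 2)
  rw [h2]
  nlinarith

end ScaleData

/-! ### Concentration of the total mass -/

namespace ScaleData

variable {D : ScaleData}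

/-- If the thresholds `d i` of the blocks decrease, then the blocks which are not decorrelated at
the distance `t` are the first `j` ones. -/
lemma exists_first_le {d : ℕ → ℝ} (hd : ∀ i, d (i + 1) ≤ d i) (r : ℕ) (t : ℝ) :
    ∃ j ≤ r, (∀ i, j ≤ i → i < r → d i ≤ t) ∧ (j = 0 ∨ ∃ k, j = k + 1 ∧ t < d k) := by
  classical
  have hex : ∃ j, r ≤ j ∨ d j ≤ t := ⟨r, Or.inl le_rfl⟩
  refine ⟨Nat.find hex, Nat.find_min' hex (Or.inl le_rfl), fun i hji hir => ?_, ?_⟩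
  · rcases Nat.find_spec hex with h | h
    · omega
    · exact (antitone_nat_of_succ_le hd hji).trans h
  · rcases Nat.eq_zero_or_eq_succ_pred (Nat.find hex) with h | h
    · exact Or.inl h
    · refine Or.inr ⟨_, h, ?_⟩
      have := Nat.find_min hex (m := (Nat.find hex).pred) (by omega)
      push Not at this
      exact this.2

/-- With probability close to one, the integral of the truncated density over `[-L, L]` exceeds
`L exp (x ^ 2 V)`, about half its mean. The number `d i` is the distance from which on the block `i`
is decorrelated. -/
lemma eventually_measure_integral_phi_le {x η C υ ε : ℝ} (hx : 0 < x) (hη : 0 < η) (hC : 0 < C)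
    (hυ : υ < 1) (hε : 0 < ε) (hε1 : ε ≤ 1) (r : ℕ) :
    ∃ w : ℝ, 0 < w ∧ ∃ q : ℝ, 0 < q ∧ ∀ᶠ T : ℝ in atTop, ∀ D : ScaleData, D.Regular υ C w T →
      D.r = r → ∀ (L : ℝ) (d : ℕ → ℝ), 0 < L → (∀ i, 0 ≤ d i) → (∀ i, d (i + 1) ≤ d i) →
      (∀ i < r, ∀ t, d i ≤ |t| → |t| ≤ 2 * L →
        ∑ p ∈ D.primes, D.b i p ^ 2 * Real.cos (t * Real.log p) ≤ q) →
      ∑ j ∈ Finset.range r, Real.exp (x ^ 2 * ∑ i ∈ Finset.range (j + 1), D.v i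
        + 2 * x * ((j + 1) * (η * Real.log (Real.log T)))) * d j ≤ ε * L →
      (uniformLaw T).real {t | ∫ h in (-L)..L, D.phi x η (Real.log (Real.log T)) (t + h)
        ≤ L * Real.exp (x ^ 2 * D.V)} ≤ 20 * ε := by
  obtain ⟨w₀, hw₀, h₀⟩ := eventually_le_mean_phi hx.le hη hC hυ hε r
  have hw : 0 < min w₀ (1 / (4 * x)) := by positivity
  have hw4 : 4 * x * min w₀ (1 / (4 * x)) ≤ 1 := by
    have := (le_div_iff₀ (by positivity)).1 (min_le_right w₀ (1 / (4 * x)))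
    linarith
  refine ⟨min w₀ (1 / (4 * x)), hw, ε / (8 * x ^ 2 * (r + 1)), by positivity, ?_⟩
  filter_upwards [h₀ _ (min_le_left _ _),
    eventually_mean_phi_mul_phi_le (η := η) (C := C) (ε := ε / 4) hx hυ (by positivity) hw4 r,
    eventually_gt_atTop 0] with T hT1 hT2 hT0 D hD hr L d hL hd0 hd hdec hsum
  set n := Real.log (Real.log T) with hndef
  refine second_moment (M := Real.exp (x ^ 2 * D.V)) hT0 hL (Real.exp_pos _) hε.le hε1
    (measurable_phi x η n) (phi_nonneg x η n) (fun u => phi_le hx.le u)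
    (fun h _ _ => hT1 D hD hr _) (fun j => (Real.exp_pos _).le) hd0 ?_ hsum
  intro h h' hh1 hh2 hh1' hh2'
  have ht : |h' - h| ≤ 2 * L := abs_le.2 ⟨by linarith, by linarith⟩
  obtain ⟨j, hjr, hj1, hj2⟩ := exists_first_le hd r |h' - h|
  have hq : ∑ i ∈ Finset.Ico j r, ∑ p ∈ D.primes, D.b i p ^ 2 * Real.cos ((h' - h) * Real.log p)
      ≤ r * (ε / (8 * x ^ 2 * (r + 1))) := by
    calc _ ≤ ∑ _i ∈ Finset.Ico j r, ε / (8 * x ^ 2 * (r + 1)) :=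
          Finset.sum_le_sum fun i hi => by
            obtain ⟨h1, h2⟩ := Finset.mem_Ico.1 hi
            exact hdec i h2 _ (hj1 i h1 h2) ht
      _ ≤ ∑ _i ∈ Finset.range r, ε / (8 * x ^ 2 * (r + 1)) :=
          Finset.sum_le_sum_of_subset_of_nonneg
            (fun i hi => Finset.mem_range.2 (Finset.mem_Ico.1 hi).2) fun _ _ _ => by positivity
      _ = _ := by simp
  have hmean := hT2 D hD hr j hjr (h' - h) _ hq (T + h)
  refine hmean.trans ?_
  -- the slack in the two-point bound, with the decorrelation error `q = ε / (8 x ^ 2 (r + 1))`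
  have hexp : (1 + ε / 4) * Real.exp (2 * x ^ 2 * (r * (ε / (8 * x ^ 2 * (r + 1))))) ≤ 1 + ε := by
    have h1 : 2 * x ^ 2 * (r * (ε / (8 * x ^ 2 * (r + 1)))) ≤ ε / 4 := by
      have : 2 * x ^ 2 * (r * (ε / (8 * x ^ 2 * (r + 1)))) = ε / 4 * (r / (r + 1)) := by
        field_simp; ring
      rw [this]
      have : (r : ℝ) / (r + 1) ≤ 1 := (div_le_one (by positivity)).2 (by linarith)
      nlinarith
    have h2 : Real.exp (ε / 4) * (1 - ε / 4) ≤ 1 := by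
      have := mul_le_mul_of_nonneg_left (Real.one_sub_le_exp_neg (ε / 4)) (Real.exp_pos (ε / 4)).le
      rwa [← Real.exp_add, add_neg_cancel, Real.exp_zero] at this
    have h3 := Real.exp_le_exp.2 h1
    have h4 := Real.exp_pos (ε / 4)
    have h5 : Real.exp (ε / 4) ≤ 1 + ε / 2 := by nlinarith
    calc _ ≤ (1 + ε / 4) * (1 + ε / 2) := by gcongr; linarith
      _ ≤ _ := by nlinarith
  have hsplit : (1 + ε / 4) * Real.exp (2 * x ^ 2 * D.V + x ^ 2 * ∑ i ∈ Finset.range j, D.v i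
        + 2 * x * (j * (η * n)) + 2 * x ^ 2 * (r * (ε / (8 * x ^ 2 * (r + 1)))))
      = Real.exp (x ^ 2 * D.V) ^ 2
        * ((1 + ε / 4) * Real.exp (2 * x ^ 2 * (r * (ε / (8 * x ^ 2 * (r + 1)))))
          * Real.exp (x ^ 2 * ∑ i ∈ Finset.range j, D.v i + 2 * x * (j * (η * n)))) := by
    rw [← Real.exp_nat_mul, mul_assoc (1 + ε / 4), ← Real.exp_add,
      mul_left_comm (Real.exp _) (1 + ε / 4), ← Real.exp_add]
    congr 2
    push_cast; ring
  rw [hsplit]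
  refine mul_le_mul_of_nonneg_left (mul_le_mul hexp ?_ (Real.exp_pos _).le (by positivity))
    (by positivity)
  have hterm : ∀ k ∈ Finset.range r, 0 ≤ Real.exp (x ^ 2 * ∑ i ∈ Finset.range (k + 1), D.v i
      + 2 * x * ((k + 1) * (η * n))) * (if |h' - h| ≤ d k then (1 : ℝ) else 0) := fun k _ =>
    mul_nonneg (Real.exp_pos _).le (by split_ifs <;> norm_num)
  rcases hj2 with rfl | ⟨k, rfl, hk⟩
  · have := Finset.sum_nonneg hterm
    simpa using this
  · have := Finset.single_le_sum hterm (Finset.mem_range.2 hjr)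
    rw [if_pos hk.le, mul_one] at this
    push_cast
    linarith

/-- At the good points the density is at most a constant and the field of interest is large. -/
lemma mul_integral_phi_le {x η n β : ℝ} (hx : 0 ≤ x) (hβ : 0 ≤ β) {L : ℝ} (hL : 0 ≤ L) (t : ℝ) :
    Real.exp (β * (x * D.cov - η * n) - (2 * x ^ 2 * D.V + 2 * x * (D.r * (η * n))))
      * ∫ h in (-L)..L, D.phi x η n (t + h)
      ≤ ∫ h in (-L)..L, Real.exp (β * (D.S (t + h)).re) := by
  rw [← intervalIntegral.integral_const_mul]
  refine intervalIntegral.integral_mono_on (by linarith) ?_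
    (Continuous.intervalIntegrable (by fun_prop) _ _) fun h _ => ?_
  · have := (intervalIntegrable_phi (D := D) x η n (t + -L) (t + L)).comp_add_left (c := t)
    simp only [add_sub_cancel_left] at this
    exact this.const_mul _
  · by_cases hg : D.Good x η n (t + h)
    · have h1 := phi_le (D := D) (η := η) (n := n) hx (t + h)
      calc _ ≤ Real.exp (β * (x * D.cov - η * n) - (2 * x ^ 2 * D.V + 2 * x * (D.r * (η * n))))
            * Real.exp (2 * x ^ 2 * D.V + 2 * x * (D.r * (η * n))) := by gcongr
        _ = Real.exp (β * (x * D.cov - η * n)) := by rw [← Real.exp_add]; congr 1; ring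
        _ ≤ _ := by
            apply Real.exp_le_exp.2
            exact mul_le_mul_of_nonneg_left hg.2.2 hβ
    · rw [phi, if_neg hg, mul_zero]
      positivity

/-- The lower bound for the integral of interest in terms of `cov` and `V`. -/
lemma eventually_measure_integral_exp_le {x η C υ ε β : ℝ} (hx : 0 < x) (hη : 0 < η) (hC : 0 < C)
    (hυ : υ < 1) (hε : 0 < ε) (hε1 : ε ≤ 1) (hβ : 0 < β) (r : ℕ) :
    ∃ w : ℝ, 0 < w ∧ ∃ q : ℝ, 0 < q ∧ ∀ᶠ T : ℝ in atTop, ∀ D : ScaleData, D.Regular υ C w T →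
      D.r = r → ∀ (L : ℝ) (d : ℕ → ℝ), 0 < L → (∀ i, 0 ≤ d i) → (∀ i, d (i + 1) ≤ d i) →
      (∀ i < r, ∀ t, d i ≤ |t| → |t| ≤ 2 * L →
        ∑ p ∈ D.primes, D.b i p ^ 2 * Real.cos (t * Real.log p) ≤ q) →
      ∑ j ∈ Finset.range r, Real.exp (x ^ 2 * ∑ i ∈ Finset.range (j + 1), D.v i
        + 2 * x * ((j + 1) * (η * Real.log (Real.log T)))) * d j ≤ ε * L →
      (uniformLaw T).real {t | ∫ h in (-L)..L, Real.exp (β * (D.S (t + h)).re)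
        ≤ L * Real.exp (β * x * D.cov - x ^ 2 * D.V
          - (β + 2 * x * r) * (η * Real.log (Real.log T)))} ≤ 20 * ε := by
  obtain ⟨w, hw, q, hq, h⟩ := eventually_measure_integral_phi_le hx hη hC hυ hε hε1 r
  refine ⟨w, hw, q, hq, ?_⟩
  filter_upwards [h, eventually_gt_atTop 0] with T hT hT0 D hD hr L d hL hd0 hd hdec hsum
  refine le_trans ?_ (hT D hD hr L d hL hd0 hd hdec hsum)
  have := isProbabilityMeasure_uniformLaw hT0
  refine measureReal_mono fun t ht => ?_
  set n := Real.log (Real.log T) with hndef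
  have h1 := (mul_integral_phi_le (η := η) (n := n) hx.le hβ.le hL.le t).trans ht
  refine le_of_mul_le_mul_left (h1.trans (le_of_eq ?_)) (Real.exp_pos _)
  rw [mul_left_comm (Real.exp _) L, ← Real.exp_add, hr]
  congr 2
  ring

end ScaleData

/-! ### The field attached to the primes -/

lemma rpow_neg_prime_eq (p : ℕ) (hp : p.Prime) (σ t h : ℝ) :
    1 / (p : ℂ) ^ ((σ : ℂ) + Complex.I * (t : ℂ) + Complex.I * (h : ℂ))
      = (((p : ℝ) ^ (-σ) : ℝ) : ℂ)
        * Complex.exp (-(Complex.I * (((t + h) * Real.log p : ℝ) : ℂ))) := by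
  have hp0 : (p : ℂ) ≠ 0 := by exact_mod_cast hp.ne_zero
  have hp1 : (0 : ℝ) < p := by exact_mod_cast hp.pos
  rw [one_div, ← Complex.cpow_neg, Complex.cpow_def_of_ne_zero hp0, ← Complex.natCast_log,
    Real.rpow_def_of_pos hp1, Complex.ofReal_exp, ← Complex.exp_add]
  congr 1
  push_cast
  ring

/-- The blocks of primes `J_1, …, J_m` together are the window
`(log T) ^ (1 / K) < log p ≤ (log T) ^ ((m + 1) / K)`. -/
lemma sum_primeBlock_eq {K : ℕ} (hK : 0 < K) {T : ℝ} (hT : 1 ≤ Real.log T) (g : ℕ → ℂ) (m : ℕ) :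
    ∑ j ∈ Finset.Icc 1 m, ∑ p ∈ primeBlock K T j, g p
      = ∑ p ∈ primesIn (Real.log T ^ (1 / (K : ℝ))) (Real.log T ^ (((m : ℝ) + 1) / K)), g p := by
  have hK' : (0 : ℝ) < K := by exact_mod_cast hK
  induction m with
  | zero =>
    rw [Finset.Icc_eq_empty (by norm_num), Finset.sum_empty, Finset.sum_eq_zero]
    intro p hp
    rw [mem_primesIn] at hp
    simp only [Nat.cast_zero, zero_add] at hp
    linarith [hp.2.1, hp.2.2]
  | succ m ih =>
    rw [Finset.sum_Icc_succ_top (by omega), ih, ← Finset.sum_union]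
    · refine Finset.sum_congr (Finset.ext fun p => ?_) fun _ _ => rfl
      rw [Finset.mem_union, mem_primesIn, mem_primesIn, mem_primeBlock]
      have h1 : Real.log T ^ (1 / (K : ℝ)) ≤ Real.log T ^ (((m : ℝ) + 1) / K) :=
        Real.rpow_le_rpow_of_exponent_le hT (by gcongr; linarith [(Nat.cast_nonneg m : (0:ℝ) ≤ m)])
      have h2 : Real.log T ^ (((m : ℝ) + 1) / K) ≤ Real.log T ^ ((((m + 1 : ℕ) : ℝ) + 1) / K) :=
        Real.rpow_le_rpow_of_exponent_le hT (by gcongr; linarith)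
      unfold blockEnd
      by_cases hp : p.Prime
      · have hp0 : (0 : ℝ) < p := by exact_mod_cast hp.pos
        rw [← Real.lt_log_iff_exp_lt hp0, ← Real.log_le_iff_le_exp hp0]
        push_cast at h2 ⊢
        constructor
        · rintro (⟨-, h3, h4⟩ | ⟨-, h3, h4⟩)
          · exact ⟨hp, h3, h4.trans h2⟩
          · exact ⟨hp, h1.trans_lt h3, h4⟩
        · rintro ⟨-, h3, h4⟩
          rcases le_or_gt (Real.log p) (Real.log T ^ (((m : ℝ) + 1) / K)) with h5 | h5
          · exact Or.inl ⟨hp, h3, h5⟩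
          · exact Or.inr ⟨hp, h5, h4⟩
      · simp [hp]
    · refine Finset.disjoint_left.2 fun p hp hp' => ?_
      rw [mem_primesIn] at hp
      rw [mem_primeBlock, blockEnd] at hp'
      have hp0 : (0 : ℝ) < p := by exact_mod_cast hp.1.pos
      have := (Real.lt_log_iff_exp_lt hp0).2 hp'.2.1
      have := hp.2.2
      push_cast at *
      linarith

/-- The multiscale field attached to `∑ j, P_j`: the block `i` has smooth weights on the window
`(log T) ^ (a + i ω) < log p ≤ (log T) ^ (a + (i + 1) ω)`. -/
def fieldData (K r : ℕ) (a ω η T : ℝ) : ScaleData where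
  primes := primesIn (Real.log T ^ (1 / (K : ℝ))) (Real.log T ^ (((K : ℝ) - 2) / K))
  r := r
  b i p := if p ∈ primesIn (Real.log T ^ (a + i * ω)) (Real.log T ^ (a + (i + 1) * ω)) then
    √(windowWeight (a + i * ω) (a + (i + 1) * ω) η (Real.log T) p) else 0
  c p := (p : ℝ) ^ (-sigma0 K T)

lemma sum_P_eq {K : ℕ} (hK : 3 ≤ K) {T : ℝ} (hT : 1 ≤ Real.log T) (r : ℕ) (a ω η t h : ℝ) :
    ∑ j ∈ Finset.Icc 1 (K - 3), P K T j t h = ((fieldData K r a ω η T).S (t + h)).re := by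
  unfold P
  rw [← Complex.re_sum, sum_primeBlock_eq (by omega) hT]
  have hcast : ((K - 3 : ℕ) : ℝ) + 1 = (K : ℝ) - 2 := by
    rw [Nat.cast_sub hK]; push_cast; ring
  rw [hcast]
  congr 1
  refine Finset.sum_congr rfl fun p hp => ?_
  exact rpow_neg_prime_eq p (mem_primesIn.1 hp).1 _ _ _

section FieldData

variable {K r : ℕ} {a ω η T : ℝ}

lemma half_le_sigma0 (hT : 0 ≤ Real.log T) : 1 / 2 ≤ sigma0 K T := by
  unfold sigma0
  have : 0 ≤ Real.log T ^ (3 / (2 * (K : ℝ))) / Real.log T := by positivity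
  linarith

lemma mem_fieldData_primes {p : ℕ} : p ∈ (fieldData K r a ω η T).primes ↔ p.Prime ∧
    Real.log T ^ (1 / (K : ℝ)) < Real.log p ∧ Real.log p ≤ Real.log T ^ (((K : ℝ) - 2) / K) :=
  mem_primesIn

lemma windowWeight_nonneg {s s' A : ℝ} (hA : 1 ≤ A) (h : s + 2 * η ≤ s') {p : ℕ} (hp : 1 ≤ p) :
    0 ≤ windowWeight s s' η A p :=
  smoothWeight_nonneg (Real.rpow_le_rpow_of_exponent_le hA (by linarith)) hp

lemma fieldData_b_le (hT : 1 ≤ Real.log T) (i p : ℕ) :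
    (fieldData K r a ω η T).b i p ≤ (p : ℝ) ^ (-(1 / 2) : ℝ) := by
  simp only [fieldData]
  split_ifs with h
  · have hp := (mem_primesIn.1 h).1.one_lt.le
    have hp0 : (0 : ℝ) < p := by exact_mod_cast hp
    apply Real.sqrt_le_iff.2 ⟨by positivity, ?_⟩
    rw [← Real.rpow_natCast, ← Real.rpow_mul hp0.le]
    norm_num
    rw [Real.rpow_neg_one]
    exact smoothWeight_le_inv (by positivity) hp
  · positivity

lemma fieldData_b_mul (hT : 1 ≤ Real.log T) (hω : 0 ≤ ω) (i j p : ℕ) (hij : i ≠ j) :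
    (fieldData K r a ω η T).b i p * (fieldData K r a ω η T).b j p = 0 := by
  wlog h : i < j generalizing i j
  · rw [mul_comm]
    exact this j i hij.symm (by omega)
  simp only [fieldData]
  split_ifs with h1 h2
  · exfalso
    have h3 := (mem_primesIn.1 h1).2.2
    have h4 := (mem_primesIn.1 h2).2.1
    have h5 : Real.log T ^ (a + (i + 1) * ω) ≤ Real.log T ^ (a + j * ω) := by
      apply Real.rpow_le_rpow_of_exponent_le hT
      have : (i : ℝ) + 1 ≤ j := by exact_mod_cast h
      gcongr
    linarith
  all_goals simp

lemma fieldData_b_nonneg (i p : ℕ) : 0 ≤ (fieldData K r a ω η T).b i p := by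
  simp only [fieldData]
  split_ifs <;> positivity

lemma fieldData_tot_nonneg (p : ℕ) : 0 ≤ (fieldData K r a ω η T).tot p :=
  Finset.sum_nonneg fun i _ => fieldData_b_nonneg i p

lemma fieldData_tot_le (hT : 1 ≤ Real.log T) (hω : 0 ≤ ω) (p : ℕ) :
    (fieldData K r a ω η T).tot p ≤ (p : ℝ) ^ (-(1 / 2) : ℝ) := by
  by_cases h : ∃ i ∈ Finset.range r, (fieldData K r a ω η T).b i p ≠ 0
  · obtain ⟨i, hi, hne⟩ := h
    have : (fieldData K r a ω η T).tot p = (fieldData K r a ω η T).b i p := by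
      unfold ScaleData.tot
      refine Finset.sum_eq_single_of_mem i hi fun j _ hj => ?_
      exact (mul_eq_zero.1 (fieldData_b_mul hT hω j i p hj)).resolve_right hne
    rw [this]
    exact fieldData_b_le hT i p
  · push Not at h
    have : (fieldData K r a ω η T).tot p = 0 := Finset.sum_eq_zero h
    rw [this]
    positivity

lemma rpow_neg_half_sq {p : ℕ} (hp : p.Prime) : ((p : ℝ) ^ (-(1 / 2) : ℝ)) ^ 2 = (p : ℝ)⁻¹ := by
  have hp0 : (0 : ℝ) < p := by exact_mod_cast hp.pos
  rw [← Real.rpow_natCast, ← Real.rpow_mul hp0.le, ← Real.rpow_neg_one]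
  norm_num

lemma sum_inv_fieldData_le (hT : 1 ≤ Real.log T) (hK : 3 ≤ K) :
    ∑ p ∈ (fieldData K r a ω η T).primes, (p : ℝ)⁻¹ ≤ 3 * (2 + Real.log (Real.log T)) := by
  refine le_trans (Finset.sum_le_sum_of_subset_of_nonneg (fun p hp => ?_) fun _ _ _ => by
    positivity) (sum_inv_primesIn_le (lo := Real.log T ^ (1 / (K : ℝ))) hT)
  rw [mem_fieldData_primes] at hp
  rw [mem_primesIn]
  refine ⟨hp.1, hp.2.1, hp.2.2.trans ?_⟩
  calc Real.log T ^ (((K : ℝ) - 2) / K) ≤ Real.log T ^ (1 : ℝ) := by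
        apply Real.rpow_le_rpow_of_exponent_le hT
        have : (0 : ℝ) < K := by positivity
        rw [div_le_one this]; linarith
    _ = Real.log T := Real.rpow_one _

lemma rpow_neg_half_le {p : ℕ} (hp : p ∈ (fieldData K r a ω η T).primes) :
    (p : ℝ) ^ (-(1 / 2) : ℝ) ≤ Real.exp (-(Real.log T ^ (1 / (K : ℝ)) / 2)) := by
  rw [mem_fieldData_primes] at hp
  have hp0 : (0 : ℝ) < p := by exact_mod_cast hp.1.pos
  rw [Real.rpow_def_of_pos hp0]
  apply Real.exp_le_exp.2
  linarith [hp.2.1]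

/-- The coefficients of the multiscale field satisfy the hypotheses of the second moment
method. -/
lemma eventually_regular_fieldData (hK : 3 ≤ K) (hω : 0 ≤ ω) {w : ℝ} (hw : 0 < w) (r : ℕ)
    (a η : ℝ) :
    ∀ᶠ T : ℝ in atTop, (fieldData K r a ω η T).Regular (((K : ℝ) - 2) / K) 4 w T := by
  have hK0 : (0 : ℝ) < 1 / (K : ℝ) := by positivity
  have h1 : Tendsto (fun T : ℝ => Real.exp (-(Real.log T ^ (1 / (K : ℝ)) / 2))) atTop (𝓝 0) :=
    Real.tendsto_exp_neg_atTop_nhds_zero.comp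
      (((tendsto_rpow_atTop hK0).comp Real.tendsto_log_atTop).atTop_div_const two_pos)
  have h2 : ∀ᶠ A : ℝ in atTop, Real.exp (-A ^ (1 / (K : ℝ))) * (4 * Real.log A) ≤ w := by
    have h3 : Tendsto (fun y : ℝ => y * Real.exp (-y)) atTop (𝓝 0) := by
      simpa using Real.tendsto_pow_mul_exp_neg_atTop_nhds_zero 1
    have h4 : ∀ᶠ A : ℝ in atTop, A ^ (1 / (K : ℝ)) * Real.exp (-A ^ (1 / (K : ℝ))) ≤ w / (4 * K) :=
      (h3.comp (tendsto_rpow_atTop hK0)).eventually (eventually_le_nhds (by positivity))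
    filter_upwards [h4, eventually_gt_atTop 0] with A hA hA0
    have h5 : Real.log A ≤ K * A ^ (1 / (K : ℝ)) := by
      have := Real.log_le_rpow_div hA0.le hK0
      rw [div_div_eq_mul_div, div_one, mul_comm] at this
      exact this
    calc _ ≤ Real.exp (-A ^ (1 / (K : ℝ))) * (4 * (K * A ^ (1 / (K : ℝ)))) := by gcongr
      _ = 4 * K * (A ^ (1 / (K : ℝ)) * Real.exp (-A ^ (1 / (K : ℝ)))) := by ring
      _ ≤ 4 * K * (w / (4 * K)) := by gcongr
      _ = w := by field_simp
  filter_upwards [h1.eventually (eventually_le_nhds hw), Real.tendsto_log_atTop.eventually h2,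
    Real.tendsto_log_atTop.eventually_ge_atTop 1,
    (Real.tendsto_log_atTop.comp Real.tendsto_log_atTop).eventually_ge_atTop 6]
    with T hw1 hw2 hT hn
  simp only [Function.comp_apply] at hn
  have hsum : ∑ p ∈ (fieldData K r a ω η T).primes, (p : ℝ)⁻¹ ≤ 4 * Real.log (Real.log T) :=
    (sum_inv_fieldData_le hT hK).trans (by linarith)
  have hc : ∀ p ∈ (fieldData K r a ω η T).primes,
      (fieldData K r a ω η T).c p ≤ (p : ℝ) ^ (-(1 / 2) : ℝ) := fun p hp => by
    have hp1 := (mem_fieldData_primes.1 hp).1.one_lt.le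
    refine Real.rpow_le_rpow_of_exponent_le (by exact_mod_cast hp1) ?_
    have := half_le_sigma0 (K := K) (T := T) (by linarith)
    linarith
  have hc0 : ∀ p, 0 ≤ (fieldData K r a ω η T).c p := fun p => by
    simp only [fieldData]; positivity
  have htot2 : ∀ p ∈ (fieldData K r a ω η T).primes,
      (fieldData K r a ω η T).tot p ^ 2 ≤ (p : ℝ)⁻¹ := fun p hp => by
    rw [← rpow_neg_half_sq (mem_fieldData_primes.1 hp).1]
    exact pow_le_pow_left₀ (fieldData_tot_nonneg p) (fieldData_tot_le hT hω p) 2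
  refine ⟨fun p hp => (mem_fieldData_primes.1 hp).1, fun p hp => ?_, fieldData_b_nonneg,
    fieldData_b_mul hT hω, hc0, fun p hp => ?_, fun p hp => ?_, ?_, ?_, ?_⟩
  · have hp0 : (0 : ℝ) < p := by exact_mod_cast (mem_fieldData_primes.1 hp).1.pos
    exact (Real.log_le_iff_le_exp hp0).1 (mem_fieldData_primes.1 hp).2.2
  · exact (fieldData_tot_le hT hω p).trans ((rpow_neg_half_le hp).trans hw1)
  · exact (hc p hp).trans ((rpow_neg_half_le hp).trans hw1)
  · rw [← ScaleData.sum_tot_sq (fieldData_b_mul hT hω)]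
    exact (Finset.sum_le_sum htot2).trans hsum
  · refine (Finset.sum_le_sum fun p hp => ?_).trans hsum
    rw [← rpow_neg_half_sq (mem_fieldData_primes.1 hp).1]
    exact pow_le_pow_left₀ (hc0 p) (hc p hp) 2
  · refine le_trans ?_ hw2
    calc _ ≤ ∑ p ∈ (fieldData K r a ω η T).primes,
          Real.exp (-Real.log T ^ (1 / (K : ℝ))) * (p : ℝ)⁻¹ := by
          refine Finset.sum_le_sum fun p hp => ?_
          have h3 : (p : ℝ)⁻¹ ≤ Real.exp (-Real.log T ^ (1 / (K : ℝ))) := by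
            rw [← rpow_neg_half_sq (mem_fieldData_primes.1 hp).1]
            refine (pow_le_pow_left₀ (by positivity) (rpow_neg_half_le hp) 2).trans (le_of_eq ?_)
            rw [← Real.exp_nat_mul]
            congr 1
            push_cast; ring
          calc (fieldData K r a ω η T).tot p ^ 4
              = (fieldData K r a ω η T).tot p ^ 2 * (fieldData K r a ω η T).tot p ^ 2 := by ring
            _ ≤ Real.exp (-Real.log T ^ (1 / (K : ℝ))) * (p : ℝ)⁻¹ :=
              mul_le_mul ((htot2 p hp).trans h3) (htot2 p hp) (sq_nonneg _) (Real.exp_pos _).le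
      _ ≤ _ := by
          rw [← Finset.mul_sum]
          gcongr

/-- Sums over a block are weighted sums over a window of primes. -/
lemma sum_fieldData_b_sq_mul (hT : 1 ≤ Real.log T) (hη : 2 * η ≤ ω) (hω : 0 ≤ ω)
    (ha : 1 / (K : ℝ) ≤ a) (hr : a + r * ω ≤ ((K : ℝ) - 2) / K) {i : ℕ} (hi : i < r) (g : ℕ → ℝ) :
    ∑ p ∈ (fieldData K r a ω η T).primes, (fieldData K r a ω η T).b i p ^ 2 * g p
      = ∑ p ∈ primesIn (Real.log T ^ (a + i * ω)) (Real.log T ^ (a + (i + 1) * ω)),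
        windowWeight (a + i * ω) (a + (i + 1) * ω) η (Real.log T) p * g p := by
  symm
  have h1 : ∀ p ∈ primesIn (Real.log T ^ (a + i * ω)) (Real.log T ^ (a + (i + 1) * ω)),
      windowWeight (a + i * ω) (a + (i + 1) * ω) η (Real.log T) p * g p
        = (fieldData K r a ω η T).b i p ^ 2 * g p := by
    intro p hp
    simp only [fieldData]
    rw [if_pos hp, Real.sq_sqrt]
    exact windowWeight_nonneg hT (by linarith) (mem_primesIn.1 hp).1.one_lt.le
  rw [Finset.sum_congr rfl h1]
  refine Finset.sum_subset (fun p hp => ?_) fun p _ hp => ?_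
  · rw [mem_primesIn] at hp
    rw [mem_fieldData_primes]
    have hir : (i : ℝ) + 1 ≤ r := by exact_mod_cast hi
    refine ⟨hp.1, lt_of_le_of_lt ?_ hp.2.1, hp.2.2.trans ?_⟩
    · apply Real.rpow_le_rpow_of_exponent_le hT
      have : 0 ≤ (i : ℝ) * ω := by positivity
      linarith
    · apply Real.rpow_le_rpow_of_exponent_le hT
      have : ((i : ℝ) + 1) * ω ≤ r * ω := by gcongr
      linarith
  · simp [fieldData, hp]

lemma eventually_abs_fieldData_v_sub_le (hη0 : 0 < η) (hη : 2 * η ≤ ω)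
    (ha0 : 0 < a) (ha : 1 / (K : ℝ) ≤ a) (hr : a + r * ω ≤ ((K : ℝ) - 2) / K) :
    ∀ᶠ T : ℝ in atTop, ∀ i < r,
      |(fieldData K r a ω η T).v i - (ω - 2 * η) * Real.log (Real.log T)| ≤ 1 := by
  have hω : 0 ≤ ω := by linarith
  have h : ∀ᶠ A : ℝ in atTop, ∀ i ∈ Finset.range r,
      |∑ p ∈ primesIn (A ^ (a + i * ω)) (A ^ (a + (i + 1) * ω)),
          windowWeight (a + i * ω) (a + (i + 1) * ω) η A p
        - ((a + (i + 1) * ω) - (a + i * ω) - 2 * η) * Real.log A| ≤ 1 :=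
    (Finset.eventually_all _).2 fun i _ => eventually_abs_sum_windowWeight_le (by positivity) hη0
      (by linarith) one_pos
  filter_upwards [Real.tendsto_log_atTop.eventually h,
    Real.tendsto_log_atTop.eventually_ge_atTop 1] with T hT hT1 i hi
  have h1 := hT i (Finset.mem_range.2 hi)
  have h2 := sum_fieldData_b_sq_mul hT1 hη hω ha hr hi (fun _ => 1)
  simp only [mul_one] at h2
  unfold ScaleData.v
  rw [h2]
  refine le_trans (le_of_eq ?_) h1
  ring_nf

lemma eventually_sum_fieldData_cos_le (hη0 : 0 < η) (hη : 2 * η ≤ ω)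
    (ha0 : 0 < a) (ha : 1 / (K : ℝ) ≤ a) (hr : a + r * ω ≤ ((K : ℝ) - 2) / K) (θ : ℝ) {q : ℝ}
    (hq : 0 < q) :
    ∀ᶠ T : ℝ in atTop, ∀ i < r, ∀ t : ℝ, Real.log T ^ (-(a + i * ω)) ≤ |t| →
      |t| ≤ 2 * Real.log T ^ θ → ∑ p ∈ (fieldData K r a ω η T).primes,
        (fieldData K r a ω η T).b i p ^ 2 * Real.cos (t * Real.log p) ≤ q := by
  have hω : 0 ≤ ω := by linarith
  have h : ∀ᶠ A : ℝ in atTop, ∀ i ∈ Finset.range r, ∀ t : ℝ, A ^ (-(a + i * ω)) ≤ |t| →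
      |t| ≤ A ^ (|θ| + 1) → ∑ p ∈ primesIn (A ^ (a + i * ω)) (A ^ (a + (i + 1) * ω)),
          windowWeight (a + i * ω) (a + (i + 1) * ω) η A p * Real.cos (t * Real.log p) ≤ q :=
    (Finset.eventually_all _).2 fun i _ => eventually_sum_windowWeight_cos_le (by positivity)
      (by positivity) hη0 (by linarith) hq
  filter_upwards [Real.tendsto_log_atTop.eventually h,
    Real.tendsto_log_atTop.eventually_ge_atTop 2] with T hT hT1 i hi t ht1 ht2
  rw [sum_fieldData_b_sq_mul (by linarith) hη hω ha hr hi]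
  refine hT i (Finset.mem_range.2 hi) t ht1 (ht2.trans ?_)
  rw [Real.rpow_add_one (by linarith), mul_comm]
  gcongr
  · linarith
  · exact le_abs_self θ

/-- The field of interest is almost as correlated with the blocks as the blocks are with
themselves: `p ^ (σ₀ - 1 / 2)` is close to one for the primes in the window. -/
lemma eventually_le_fieldData_cov (hK : 3 ≤ K) (hω : 0 ≤ ω) {ε : ℝ} (hε : 0 < ε) (r : ℕ)
    (a η : ℝ) :
    ∀ᶠ T : ℝ in atTop, (1 - ε) * (fieldData K r a ω η T).V ≤ (fieldData K r a ω η T).cov := by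
  have hK0 : (0 : ℝ) < 1 / (2 * (K : ℝ)) := by positivity
  filter_upwards [Real.tendsto_log_atTop.eventually (eventually_rpow_neg_le hK0 hε),
    Real.tendsto_log_atTop.eventually_ge_atTop 1] with T hT hT1
  have hT0 : 0 < Real.log T := by linarith
  rw [← ScaleData.sum_tot_sq (fieldData_b_mul hT1 hω), ScaleData.cov, Finset.mul_sum]
  refine Finset.sum_le_sum fun p hp => ?_
  obtain ⟨hpp, -, hp2⟩ := mem_fieldData_primes.1 hp
  have hp0 : (0 : ℝ) < p := by exact_mod_cast hpp.pos
  have h0 := fieldData_tot_nonneg (K := K) (r := r) (a := a) (ω := ω) (η := η) (T := T) p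
  have h1 : (1 - ε) * (p : ℝ) ^ (-(1 / 2) : ℝ) ≤ (fieldData K r a ω η T).c p := by
    have h2 : Real.log T ^ (3 / (2 * (K : ℝ))) / Real.log T * Real.log p ≤ ε := by
      calc _ ≤ Real.log T ^ (3 / (2 * (K : ℝ))) / Real.log T
            * Real.log T ^ (((K : ℝ) - 2) / K) := by gcongr
        _ = Real.log T ^ (-(1 / (2 * (K : ℝ)))) := by
            rw [← Real.rpow_sub_one hT0.ne', ← Real.rpow_add hT0]
            congr 1
            have : (K : ℝ) ≠ 0 := by positivity
            field_simp
            ring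
        _ ≤ ε := hT
    have h3 : (fieldData K r a ω η T).c p = Real.exp
        (-(Real.log T ^ (3 / (2 * (K : ℝ))) / Real.log T * Real.log p))
          * (p : ℝ) ^ (-(1 / 2) : ℝ) := by
      simp only [fieldData, sigma0]
      rw [Real.rpow_def_of_pos hp0, Real.rpow_def_of_pos hp0, ← Real.exp_add]
      congr 1
      ring
    rw [h3]
    gcongr
    have := Real.one_sub_le_exp_neg (Real.log T ^ (3 / (2 * (K : ℝ))) / Real.log T * Real.log p)
    linarith
  rcases le_or_gt (1 - ε) 0 with h | h
  · have h4 : 0 ≤ (fieldData K r a ω η T).c p := by simp only [fieldData]; positivity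
    have h5 : (1 - ε) * (fieldData K r a ω η T).tot p ^ 2 ≤ 0 :=
      mul_nonpos_of_nonpos_of_nonneg h (sq_nonneg _)
    have := mul_nonneg h0 h4
    linarith
  · calc (1 - ε) * (fieldData K r a ω η T).tot p ^ 2
        = (fieldData K r a ω η T).tot p * ((1 - ε) * (fieldData K r a ω η T).tot p) := by ring
      _ ≤ (fieldData K r a ω η T).tot p * ((1 - ε) * (p : ℝ) ^ (-(1 / 2) : ℝ)) := by
          have := fieldData_tot_le (K := K) (r := r) (a := a) (η := η) hT1 hω p
          gcongr
      _ ≤ _ := by gcongr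

end FieldData

/-! ### The free energy and the choice of the scales -/

/-- The optimal tilt `x`: the points where the field is about `x (1 + min θ 0) log log T` carry the
integral. -/
lemma exists_tilt {θ β : ℝ} (hβ : 0 < β) :
    ∃ x : ℝ, 0 < x ∧ 2 * x ≤ β ∧ x ^ 2 ≤ 1 + max θ 0 ∧
      freeEnergy θ β = θ + (β * x - x ^ 2) * (1 + min θ 0) := by
  rcases le_or_gt θ 0 with h | h
  · rw [max_eq_right h, min_eq_left h]
    rcases le_or_gt β 2 with hb | hb
    · refine ⟨β / 2, by positivity, by linarith, by nlinarith, ?_⟩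
      simp only [freeEnergy, betaC, if_pos h, if_pos hb]
      ring
    · refine ⟨1, one_pos, by linarith, by norm_num, ?_⟩
      simp only [freeEnergy, betaC, m, if_pos h, if_neg (not_le.2 hb)]
      ring
  · rw [max_eq_left h.le, min_eq_right h.le]
    have hs := Real.sq_sqrt (show 0 ≤ 1 + θ by linarith)
    have hs0 : 0 < √(1 + θ) := Real.sqrt_pos.2 (by linarith)
    rcases le_or_gt β (2 * √(1 + θ)) with hb | hb
    · refine ⟨β / 2, by positivity, by linarith, by nlinarith, ?_⟩
      simp only [freeEnergy, betaC, if_neg (not_le.2 h), if_pos hb]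
      ring
    · refine ⟨√(1 + θ), hs0, by linarith, hs.le, ?_⟩
      simp only [freeEnergy, betaC, m, if_neg (not_le.2 h), if_neg (not_le.2 hb)]
      linear_combination hs

/-- The contribution of the close pairs is negligible: this is where the bound
`x ^ 2 ≤ 1 + max θ 0` on the tilt enters. The first scale is `-min θ 0 + 2 ω`, slightly beyond the
scale `-min θ 0` below which the field is constant on the interval. -/
lemma sum_exp_mul_rpow_le {x ω η θ A : ℝ} {r : ℕ} {v : ℕ → ℝ} (hx : 0 ≤ x) (hω : 0 ≤ ω)
    (hη : 0 ≤ η) (hA : 1 ≤ A) (hv : ∀ i < r, v i ≤ ω * Real.log A + 1)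
    (hxθ : x ^ 2 ≤ 1 + max θ 0) (hrω : r * ω ≤ 1) (hrη : 2 * x * (r * η) ≤ ω / 2) :
    ∑ j ∈ Finset.range r, Real.exp (x ^ 2 * ∑ i ∈ Finset.range (j + 1), v i
        + 2 * x * ((j + 1) * (η * Real.log A))) * A ^ (-(-min θ 0 + 2 * ω + j * ω))
      ≤ r * Real.exp (r * x ^ 2) * A ^ (-(ω / 2)) * A ^ θ := by
  have hA0 : 0 < A := by linarith
  have hn : 0 ≤ Real.log A := Real.log_nonneg hA
  have key : ∀ j ∈ Finset.range r, Real.exp (x ^ 2 * ∑ i ∈ Finset.range (j + 1), v i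
        + 2 * x * ((j + 1) * (η * Real.log A))) * A ^ (-(-min θ 0 + 2 * ω + j * ω))
      ≤ Real.exp (r * x ^ 2) * A ^ (-(ω / 2)) * A ^ θ := by
    intro j hj
    have hjr : (j : ℝ) + 1 ≤ r := by exact_mod_cast Finset.mem_range.1 hj
    rw [Real.rpow_def_of_pos hA0, Real.rpow_def_of_pos hA0, Real.rpow_def_of_pos hA0,
      ← Real.exp_add, ← Real.exp_add, ← Real.exp_add]
    apply Real.exp_le_exp.2
    set n := Real.log A with hndef
    have h1 : ∑ i ∈ Finset.range (j + 1), v i ≤ ((j : ℝ) + 1) * (ω * n + 1) := by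
      calc _ ≤ ∑ _i ∈ Finset.range (j + 1), (ω * n + 1) := Finset.sum_le_sum fun i hi =>
            hv i (lt_of_lt_of_le (Finset.mem_range.1 hi) (Finset.mem_range.1 hj))
        _ = _ := by rw [Finset.sum_const, Finset.card_range, nsmul_eq_mul]; push_cast; rfl
    have h2 : x ^ 2 * ∑ i ∈ Finset.range (j + 1), v i
        ≤ (((j : ℝ) + 1) * ω + max θ 0) * n + r * x ^ 2 := by
      have h3 := mul_le_mul_of_nonneg_left h1 (sq_nonneg x)
      have h4 : x ^ 2 * ((j : ℝ) + 1) ≤ x ^ 2 * r := by gcongr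
      have h5 : ((j : ℝ) + 1) * ω ≤ 1 := le_trans (by gcongr) hrω
      have h6 : x ^ 2 * (((j : ℝ) + 1) * ω) ≤ ((j : ℝ) + 1) * ω + max θ 0 := by
        calc _ ≤ (1 + max θ 0) * (((j : ℝ) + 1) * ω) := by gcongr
          _ = ((j : ℝ) + 1) * ω + max θ 0 * (((j : ℝ) + 1) * ω) := by ring
          _ ≤ ((j : ℝ) + 1) * ω + max θ 0 * 1 := by gcongr
          _ = _ := by ring
      have h7 := mul_le_mul_of_nonneg_right h6 hn
      linarith
    have h3 : 2 * x * (((j : ℝ) + 1) * (η * n)) ≤ ω / 2 * n := by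
      calc _ ≤ 2 * x * ((r : ℝ) * (η * n)) := by gcongr
        _ = 2 * x * (r * η) * n := by ring
        _ ≤ _ := by gcongr
    have h4 : max θ 0 * n + min θ 0 * n = θ * n := by
      rw [← add_mul, add_comm, min_add_max, add_zero]
    linarith
  refine (Finset.sum_le_sum key).trans (le_of_eq ?_)
  simp
  ring

/-- The exponent in `ScaleData.eventually_measure_integral_exp_le` is at least that of the claim. -/
lemma freeEnergy_sub_le {θ β x ε ω η δ n V c : ℝ} {r : ℕ} (hβ : 0 < β) (hx : 0 < x)
    (hxβ : 2 * x ≤ β)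
    (hf : freeEnergy θ β = θ + (β * x - x ^ 2) * (1 + min θ 0)) (hn : 0 ≤ n)
    (hω0 : 0 ≤ ω) (hη0 : 0 ≤ η) (hδ0 : 0 ≤ δ) (hrω : r * ω = 1 + min θ 0 - 4 * ω)
    (hω : β * x * (4 * ω) ≤ ε / 6) (hη : (2 * β * x * r + β + 2 * x * r) * η ≤ ε / 6)
    (hδ : β * x * δ ≤ ε / 6) (hδ1 : δ ≤ 1 / 2) (hc : (1 - δ) * V ≤ c)
    (hV : r * ((ω - 2 * η) * n - 1) ≤ V) (hlarge : β * x * r ≤ ε / 2 * n) :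
    (freeEnergy θ β - ε) * n
      ≤ θ * n + (β * x * c - x ^ 2 * V - (β + 2 * x * r) * (η * n)) := by
  have hβx : 0 < β * x := by positivity
  set k := β * x * (1 - δ) - x ^ 2 with hk
  have hk0 : 0 ≤ k := by
    have h1 : β * x * (1 / 2) ≤ β * x * (1 - δ) := by gcongr; linarith
    nlinarith
  have hkle : k ≤ β * x := by
    have : 0 ≤ β * x * δ := by positivity
    nlinarith [sq_nonneg x]
  have h1 : k * V ≤ β * x * c - x ^ 2 * V := by
    have := mul_le_mul_of_nonneg_left hc hβx.le
    rw [hk]; linarith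
  have h2 := mul_le_mul_of_nonneg_left hV hk0
  have h3 : k * (r * ((ω - 2 * η) * n - 1)) = k * (r * ω) * n - k * (r * (2 * η * n + 1)) := by
    ring
  have h4 : k * (r * (2 * η * n + 1)) ≤ β * x * (r * (2 * η * n + 1)) := by gcongr
  have hm0 : min θ 0 ≤ 0 := min_le_right _ _
  have h5 : (β * x - x ^ 2) * (1 + min θ 0) - β * x * δ - β * x * (4 * ω) ≤ k * (r * ω) := by
    rw [hrω, hk]
    have h6 : β * x * δ * (1 + min θ 0) ≤ β * x * δ * 1 := by gcongr; linarith
    have h7 : k * (4 * ω) ≤ β * x * (4 * ω) := by gcongr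
    rw [hk] at h7
    linarith
  have h6 := mul_le_mul_of_nonneg_right h5 hn
  have h7 := mul_le_mul_of_nonneg_right hη hn
  have h8 := mul_le_mul_of_nonneg_right hδ hn
  have h9 := mul_le_mul_of_nonneg_right hω hn
  rw [hf]
  linarith

/-- The constants of the multiscale decomposition: `r` blocks of length `ω` fill the scales from
`-min θ 0` to `1` up to `4 ω`, `η` is the precision of the truncation and `δ` that of the
covariance. -/
lemma exists_scales {θ β x ε : ℝ} (hθ : -1 < θ) (hβ : 0 < β) (hx : 0 < x) (hε : 0 < ε) :
    ∃ (r : ℕ) (ω η δ : ℝ), 0 < ω ∧ 0 < η ∧ 0 < δ ∧ 2 * η ≤ ω ∧ r * ω = 1 + min θ 0 - 4 * ω ∧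
      2 * x * (r * η) ≤ ω / 2 ∧ β * x * (4 * ω) ≤ ε / 6 ∧
      (2 * β * x * r + β + 2 * x * r) * η ≤ ε / 6 ∧ β * x * δ ≤ ε / 6 ∧ δ ≤ 1 / 2 := by
  have hμ0 : 0 < 1 + min θ 0 := by
    have : -1 < min θ 0 := lt_min hθ (by norm_num)
    linarith
  have hμ1 : 1 + min θ 0 ≤ 1 := by linarith [min_le_right θ 0]
  obtain ⟨r, hr⟩ := exists_nat_ge (24 * (β * x) / ε)
  set ω := (1 + min θ 0) / (r + 4) with hω
  have hω0 : 0 < ω := by positivity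
  set q := 2 * β * x * r + β + 2 * x * r with hq
  have hq0 : 0 < q := by positivity
  refine ⟨r, ω, min (ω / 2) (min (ω / (4 * x * (r + 1))) (ε / (6 * q))),
    min (1 / 2) (ε / (6 * (β * x))), hω0, by positivity, by positivity, ?_, ?_, ?_, ?_, ?_, ?_,
    min_le_left _ _⟩
  · linarith [min_le_left (ω / 2) (min (ω / (4 * x * (r + 1))) (ε / (6 * q)))]
  · rw [hω]; field_simp; ring
  · have h1 : min (ω / 2) (min (ω / (4 * x * (r + 1))) (ε / (6 * q))) ≤ ω / (4 * x * (r + 1)) :=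
      (min_le_right _ _).trans (min_le_left _ _)
    calc _ ≤ 2 * x * ((r + 1) * (ω / (4 * x * (r + 1)))) := by gcongr; linarith
      _ = ω / 2 := by field_simp; norm_num
  · have h1 : ω ≤ 1 / (r + 4) := by rw [hω]; gcongr
    have h2 : 24 * (β * x) ≤ r * ε := (div_le_iff₀ hε).1 hr
    calc β * x * (4 * ω) ≤ β * x * (4 * (1 / (r + 4))) := by gcongr
      _ = 4 * (β * x) / (r + 4) := by ring
      _ ≤ ε / 6 := by
          rw [div_le_iff₀ (by positivity)]
          linarith
  · have h1 : min (ω / 2) (min (ω / (4 * x * (r + 1))) (ε / (6 * q))) ≤ ε / (6 * q) :=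
      (min_le_right _ _).trans (min_le_right _ _)
    calc _ ≤ q * (ε / (6 * q)) := by gcongr
      _ = ε / 6 := by field_simp
  · calc _ ≤ β * x * (ε / (6 * (β * x))) := by gcongr; exact min_le_right _ _
      _ = ε / 6 := by field_simp

/-- A family of probabilities tends to one if the complements have arbitrarily small outer
measure. -/
lemma tendsto_measureReal_one {μ : ℝ → Measure ℝ} {s : ℝ → Set ℝ}
    (hμ : ∀ᶠ T in atTop, IsProbabilityMeasure (μ T))
    (h : ∀ ε : ℝ, 0 < ε → ε ≤ 1 → ∀ᶠ T in atTop, (μ T).real (s T)ᶜ ≤ 20 * ε) :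
    Tendsto (fun T => (μ T).real (s T)) atTop (𝓝 1) := by
  rw [Metric.tendsto_nhds]
  intro δ hδ
  filter_upwards [h (min 1 (δ / 40)) (by positivity) (min_le_left _ _), hμ] with T hT hμT
  have h1 : 1 ≤ (μ T).real (s T) + (μ T).real (s T)ᶜ := by
    rw [← probReal_univ (μ := μ T), ← Set.union_compl_self (s T)]
    exact measureReal_union_le _ _
  have h2 : (μ T).real (s T) ≤ 1 := measureReal_le_one
  have h3 := min_le_right 1 (δ / 40)
  rw [Real.dist_eq, abs_lt]
  constructor <;> linarith

/-- The claim up to a probability `20 ε'`, for a fixed choice of the scales. -/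
lemma eventually_measure_compl_le {θ β ε x ω η δ ε' : ℝ} {r K : ℕ} (hβ : 0 < β)
    (hε : 0 < ε) (hx : 0 < x) (hxβ : 2 * x ≤ β) (hxθ : x ^ 2 ≤ 1 + max θ 0)
    (hf : freeEnergy θ β = θ + (β * x - x ^ 2) * (1 + min θ 0))
    (hω0 : 0 < ω) (hη0 : 0 < η) (hδ0 : 0 < δ) (hηω : 2 * η ≤ ω)
    (hrω : r * ω = 1 + min θ 0 - 4 * ω) (hrη : 2 * x * (r * η) ≤ ω / 2)
    (hω : β * x * (4 * ω) ≤ ε / 6) (hη : (2 * β * x * r + β + 2 * x * r) * η ≤ ε / 6)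
    (hδ : β * x * δ ≤ ε / 6) (hδ1 : δ ≤ 1 / 2) (hK : 3 ≤ K) (hKω : 1 / (K : ℝ) ≤ ω)
    (hε' : 0 < ε') (hε'1 : ε' ≤ 1) :
    ∀ᶠ T : ℝ in atTop, (uniformLaw T).real {t : ℝ | Real.log T ^ (freeEnergy θ β - ε) <
      ∫ h in (-(Real.log T ^ θ))..(Real.log T ^ θ),
        Real.exp (β * ∑ j ∈ Finset.Icc 1 (K - 3), P K T j t h)}ᶜ ≤ 20 * ε' := by
  have hK0 : (0 : ℝ) < K := by positivity
  have hm0 : min θ 0 ≤ 0 := min_le_right _ _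
  set a := -min θ 0 + 2 * ω with ha
  have ha0 : 0 < a := by linarith
  have haK : 1 / (K : ℝ) ≤ a := by linarith
  have harK : a + r * ω ≤ ((K : ℝ) - 2) / K := by
    have : ((K : ℝ) - 2) / K = 1 - 2 * (1 / K) := by field_simp
    rw [this]; linarith
  have hυ : ((K : ℝ) - 2) / K < 1 := by
    rw [div_lt_one hK0]; linarith
  obtain ⟨w, hw, q, hq, hmain⟩ := ScaleData.eventually_measure_integral_exp_le (C := 4) hx hη0
    (by norm_num) hυ hε' hε'1 hβ r
  have hsmall : ∀ᶠ A : ℝ in atTop, A ^ (-(ω / 2)) ≤ ε' / (r * Real.exp (r * x ^ 2) + 1) :=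
    eventually_rpow_neg_le (by positivity) (by positivity)
  filter_upwards [hmain, eventually_regular_fieldData (K := K) hK hω0.le hw r a η,
    eventually_abs_fieldData_v_sub_le hη0 hηω ha0 haK harK,
    eventually_sum_fieldData_cos_le hη0 hηω ha0 haK harK θ hq,
    eventually_le_fieldData_cov (K := K) hK hω0.le hδ0 r a η,
    Real.tendsto_log_atTop.eventually hsmall,
    Real.tendsto_log_atTop.eventually_ge_atTop 1,
    ScaleData.tendsto_loglog.eventually_ge_atTop (β * x * r * (2 / ε)),
    eventually_gt_atTop 0]
    with T hT hreg hv hcos hcov hsm hT1 hn hT0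
  have hA0 : 0 < Real.log T := by linarith
  have hn0 : 0 ≤ Real.log (Real.log T) := Real.log_nonneg hT1
  have hr1 : (r : ℝ) * ω ≤ 1 := by linarith
  have := isProbabilityMeasure_uniformLaw hT0
  have hL : 0 < Real.log T ^ θ := by positivity
  have h := hT (fieldData K r a ω η T) hreg rfl (Real.log T ^ θ)
    (fun i => Real.log T ^ (-(a + i * ω))) hL (fun i => by positivity) (fun i => ?_) hcos ?_
  · refine le_trans (measureReal_mono fun t ht => ?_) h
    simp only [Set.mem_compl_iff, Set.mem_ofPred_eq, not_lt, sum_P_eq hK hT1 r a ω η] at ht ⊢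
    refine ht.trans ?_
    rw [Real.rpow_def_of_pos hA0, Real.rpow_def_of_pos hA0, ← Real.exp_add]
    apply Real.exp_le_exp.2
    have hV : r * ((ω - 2 * η) * Real.log (Real.log T) - 1) ≤ (fieldData K r a ω η T).V := by
      calc _ = ∑ _i ∈ Finset.range r, ((ω - 2 * η) * Real.log (Real.log T) - 1) := by
            rw [Finset.sum_const, Finset.card_range, nsmul_eq_mul]
        _ ≤ _ := Finset.sum_le_sum fun i hi => by
          have := (abs_le.1 (hv i (Finset.mem_range.1 hi))).1
          linarith
    have hlarge : β * x * r ≤ ε / 2 * Real.log (Real.log T) := by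
      calc β * x * r = ε / 2 * (β * x * r * (2 / ε)) := by field_simp
        _ ≤ _ := by gcongr
    have := freeEnergy_sub_le hβ hx hxβ hf hn0 hω0.le hη0.le hδ0.le hrω hω hη hδ hδ1 hcov hV
      hlarge
    linarith
  · apply Real.rpow_le_rpow_of_exponent_le hT1
    push_cast
    linarith
  · refine (sum_exp_mul_rpow_le hx.le hω0.le hη0.le hT1 (fun i hi => ?_) hxθ hr1 hrη).trans ?_
    · have := (abs_le.1 (hv i hi)).2
      have : 0 ≤ 2 * η * Real.log (Real.log T) := by positivity
      linarith
    · refine mul_le_mul_of_nonneg_right ?_ hL.le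
      calc _ ≤ (r * Real.exp (r * x ^ 2) + 1) * (ε' / (r * Real.exp (r * x ^ 2) + 1)) := by
            gcongr; linarith
        _ = ε' := by field_simp

end ZetaFreezing

end

theorem proposition3p10 (θ β ε : ℝ) (hθ : -1 < θ) (hβ : 0 < β) (hε : 0 < ε) :
    ∃ K₀ : ℕ, ∀ K : ℕ, K₀ ≤ K →
      Tendsto
        (fun T : ℝ => (ZetaFreezing.uniformLaw T).real
          {t : ℝ | Real.log T ^ (ZetaFreezing.freeEnergy θ β - ε) <
            ∫ h in (-(Real.log T ^ θ))..(Real.log T ^ θ),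
              Real.exp (β * ∑ j ∈ Finset.Icc 1 (K - 3), ZetaFreezing.P K T j t h)})
        atTop (𝓝 1) := by
  obtain ⟨x, hx, hxβ, hxθ, hf⟩ := ZetaFreezing.exists_tilt (θ := θ) hβ
  obtain ⟨r, ω, η, δ, hω0, hη0, hδ0, hηω, hrω, hrη, hω, hη, hδ, hδ1⟩ :=
    ZetaFreezing.exists_scales hθ hβ hx hε
  refine ⟨max 3 ⌈1 / ω⌉₊, fun K hK => ZetaFreezing.tendsto_measureReal_one ?_ ?_⟩
  · filter_upwards [eventually_gt_atTop 0] with T hT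
    exact ZetaFreezing.isProbabilityMeasure_uniformLaw hT
  · intro ε' hε' hε'1
    have hK3 : 3 ≤ K := (le_max_left _ _).trans hK
    have hK0 : (0 : ℝ) < K := by positivity
    have hKω : 1 / (K : ℝ) ≤ ω := by
      rw [one_div_le hK0 hω0]
      exact (Nat.le_ceil _).trans (by exact_mod_cast (le_max_right _ _).trans hK)
    exact ZetaFreezing.eventually_measure_compl_le hβ hε hx hxβ hxθ hf hω0 hη0 hδ0 hηω hrω hrη
      hω hη hδ hδ1 hK3 hKω hε' hε'1
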